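/- **Conventions.** The finite types are generated from $0$ by $\sigma,\tau\mapsto(\sigma\to\tau)$; the pure types are $1=0\to0$ and, in general, $k+1=k\to 0$. A functional $H^2:\mathbb N^{\mathbb N}\to\mathbb N$ is *normal* if it computes, via Kleene's schemes S1–S9, the functional $\exists^2$, where $\exists^2(f)=0$ if $(\exists n)(f(n)=0)$ and $\exists^2(f)=1$ otherwise. For normal $H^2$ let $\mathcal M^H$ be the type structure of $H$-computable functionals: $\mathcal M^H_0=\mathbb N$, and $\mathcal M^H_{k+1}$ consists of all $\phi:\mathcal M^H_k\to\mathbb N$ that are computable in $H$ via S1–S9; likewise, for non-pure types, $\mathcal M^H_{\sigma_1\to\dots\to\sigma_n\to0}$ consists of all $\phi:\mathcal M^H_{\sigma_1}\times\dots\times\mathcal M^H_{\sigma_n}\to\mathbb N$ that are computable in $H$ via S1–S9. (Computations with arguments from $\mathcal M^H$ are interpreted over $\mathcal M^H$: variables of higher type range over $\mathcal M^H$.) Let $C^H$ be the set of $f\in\mathcal M^H_1$ with $f(n)\le1$ for all $n$. For $F,G\in\mathcal M^H_2$ let $\mathsf{LOC}(F,G)$ be the statement $$(\forall f,g\in C^H)\big[(\forall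 m<G(f))(g(m)=f(m))\to F(g)\le G(f)\big].$$ **Theorem.** Let $H^2$ be normal. Then: 1. $\mathcal M^H$ satisfies $\mathsf{QF\text{-}AC}^{0,1}$: for every quantifier-free formula $A(x^0,y^1)$ of the language of finite-type arithmetic (typed variables, application, the constants $0,1,+,\times$, the combinators $K,S$ and the recursors $\mathbf R_\sigma$ of all finite types, and the relations $=_0,<_0$), with parameters of arbitrary finite types from $\mathcal M^H$, if for all $x\in\mathbb N$ there is $y\in\mathcal M^H_1$ such that $A(x,y)$ holds in $\mathcal M^H$, then there is $Y\in\mathcal M^H_{0\to1}$ such that for all $x\in\mathbb N$, $A(x,Y(x))$ holds in $\mathcal M^H$. 2. $\mathcal M^H$ satisfies $\neg\mathsf{PIT}_{\mathsf u}$: it is not the case that for every $G\in\mathcal M^H_2$ there is $N\in\mathbb N$ such that for all $F\in\mathcal M^H_2$, $\mathsf{LOC}(F,G)\to(\forall g\in C^H)(F(g)\le N)$. 3. $\mathcal M^H$ satisfies $\mathsf{PIT}_o$: for all $F,G\in\mathcal M^H_2$ there is $N\in\mathbb N$ such that $\mathsf{LOC}(F,G)\to(\forall g\in C^H)(F(g)\le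 N)$. 4. $\mathcal M^H$ contains no weak Pincherle realiser: there is no $M_o\in\mathcal M^H_{2\to2\to0}$ such that for all $F,G\in\mathcal M^H_2$, $\mathsf{LOC}(F,G)\to(\forall g\in C^H)(F(g)\le M_o(F,G))$. 5. $\mathcal M^H$ contains no Pincherle realiser: there is no $M_u\in\mathcal M^H_3$ such that for all $F,G\in\mathcal M^H_2$, $\mathsf{LOC}(F,G)\to(\forall g\in C^H)(F(g)\le M_u(G))$. -/

import Mathlib

namespace HigherType

/-! ## Finite types and the full type structure -/

/-- The finite types: `0` and `σ ⇒ τ`. -/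
inductive Ty : Type
  | nat : Ty
  | arr : Ty → Ty → Ty
  deriving DecidableEq

namespace Ty

/-- The pure types `0`, `1 = 0 ⇒ 0`, `2 = 1 ⇒ 0`, ... -/
abbrev pure : ℕ → Ty
  | 0 => nat
  | k + 1 => arr (pure k) nat

/-- The type level: `lev 0 = 0` and `lev (σ ⇒ τ) = max (lev σ + 1) (lev τ)`. -/
def level : Ty → ℕ
  | nat => 0
  | arr σ τ => max (level σ + 1) (level τ)

/-- The list of argument types: `σ₁, ..., σₙ` for `σ₁ ⇒ ... ⇒ σₙ ⇒ 0`. -/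
abbrev args : Ty → List Ty
  | nat => []
  | arr σ τ => σ :: args τ

end Ty

/-- The full type structure over `ℕ`. -/
abbrev Full : Ty → Type
  | Ty.nat => ℕ
  | Ty.arr σ τ => Full σ → Full τ

/-- The functional of type `σ` that is constantly `0`. -/
def Full.zero : (σ : Ty) → Full σ
  | Ty.nat => (0 : ℕ)
  | Ty.arr _ τ => fun _ => Full.zero τ

/-- A full tuple of arguments for a functional of type `σ`. -/
abbrev Args (σ : Ty) : Type := (i : Fin σ.args.length) → Full (σ.args.get i)

/-- The number `Φ(ξ₁, ..., ξₙ)`. -/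
def Full.apply : (σ : Ty) → Full σ → Args σ → ℕ
  | Ty.nat, v, _ => v
  | Ty.arr _ τ, Φ, ξ => Full.apply τ (Φ (ξ ⟨0, Nat.succ_pos _⟩)) (fun i => ξ i.succ)

/-- Lists of arguments of mixed types. -/
abbrev Env : Type := List (Sigma Full)

def Args.toEnv {σ : Ty} (ξ : Args σ) : Env := List.ofFn fun i => ⟨σ.args.get i, ξ i⟩

/-- The number `n`, as an entry of an argument list. -/
abbrev num (n : ℕ) : Sigma Full := ⟨Ty.nat, n⟩

/-- A choice, at each type, of the functionals that count as objects of that type. -/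
abbrev Family : Type := (σ : Ty) → Set (Full σ)

/-- All members of the tuple `ξ` are objects of the family. -/
def Args.In {σ : Ty} (P : Family) (ξ : Args σ) : Prop := ∀ i, ξ i ∈ P (σ.args.get i)

/-! ## Kleene's schemes S1-S9 -/

/-- Sequence numbers `⟨l₀, ..., lₙ⟩`; these are the indices of computations. -/
def ix (l : List ℕ) : ℕ := Encodable.encode l

/-- `Comp H P e Γ a` says that `{e}(Γ) = a` by Kleene's schemes S1-S9, where the functional `H`
of type two is available as a fixed further argument and where the arguments of higher type are
interpreted over the type structure `P`: variables range over `P`, and the functionals to which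
an argument is applied in S8 must be in `P`. In S8 the head argument `Φ` may have any type
`τ₁ ⇒ ... ⇒ τₙ ⇒ 0`; for `Φ` of pure type this is Kleene's original scheme. -/
inductive Comp (H : (ℕ → ℕ) → ℕ) (P : Family) : ℕ → Env → ℕ → Prop
  /-- S1: `{e}(x, Γ) = x + 1`. -/
  | s1 (x : ℕ) (Γ : Env) : Comp H P (ix [1]) (num x :: Γ) (x + 1)
  /-- S2: `{e}(Γ) = q`. -/
  | s2 (q : ℕ) (Γ : Env) : Comp H P (ix [2, q]) Γ q
  /-- S3: `{e}(x, Γ) = x`. -/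
  | s3 (x : ℕ) (Γ : Env) : Comp H P (ix [3]) (num x :: Γ) x
  /-- S4: `{e}(Γ) = {c}({d}(Γ), Γ)`. -/
  | s4 (c d b a : ℕ) (Γ : Env) (hd : Comp H P d Γ b) (hc : Comp H P c (num b :: Γ) a) :
      Comp H P (ix [4, c, d]) Γ a
  /-- S5, first clause: `{e}(0, Γ) = {c}(Γ)`. -/
  | s5_zero (c d a : ℕ) (Γ : Env) (hc : Comp H P c Γ a) :
      Comp H P (ix [5, c, d]) (num 0 :: Γ) a
  /-- S5, second clause: `{e}(x + 1, Γ) = {d}(x, {e}(x, Γ), Γ)`. -/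
  | s5_succ (c d x b a : ℕ) (Γ : Env) (hx : Comp H P (ix [5, c, d]) (num x :: Γ) b)
      (hd : Comp H P d (num x :: num b :: Γ) a) :
      Comp H P (ix [5, c, d]) (num (x + 1) :: Γ) a
  /-- S6: `{e}(Γ) = {d}(Γ')`, where `Γ'` arises from `Γ` by moving the entry at position `k`
  to the front. -/
  | s6 (d k a : ℕ) (Γ : Env) (hk : k < Γ.length) (hd : Comp H P d (Γ[k] :: Γ.eraseIdx k) a) :
      Comp H P (ix [6, d, k]) Γ a
  /-- S7: `{e}(f, x, Γ) = f(x)`. -/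
  | s7 (f : ℕ → ℕ) (x : ℕ) (Γ : Env) :
      Comp H P (ix [7]) (⟨Ty.arr Ty.nat Ty.nat, f⟩ :: num x :: Γ) (f x)
  /-- S8: `{e}(Φ, Γ) = Φ(F₁, ..., Fₙ)` with `Fᵢ = λ ξ. {dᵢ}(ξ, Φ, Γ)`, provided that all these
  functionals are total and objects of the type structure. -/
  | s8 (σ : Ty) (Φ : Full σ) (Γ : Env) (d : Fin σ.args.length → ℕ) (F : Args σ)
      (hF : F.In P)
      (hd : ∀ (i : Fin σ.args.length) (ξ : Args (σ.args.get i)), ξ.In P →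
        Comp H P (d i) (ξ.toEnv ++ ⟨σ, Φ⟩ :: Γ) (Full.apply (σ.args.get i) (F i) ξ)) :
      Comp H P (ix (8 :: List.ofFn d)) (⟨σ, Φ⟩ :: Γ) (Full.apply σ Φ F)
  /-- S8 for the fixed argument `H`: `{e}(Γ) = H(λ n. {d}(n, Γ))`. -/
  | s8_oracle (d : ℕ) (f : ℕ → ℕ) (Γ : Env) (hd : ∀ n, Comp H P d (num n :: Γ) (f n)) :
      Comp H P (ix [0, d]) Γ (H f)
  /-- S9: `{e}(x, Γ) = {x}(Γ')`, where `Γ'` consists of the first `m` entries of `Γ`. -/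
  | s9 (x m a : ℕ) (Γ : Env) (hx : Comp H P x (Γ.take m) a) :
      Comp H P (ix [9, m]) (num x :: Γ) a

/-- `φ` is, on tuples of objects of `P`, a functional computable in `H`. A function that is
defined only on tuples of objects of `P` is identified with its extension by `0`. -/
def ComputableIn (H : (ℕ → ℕ) → ℕ) (P : Family) (σ : Ty) (φ : Full σ) : Prop :=
  (∃ e, ∀ ξ : Args σ, ξ.In P → Comp H P e ξ.toEnv (Full.apply σ φ ξ)) ∧
    ∀ ξ : Args σ, ¬ ξ.In P → Full.apply σ φ ξ = 0

open Classical in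
/-- The functional `∃²`. -/
noncomputable def existsTwo (f : ℕ → ℕ) : ℕ := if ∃ n, f n = 0 then 0 else 1

/-- `H` is normal: it computes `∃²`. -/
def Normal (H : (ℕ → ℕ) → ℕ) : Prop :=
  ∃ e, ∀ f : ℕ → ℕ, Comp H (fun _ => Set.univ) e [⟨Ty.pure 1, f⟩] (existsTwo f)

/-! ## The type structure of `H`-computable functionals -/

/-- The stages of the recursion on type level that defines the structure: the stage `n` is the
intended one at the types of level at most `n`. -/
def stage (H : (ℕ → ℕ) → ℕ) : ℕ → Family
  | 0 => fun _ => Set.univ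
  | n + 1 => fun σ => {φ | ComputableIn H (stage H n) σ φ}

/-- The type structure `𝓜^H`: its objects of type `0` are the numbers, and its objects of type
`σ₁ ⇒ ... ⇒ σₙ ⇒ 0` are the functionals on its objects of types `σ₁, ..., σₙ` that are computable
in `H`. -/
def M (H : (ℕ → ℕ) → ℕ) : Family := fun σ => stage H σ.level σ

theorem Ty.level_lt {σ τ : Ty} (h : τ ∈ σ.args) : τ.level < σ.level := by
  induction σ with
  | nat => simp [Ty.args] at h
  | arr α β _ ih =>
    simp only [Ty.args, List.mem_cons] at h
    simp only [Ty.level]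
    rcases h with rfl | h
    · omega
    · have := ih h; omega

theorem Ty.level_get_lt (σ : Ty) (i : Fin σ.args.length) : (σ.args.get i).level < σ.level :=
  Ty.level_lt (List.get_mem _ _)

theorem Comp.congr {H : (ℕ → ℕ) → ℕ} {P Q : Family} {n : ℕ}
    (hPQ : ∀ τ : Ty, τ.level < n → P τ = Q τ) {e : ℕ} {Γ : Env} {a : ℕ}
    (h : Comp H P e Γ a) (hΓ : ∀ v ∈ Γ, v.1.level ≤ n) : Comp H Q e Γ a := by
  have h0 : ∀ x, (num x).1.level ≤ n := fun x => Nat.zero_le _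
  induction h with
  | s1 => exact .s1 _ _
  | s2 => exact .s2 _ _
  | s3 => exact .s3 _ _
  | s4 c d b a Γ hd hc id ic =>
    refine .s4 _ _ b _ _ (id hΓ) (ic ?_)
    exact List.forall_mem_cons.2 ⟨h0 _, hΓ⟩
  | s5_zero c d a Γ hc ih => exact .s5_zero _ _ _ _ (ih fun v hv => hΓ v (List.mem_cons_of_mem _ hv))
  | s5_succ c d x b a Γ hx hd ix id =>
    have h1 : ∀ v ∈ Γ, v.1.level ≤ n := fun v hv => hΓ v (List.mem_cons_of_mem _ hv)
    refine .s5_succ _ _ _ b _ _ (ix ?_) (id ?_)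
    · exact List.forall_mem_cons.2 ⟨h0 _, h1⟩
    · exact List.forall_mem_cons.2 ⟨h0 _, List.forall_mem_cons.2 ⟨h0 _, h1⟩⟩
  | s6 d k a Γ hk hd ih =>
    refine .s6 _ _ _ _ hk (ih ?_)
    intro v hv
    rcases List.mem_cons.1 hv with rfl | hv
    · exact hΓ _ (List.getElem_mem _)
    · exact hΓ _ (List.mem_of_mem_eraseIdx hv)
  | s7 => exact .s7 _ _ _
  | s8 σ Φ Γ d F hF hd ih =>
    have hσ : σ.level ≤ n := hΓ ⟨σ, Φ⟩ (by simp)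
    refine .s8 _ _ _ _ _ ?_ ?_
    · intro i
      rw [← hPQ _ (lt_of_lt_of_le (σ.level_get_lt i) hσ)]
      exact hF i
    · intro i ξ hξ
      have hi := σ.level_get_lt i
      refine ih i ξ ?_ ?_
      · intro j
        rw [hPQ _ (by have := (σ.args.get i).level_get_lt j; omega)]
        exact hξ j
      · intro v hv
        rcases List.mem_append.1 hv with hv | hv
        · obtain ⟨j, rfl⟩ := (List.mem_ofFn' _ _).1 hv
          have := (σ.args.get i).level_get_lt j
          show ((σ.args.get i).args.get j).level ≤ n
          omega
        · exact hΓ v hv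
  | s8_oracle d f Γ hd ih =>
    refine .s8_oracle _ _ _ fun m => ih m ?_
    exact List.forall_mem_cons.2 ⟨h0 _, hΓ⟩
  | s9 x m a Γ hx ih =>
    exact .s9 _ _ _ _ (ih fun v hv => hΓ v (List.mem_cons_of_mem _ (List.mem_of_mem_take hv)))

theorem ComputableIn.congr {H : (ℕ → ℕ) → ℕ} {P Q : Family} {n : ℕ}
    (hPQ : ∀ τ : Ty, τ.level < n → P τ = Q τ) {σ : Ty} (hσ : σ.level ≤ n) {φ : Full σ}
    (h : ComputableIn H P σ φ) : ComputableIn H Q σ φ := by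
  have hin : ∀ ξ : Args σ, ξ.In P ↔ ξ.In Q := fun ξ => forall_congr' fun i => by
    rw [hPQ _ (lt_of_lt_of_le (σ.level_get_lt i) hσ)]
  obtain ⟨⟨e, he⟩, h0⟩ := h
  refine ⟨⟨e, fun ξ hξ => (he ξ ((hin ξ).2 hξ)).congr hPQ ?_⟩, fun ξ hξ => h0 ξ (mt (hin ξ).1 hξ)⟩
  intro v hv
  obtain ⟨j, rfl⟩ := (List.mem_ofFn' _ _).1 hv
  have := σ.level_get_lt j
  show (σ.args.get j).level ≤ n
  omega

theorem stage_eq (H : (ℕ → ℕ) → ℕ) (n : ℕ) : ∀ σ : Ty, σ.level ≤ n → stage H n σ = M H σ := by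
  induction n using Nat.strong_induction_on with
  | _ n ih =>
    intro σ hσ
    match n, hk : σ.level with
    | 0, 0 => simp [M, hk]
    | 0, k + 1 => omega
    | n + 1, 0 =>
      match σ with
      | Ty.nat =>
        refine Set.eq_univ_of_forall fun v => ⟨⟨ix [2, v], fun ξ _ => .s2 _ _⟩, fun ξ hξ => ?_⟩
        exact (hξ fun i => i.elim0).elim
      | Ty.arr α β => simp only [Ty.level] at hk; omega
    | n + 1, k + 1 =>
      have key : ∀ τ : Ty, τ.level < k + 1 → stage H n τ = stage H k τ := fun τ hτ => by
        rw [ih n (by omega) τ (by omega), ih k (by omega) τ (by omega)]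
      ext φ
      simp only [M, hk]
      exact ⟨fun h => h.congr key hk.le, fun h => h.congr (fun τ hτ => (key τ hτ).symm) hk.le⟩

/-- The defining property of `𝓜^H`: an object of type `σ` is a functional computable in `H`,
in the sense of S1-S9 over `𝓜^H` itself. -/
theorem mem_M_iff (H : (ℕ → ℕ) → ℕ) (σ : Ty) (φ : Full σ) :
    φ ∈ M H σ ↔ ComputableIn H (M H) σ φ := by
  rw [← stage_eq H (σ.level + 1) σ (Nat.le_succ _)]
  have key : ∀ τ : Ty, τ.level < σ.level + 1 → stage H σ.level τ = M H τ :=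
    fun τ hτ => stage_eq H _ τ (by omega)
  exact ⟨fun h => h.congr key (Nat.le_succ _),
    fun h => h.congr (fun τ hτ => (key τ hτ).symm) (Nat.le_succ _)⟩

/-! ## The language of finite types and quantifier-free choice -/

/-- Terms; `var σ n` is the `n`-th variable of type `σ`. -/
inductive Term : Ty → Type
  | var (σ : Ty) (n : ℕ) : Term σ
  | app {σ τ : Ty} (t : Term (Ty.arr σ τ)) (s : Term σ) : Term τ
  | zero : Term Ty.nat
  | one : Term Ty.nat
  | add : Term (Ty.arr Ty.nat (Ty.arr Ty.nat Ty.nat))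
  | mul : Term (Ty.arr Ty.nat (Ty.arr Ty.nat Ty.nat))
  | combK (σ τ : Ty) : Term (Ty.arr σ (Ty.arr τ σ))
  | combS (ρ σ τ : Ty) :
      Term (Ty.arr (Ty.arr ρ (Ty.arr σ τ)) (Ty.arr (Ty.arr ρ σ) (Ty.arr ρ τ)))
  | recursor (σ : Ty) :
      Term (Ty.arr (Ty.arr Ty.nat (Ty.arr σ σ)) (Ty.arr σ (Ty.arr Ty.nat σ)))

/-- Quantifier-free formulas. -/
inductive QF : Type
  | eq (t s : Term Ty.nat) : QF
  | lt (t s : Term Ty.nat) : QF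
  | not (A : QF) : QF
  | and (A B : QF) : QF
  | or (A B : QF) : QF
  | imp (A B : QF) : QF

/-- Assignments of values to all variables. -/
abbrev Assignment : Type := (v : Ty × ℕ) → Full v.1

open Classical in
/-- The restriction of a functional to the objects of `P` (extended by `0`). -/
noncomputable def restrict (P : Family) : (σ : Ty) → Full σ → Full σ
  | Ty.nat, v => v
  | Ty.arr σ τ, φ => fun x : Full σ => if x ∈ P σ then restrict P τ (φ x) else Full.zero τ

/-- The value of a term in the type structure `P`; the constants denote the restrictions to `P`
of the usual functionals. -/
noncomputable def Term.eval (P : Family) (ρ : Assignment) : {σ : Ty} → Term σ → Full σ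
  | _, var σ n => ρ (σ, n)
  | _, app t s => (t.eval P ρ) (s.eval P ρ)
  | _, zero => (0 : ℕ)
  | _, one => (1 : ℕ)
  | _, add => fun m n : ℕ => (m + n : ℕ)
  | _, mul => fun m n : ℕ => (m * n : ℕ)
  | _, combK _ _ => restrict P _ fun x _ => x
  | _, combS _ _ _ => restrict P _ fun f g x => f x (g x)
  | _, recursor σ => restrict P _ fun f m n => Nat.rec (motive := fun _ => Full σ) m f n

/-- Truth of a quantifier-free formula in the type structure `P`. -/
def QF.Holds (P : Family) (ρ : Assignment) : QF → Prop
  | eq t s => (show ℕ from t.eval P ρ) = (show ℕ from s.eval P ρ)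
  | lt t s => (show ℕ from t.eval P ρ) < (show ℕ from s.eval P ρ)
  | not A => ¬ A.Holds P ρ
  | and A B => A.Holds P ρ ∧ B.Holds P ρ
  | or A B => A.Holds P ρ ∨ B.Holds P ρ
  | imp A B => A.Holds P ρ → B.Holds P ρ

/-- `P` satisfies `QF-AC^{σ,τ}`: for every quantifier-free formula `A(x, y)`, with variables `x` of
type `σ` and `y` of type `τ`, and all values in `P` of the other variables,
`(∀ x)(∃ y) A(x, y) → (∃ Y)(∀ x) A(x, Y(x))`. -/
def QFAC (P : Family) (σ τ : Ty) : Prop :=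
  ∀ (A : QF) (i j : ℕ), (σ, i) ≠ (τ, j) →
    ∀ ρ : Assignment, (∀ v, ρ v ∈ P v.1) →
      (∀ x ∈ P σ, ∃ y ∈ P τ,
        A.Holds P (Function.update (Function.update ρ (σ, i) x) (τ, j) y)) →
      ∃ Y ∈ P (Ty.arr σ τ), ∀ x ∈ P σ,
        A.Holds P (Function.update (Function.update ρ (σ, i) x) (τ, j) (Y x))

/-! ## Pincherle's theorem and its realisers, in a type structure -/

/-- The elements of Cantor space in `P`. -/
def Cantor (P : Family) : Set (ℕ → ℕ) := {f | f ∈ P (Ty.pure 1) ∧ ∀ n, f n ≤ 1}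

/-- `LOC(F, G)` in `P`: if `f, g` are in Cantor space and `g` agrees with `f` below `G(f)`, then
`F(g) ≤ G(f)`. -/
def LOC (P : Family) (F G : (ℕ → ℕ) → ℕ) : Prop :=
  ∀ f ∈ Cantor P, ∀ g ∈ Cantor P, (∀ m < G f, g m = f m) → F g ≤ G f

/-- The original version of Pincherle's theorem, in `P`. -/
def PITo (P : Family) : Prop :=
  ∀ F G : (ℕ → ℕ) → ℕ, F ∈ P (Ty.pure 2) → G ∈ P (Ty.pure 2) → ∃ N : ℕ,
    LOC P F G → ∀ g ∈ Cantor P, F g ≤ N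

/-- The uniform version of Pincherle's theorem, in `P`. -/
def PITu (P : Family) : Prop :=
  ∀ G : (ℕ → ℕ) → ℕ, G ∈ P (Ty.pure 2) → ∃ N : ℕ, ∀ F : (ℕ → ℕ) → ℕ, F ∈ P (Ty.pure 2) →
    LOC P F G → ∀ g ∈ Cantor P, F g ≤ N

/-- `Mu` is, in `P`, a Pincherle realiser. -/
def PR (P : Family) (Mu : ((ℕ → ℕ) → ℕ) → ℕ) : Prop :=
  ∀ F G : (ℕ → ℕ) → ℕ, F ∈ P (Ty.pure 2) → G ∈ P (Ty.pure 2) →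
    LOC P F G → ∀ g ∈ Cantor P, F g ≤ Mu G

/-- `Mo` is, in `P`, a weak Pincherle realiser. -/
def WPR (P : Family) (Mo : ((ℕ → ℕ) → ℕ) → ((ℕ → ℕ) → ℕ) → ℕ) : Prop :=
  ∀ F G : (ℕ → ℕ) → ℕ, F ∈ P (Ty.pure 2) → G ∈ P (Ty.pure 2) →
    LOC P F G → ∀ g ∈ Cantor P, F g ≤ Mo F G

end HigherType

/-! The engine is Gandy selection: relative to a normal `H`, a number at which a given family of
computations terminates can be computed, if there is one. S8 and arguments of higher type make this
awkward to prove on the schemes themselves. They are therefore traded for a machine whose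
configurations are numbers and whose single steps are primitive recursive. Kleene computations run
on the machine through realizers (`exists_interpreter`), and machine computations are compiled back
into indices (`exists_translation`). So membership in `M H` means having a program, up to the
default value 0 off the structure (`HasRealizer.of_mem`, `HasRealizer.mem`). In the empty world a
terminating computation is a well-founded, countably branching tree. Since `∃²` quantifies over its
branches, ordinal ranks of computations can be compared (`Normal.exists_comparison`), and
`Normal.exists_selection` follows.

Choice: truth of a quantifier-free formula is decided by the machine, so selection finds from `x` an
index of a suitable `y`.

Original Pincherle: if `LOC(F, G)` holds but `F` is unbounded on Cantor space, selection yields a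
sequence in the structure with `F(y n) > n`. With `∃²` a cluster point `z` is computed. For some `n
≥ G(z)` the function `y n` agrees with `z` below `G(z)`, whence `n < F(y n) ≤ G(z) ≤ n`.

Negative parts: selection gives `G` with `G(f) = e + 1`, where `e` is an index of `f`.
Diagonalising, choose a 0-1 function `s` with `s(e) ≠ f(e)` whenever `G(f) = e + 1`; the
neighbourhoods given by `G` do not cover `s`. If `g` agrees with `s` below `N`, the functional with
value `N + 1` at `g` and 0 elsewhere satisfies `LOC` with `G` (`Normal.exists_escape`). As `N` is
arbitrary, no bound depends on `G` alone. For a weak realiser, let `N` be its value at `(0, G)`. The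
functions passed to the first argument in that computation are indexed by paths, so diagonalising
over paths gives a computable `g` that is never passed and agrees with `s` below `N`
(`exists_not_queried`). Replacing 0 by the spike at `g` does not change the computation, yet the
spike exceeds `N`. -/

namespace HigherType
open Nat.Partrec (Code)

attribute [fun_prop] Primrec
attribute [fun_prop] Primrec.id Primrec.const Primrec.comp Primrec.pair Primrec.fst Primrec.snd

/-! ## Primitive recursive functions in compositional form -/

namespace Prim

variable {α β γ σ : Type*} [Primcodable α] [Primcodable β] [Primcodable γ] [Primcodable σ]

@[fun_prop]
theorem fst {f : α → β × γ} (hf : Primrec f) : Primrec fun a => (f a).1 := Primrec.fst.comp hf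

@[fun_prop]
theorem snd {f : α → β × γ} (hf : Primrec f) : Primrec fun a => (f a).2 := Primrec.snd.comp hf

@[fun_prop]
theorem natPair {f g : α → ℕ} (hf : Primrec f) (hg : Primrec g) :
    Primrec fun a => Nat.pair (f a) (g a) := Primrec₂.natPair.comp hf hg

@[fun_prop]
theorem unpair {f : α → ℕ} (hf : Primrec f) : Primrec fun a => Nat.unpair (f a) :=
  Primrec.unpair.comp hf

@[fun_prop]
theorem add {f g : α → ℕ} (hf : Primrec f) (hg : Primrec g) : Primrec fun a => f a + g a :=
  Primrec.nat_add.comp hf hg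

@[fun_prop]
theorem sub {f g : α → ℕ} (hf : Primrec f) (hg : Primrec g) : Primrec fun a => f a - g a :=
  Primrec.nat_sub.comp hf hg

@[fun_prop]
theorem mul {f g : α → ℕ} (hf : Primrec f) (hg : Primrec g) : Primrec fun a => f a * g a :=
  Primrec.nat_mul.comp hf hg

@[fun_prop]
theorem map {f : α → List β} {g : α → β → σ} (hf : Primrec f)
    (hg : Primrec fun p : α × β => g p.1 p.2) : Primrec fun a => (f a).map (g a) :=
  Primrec.list_map hf hg

@[fun_prop]
theorem cons {f : α → List β} {g : α → β} (hf : Primrec f) (hg : Primrec g) :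
    Primrec fun a => g a :: f a := Primrec.list_cons.comp hg hf

@[fun_prop]
theorem append {f g : α → List β} (hf : Primrec f) (hg : Primrec g) :
    Primrec fun a => f a ++ g a := Primrec.list_append.comp hf hg

@[fun_prop]
theorem tail {f : α → List β} (hf : Primrec f) : Primrec fun a => (f a).tail :=
  Primrec.list_tail.comp hf

@[fun_prop]
theorem length {f : α → List β} (hf : Primrec f) : Primrec fun a => (f a).length :=
  Primrec.list_length.comp hf

@[fun_prop]
theorem range {f : α → ℕ} (hf : Primrec f) : Primrec fun a => List.range (f a) :=
  Primrec.list_range.comp hf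

@[fun_prop]
theorem take {f : α → List β} {g : α → ℕ} (hf : Primrec f) (hg : Primrec g) :
    Primrec fun a => (f a).take (g a) := Primrec.list_take.comp hg hf

@[fun_prop]
theorem drop {f : α → List β} {g : α → ℕ} (hf : Primrec f) (hg : Primrec g) :
    Primrec fun a => (f a).drop (g a) := Primrec.list_drop.comp hg hf

@[fun_prop]
theorem getD {f : α → List β} {g : α → ℕ} (d : β) (hf : Primrec f) (hg : Primrec g) :
    Primrec fun a => (f a).getD (g a) d := (Primrec.list_getD d).comp hf hg

@[fun_prop]
theorem idxOf [DecidableEq β] {f : α → List β} {g : α → β} (hf : Primrec f) (hg : Primrec g) :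
    Primrec fun a => (f a).idxOf (g a) := Primrec.list_idxOf.comp hg hf

@[fun_prop]
theorem optionGetD {f : α → Option β} {g : α → β} (hf : Primrec f) (hg : Primrec g) :
    Primrec fun a => (f a).getD (g a) := Primrec.option_getD.comp hf hg

@[fun_prop]
theorem encode {f : α → β} (hf : Primrec f) : Primrec fun a => Encodable.encode (f a) :=
  Primrec.encode.comp hf

@[fun_prop]
theorem decode {f : α → ℕ} (hf : Primrec f) :
    Primrec fun a => (Encodable.decode (f a) : Option β) := Primrec.decode.comp hf

@[fun_prop]
theorem ite_eq [DecidableEq β] {f g : α → β} {h k : α → σ} (hf : Primrec f) (hg : Primrec g)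
    (hh : Primrec h) (hk : Primrec k) : Primrec fun a => if f a = g a then h a else k a :=
  Primrec.ite (Primrec.eq.comp hf hg) hh hk

@[fun_prop]
theorem ite_lt {f g : α → ℕ} {h k : α → σ} (hf : Primrec f) (hg : Primrec g)
    (hh : Primrec h) (hk : Primrec k) : Primrec fun a => if f a < g a then h a else k a :=
  Primrec.ite (Primrec.nat_lt.comp hf hg) hh hk

@[fun_prop]
theorem ofNatCode {f : α → ℕ} (hf : Primrec f) :
    Primrec fun a => Denumerable.ofNat Code (f a) := (Primrec.ofNat Code).comp hf

@[fun_prop]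
theorem evaln {f g : α → ℕ} {c : α → Code} (hf : Primrec f) (hc : Primrec c) (hg : Primrec g) :
    Primrec fun a => Code.evaln (f a) (c a) (g a) :=
  Code.primrec_evaln.comp ((hf.pair hc).pair hg)

@[fun_prop]
theorem curry {f : α → Code} {g : α → ℕ} (hf : Primrec f) (hg : Primrec g) :
    Primrec fun a => Code.curry (f a) (g a) := Code.primrec₂_curry.comp hf hg

end Prim

/-! ## A machine for computation relative to a functional of type two

Configurations are numbers. A configuration returns a value, or is stuck, or asks an oracle about
the function computed by a family of further configurations and continues with the answer. -/

/-- The configuration that performs the action `a`. -/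
def act (a : ℕ) : ℕ := Nat.pair 0 (Nat.pair 0 a)

/-- The action that returns `v`. -/
def retAct (v : ℕ) : ℕ := Nat.pair 0 (Nat.pair v 0)

/-- The configuration that runs the program `p` on the input `x`. -/
def run (p x : ℕ) : ℕ := Nat.pair 0 (Nat.pair (p + 1) (Nat.pair x 0))

/-- The action of a configuration. -/
def action (c : ℕ) : ℕ :=
  if c.unpair.2.unpair.1 = 0 then c.unpair.2.unpair.2 else
    -- Tag 3 goes to another configuration: the result of the program if the step bound suffices,
    -- else the same run with a larger bound. Thus `action` stays primitive recursive although
    -- programs are partial recursive.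
    Nat.pair 3 ((Code.evaln c.unpair.2.unpair.2.unpair.2
      (Denumerable.ofNat Code (c.unpair.2.unpair.1 - 1)) c.unpair.2.unpair.2.unpair.1).getD
        (Nat.pair 0 (Nat.pair c.unpair.2.unpair.1
          (Nat.pair c.unpair.2.unpair.2.unpair.1 (c.unpair.2.unpair.2.unpair.2 + 1)))))

/-- Raising the mode of a configuration. -/
def addMode (m c : ℕ) : ℕ := Nat.pair (m + c.unpair.1) c.unpair.2

/-- The kind of a configuration: `0` returns, `1` is stuck, `2` asks an object of the world, and
`j + 3` asks the oracle `j`. In a mode other than `0`, the variable oracles are replaced by `0`. -/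
def kind (c : ℕ) : ℕ :=
  let t := (action c).unpair.1
  -- Tags 3 (go to) and 4 (ask oracle 0) get the same kind, because oracle 0 merely evaluates its
  -- argument at 0.
  let k := if t < 4 then t else t - 1
  if c.unpair.1 = 0 then k else if 5 < k then 5 else k

/-- The value that is returned, or the name of the object that is asked. -/
def arg (c : ℕ) : ℕ := (action c).unpair.2.unpair.1

/-- The configurations that compute the function which is the argument of the oracle. -/
def child (c n : ℕ) : ℕ :=
  if (action c).unpair.1 = 3 then addMode c.unpair.1 (action c).unpair.2 else
    Nat.pair c.unpair.1 (Nat.pair ((action c).unpair.2.unpair.2.unpair.1 + 1) (Nat.pair n 0))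

/-- The configuration that continues with the answer `w`. -/
def cont (c w : ℕ) : ℕ :=
  if (action c).unpair.1 = 3 then Nat.pair c.unpair.1 (Nat.pair 0 (retAct w)) else
    Nat.pair c.unpair.1 (Nat.pair ((action c).unpair.2.unpair.2.unpair.2 + 1) (Nat.pair w 0))

attribute [irreducible] run action addMode kind arg child cont

/-- The oracles. -/
def orc (H F : (ℕ → ℕ) → ℕ) : ℕ → (ℕ → ℕ) → ℕ
  | 0, u => u 0
  | 1, u => H u
  -- Oracle 2 falls under the default 0; it stands in for the variable oracle in modes other than 0.
  | 3, u => F u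
  | _, _ => 0

/-- `Val H P F W c v`: in the world `W`, the configuration `c` has the value `v`. -/
inductive Val (H : (ℕ → ℕ) → ℕ) (P : Family) (F : (ℕ → ℕ) → ℕ) : Env → ℕ → ℕ → Prop
  | ret (W : Env) (c : ℕ) (hc : kind c = 0) : Val H P F W c (arg c)
  | ask (W : Env) (c j v : ℕ) (u : ℕ → ℕ) (hc : kind c = j + 3)
      (hu : ∀ n, Val H P F W (child c n) (u n)) (hv : Val H P F W (cont c (orc H F j u)) v) :
      Val H P F W c v
  -- Hypothetical arguments are appended to the world, so old names stay valid. The child is told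
  -- which argument it computes, where the new entries begin and how many there are.
  | real (W : Env) (c v : ℕ) (σ : Ty) (Φ : Full σ) (ξ : Args σ) (hc : kind c = 2)
      (hΦ : W[arg c]? = some ⟨σ, Φ⟩) (hξ : ξ.In P)
      (hi : ∀ (i : Fin σ.args.length) (η : Args (σ.args.get i)), η.In P →
        Val H P F (W ++ η.toEnv)
          (child c (Encodable.encode ((i : ℕ), W.length, (σ.args.get i).args.length)))
          (Full.apply (σ.args.get i) (ξ i) η))
      (hv : Val H P F W (cont c (Full.apply σ Φ ξ)) v) : Val H P F W c v

@[fun_prop]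
theorem primrec_act {α : Type*} [Primcodable α] {f : α → ℕ} (hf : Primrec f) :
    Primrec fun a => act (f a) := by unfold act; fun_prop

@[fun_prop]
theorem primrec_retAct {α : Type*} [Primcodable α] {f : α → ℕ} (hf : Primrec f) :
    Primrec fun a => retAct (f a) := by unfold retAct; fun_prop

@[fun_prop]
theorem primrec_run {α : Type*} [Primcodable α] {f g : α → ℕ} (hf : Primrec f) (hg : Primrec g) :
    Primrec fun a => run (f a) (g a) := by unfold run; fun_prop

@[fun_prop]
theorem primrec_action {α : Type*} [Primcodable α] {f : α → ℕ} (hf : Primrec f) :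
    Primrec fun a => action (f a) := by
  have : Primrec action := by unfold action; fun_prop
  exact this.comp hf

@[fun_prop]
theorem primrec_addMode {α : Type*} [Primcodable α] {f g : α → ℕ} (hf : Primrec f)
    (hg : Primrec g) : Primrec fun a => addMode (f a) (g a) := by unfold addMode; fun_prop

@[fun_prop]
theorem primrec_kind {α : Type*} [Primcodable α] {f : α → ℕ} (hf : Primrec f) :
    Primrec fun a => kind (f a) := by
  have h4 : Primrec fun t : ℕ => if t < 4 then t else t - 1 := by fun_prop
  have h5 : Primrec fun q : ℕ × ℕ => if q.1 = 0 then q.2 else if 5 < q.2 then 5 else q.2 := by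
    fun_prop
  unfold kind
  exact h5.comp ((Prim.fst (Prim.unpair hf)).pair
    (h4.comp (Prim.fst (Prim.unpair (primrec_action hf)))))

@[fun_prop]
theorem primrec_arg {α : Type*} [Primcodable α] {f : α → ℕ} (hf : Primrec f) :
    Primrec fun a => arg (f a) := by unfold arg; fun_prop

@[fun_prop]
theorem primrec_child {α : Type*} [Primcodable α] {f g : α → ℕ} (hf : Primrec f)
    (hg : Primrec g) : Primrec fun a => child (f a) (g a) := by unfold child; fun_prop

@[fun_prop]
theorem primrec_cont {α : Type*} [Primcodable α] {f g : α → ℕ} (hf : Primrec f)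
    (hg : Primrec g) : Primrec fun a => cont (f a) (g a) := by unfold cont; fun_prop

/-! ### Inversion and determinism of machine computations -/

section Val

variable {H : (ℕ → ℕ) → ℕ} {P : Family} {F : (ℕ → ℕ) → ℕ} {W : Env}

theorem val_ret_iff {c v : ℕ} (hc : kind c = 0) : Val H P F W c v ↔ v = arg c := by
  refine ⟨fun h => ?_, fun h => h ▸ .ret _ _ hc⟩
  cases h with
  | ret => rfl
  | ask _ _ j _ u h => omega
  | real _ _ _ _ _ _ h => omega

theorem not_val {c v : ℕ} (hc : kind c = 1) : ¬ Val H P F W c v := by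
  intro h
  cases h with
  | ret _ _ h => omega
  | ask _ _ j _ u h => omega
  | real _ _ _ _ _ _ h => omega

theorem val_ask_iff {c j v : ℕ} (hc : kind c = j + 3) : Val H P F W c v ↔
    ∃ u : ℕ → ℕ, (∀ n, Val H P F W (child c n) (u n)) ∧
      Val H P F W (cont c (orc H F j u)) v := by
  refine ⟨fun h => ?_, fun ⟨u, hu, h⟩ => .ask _ _ _ _ u hc hu h⟩
  cases h with
  | ret _ _ h => omega
  | ask _ _ i _ u h hu hv =>
    obtain rfl : i = j := by omega
    exact ⟨u, hu, hv⟩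
  | real _ _ _ _ _ _ h => omega

theorem val_act_ret {w v : ℕ} : Val H P F W (act (retAct w)) v ↔ v = w := by
  rw [val_ret_iff (by simp [kind, action, act, retAct])]
  simp [arg, action, act, retAct]

theorem addMode_zero (c : ℕ) : addMode 0 c = c := by simp [addMode]

/-- The action that goes to a configuration. -/
theorem val_goto {c d v : ℕ} (hc : c.unpair.1 = 0) (h : action c = Nat.pair 3 d) :
    Val H P F W c v ↔ Val H P F W d v := by
  have hr : ∀ w v, Val H P F W (cont c w) v ↔ v = w := fun w v => by
    have : cont c w = act (retAct w) := by simp [cont, h, hc, act]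
    rw [this, val_act_ret]
  rw [val_ask_iff (j := 0) (by simp [kind, h, hc])]
  simp only [child, h, hc, Nat.unpair_pair, if_true, addMode_zero, hr, orc]
  exact ⟨fun ⟨u, hu, h⟩ => h ▸ hu 0, fun h => ⟨fun _ => v, fun _ => h, rfl⟩⟩

/-- Raising the step bound is a chain of go-to actions. The induction runs downwards from a bound at
which the program has halted. -/
theorem val_run {p x c v : ℕ} (h : c ∈ Code.eval (Denumerable.ofNat Code p) x) :
    Val H P F W (run p x) v ↔ Val H P F W c v := by
  obtain ⟨k, hk⟩ := Code.evaln_complete.1 h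
  have key : ∀ i, ∀ t, k ≤ t + i →
      (Val H P F W (Nat.pair 0 (Nat.pair (p + 1) (Nat.pair x t))) v ↔ Val H P F W c v) := by
    intro i
    induction i with
    | zero =>
      intro t ht
      have := Code.evaln_mono (show k ≤ t by omega) hk
      refine val_goto (by simp) ?_
      rw [Option.mem_def] at this
      simp [action, this]
    | succ i ih =>
      intro t ht
      cases he : Code.evaln t (Denumerable.ofNat Code p) x with
      | some d =>
        have : d = c := Part.mem_unique (Code.evaln_sound he) h
        subst this
        refine val_goto (by simp) ?_
        simp [action, he]
      | none =>
        rw [← ih (t + 1) (by omega)]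
        refine val_goto (by simp) ?_
        simp [action, he]
  rw [run]
  exact key k 0 (by omega)

/-- The value of a configuration in the empty world is unique. -/
theorem Val.unique {c v w : ℕ} (h : Val H P F [] c v) (h' : Val H P F [] c w) : v = w := by
  generalize hW : ([] : Env) = W at h
  induction h generalizing w with
  | ret W c hc => exact ((val_ret_iff hc).1 h').symm
  | ask W c j v u hc hu hv ihu ihv =>
    subst hW
    obtain ⟨u', hu', hv'⟩ := (val_ask_iff hc).1 h'
    obtain rfl : u = u' := funext fun n => ihu n (hu' n) rfl
    exact ihv hv' rfl
  | real W c v σ Φ ξ hc hΦ => subst hW; simp at hΦ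

/-- Values in the empty world are values in every world. -/
theorem Val.weaken {Q : Family} {c v : ℕ} (h : Val H P F [] c v) : Val H Q F W c v := by
  generalize hW : ([] : Env) = W' at h
  induction h with
  | ret W' c hc => exact .ret _ _ hc
  | ask W' c j v u hc hu hv ihu ihv => exact .ask _ _ _ _ u hc (fun n => ihu n hW) (ihv hW)
  | real W' c v σ Φ ξ hc hΦ => subst hW; simp at hΦ

end Val

/-! ## Relations computed by the machine -/

section HC

variable {α β : Type} [Primcodable α] [Primcodable β]

/-- A number for the program that, given `b`, runs the configuration `f (a, b)`. -/
theorem exists_closure {f : α × β → ℕ} (hf : Primrec f) : ∃ k : α → ℕ, Primrec k ∧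
    ∀ a b H P F W v, Val H P F W (run (k a) (Encodable.encode b)) v ↔ Val H P F W (f (a, b)) v := by
  have hf' : Primrec fun n => ((Encodable.decode n : Option (α × β)).map f).getD 0 := by
    have : Primrec fun o : Option (α × β) => o.map f :=
      Primrec.option_map Primrec.id (hf.comp Primrec.snd).to₂
    fun_prop
  obtain ⟨c, hc⟩ := Code.exists_code.1 (Partrec.nat_iff.1 hf'.to_comp.partrec)
  -- The s-m-n theorem: `a` is built into the program and `b` remains as input.
  refine ⟨fun a => Encodable.encode (Code.curry c (Encodable.encode a)), by fun_prop, ?_⟩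
  intro a b H P F W v
  refine val_run ?_
  rw [Denumerable.ofNat_encode, Code.eval_curry, hc]
  simp

/-- A program that refers to its own number. -/
theorem exists_fixed {f : ℕ × α → ℕ} (hf : Primrec f) : ∃ p : ℕ,
    ∀ a H P F W v, Val H P F W (run p (Encodable.encode a)) v ↔ Val H P F W (f (p, a)) v := by
  have hf' : Primrec fun q : Code × ℕ =>
      ((Encodable.decode q.2 : Option α).map fun a => f (Encodable.encode q.1, a)).getD 0 := by
    have : Primrec fun q : Code × ℕ =>
        (Encodable.decode q.2 : Option α).map fun a => f (Encodable.encode q.1, a) :=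
      Primrec.option_map (by fun_prop)
        (hf.comp (((Primrec.encode.comp Primrec.fst).comp Primrec.fst).pair Primrec.snd)).to₂
    fun_prop
  obtain ⟨c, hc⟩ := Code.fixed_point₂ (f := fun c n =>
    Part.some (((Encodable.decode n : Option α).map fun a => f (Encodable.encode c, a)).getD 0))
    hf'.to_comp.partrec
  refine ⟨Encodable.encode c, fun a H P F W v => val_run ?_⟩
  rw [Denumerable.ofNat_encode, hc]
  simp

/-- A family of relations, one in each world, that is computed by the machine. -/
def HC (H : (ℕ → ℕ) → ℕ) (P : Family)
    (φ : ((ℕ → ℕ) → ℕ) → Env → α → ℕ → Prop) : Prop :=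
  ∃ f : α → ℕ, Primrec f ∧ ∀ F W a v, Val H P F W (f a) v ↔ φ F W a v

variable {H : (ℕ → ℕ) → ℕ} {P : Family}

namespace HC

theorem goto {f : α → ℕ} (hf : Primrec f) : HC H P fun F W a v => Val H P F W (f a) v :=
  ⟨f, hf, fun _ _ _ _ => Iff.rfl⟩

theorem ret {f : α → ℕ} (hf : Primrec f) : HC H P fun _ _ a v => v = f a :=
  ⟨fun a => act (retAct (f a)), by fun_prop, fun _ _ _ _ => val_act_ret⟩

theorem stuck : HC H P fun _ _ (_ : α) _ => False :=
  ⟨fun _ => act (Nat.pair 1 0), by fun_prop, fun _ _ _ _ =>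
    iff_false_intro (not_val (by simp [kind, action, act]))⟩

theorem comp {φ : ((ℕ → ℕ) → ℕ) → Env → β → ℕ → Prop} (hφ : HC H P φ) {g : α → β}
    (hg : Primrec g) : HC H P fun F W a v => φ F W (g a) v := by
  obtain ⟨f, hf, h⟩ := hφ
  exact ⟨fun a => f (g a), hf.comp hg, fun F W a v => h F W (g a) v⟩

theorem of_iff {φ ψ : ((ℕ → ℕ) → ℕ) → Env → α → ℕ → Prop} (hφ : HC H P φ)
    (h : ∀ F W a v, ψ F W a v ↔ φ F W a v) : HC H P ψ := by
  obtain ⟨f, hf, hh⟩ := hφ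
  exact ⟨f, hf, fun F W a v => (hh F W a v).trans (h F W a v).symm⟩

theorem ask {φ ψ : ((ℕ → ℕ) → ℕ) → Env → α × ℕ → ℕ → Prop} {j : α → ℕ} (hj : Primrec j)
    (hφ : HC H P φ) (hψ : HC H P ψ) : HC H P fun F W a v =>
      ∃ u : ℕ → ℕ, (∀ n, φ F W (a, n) (u n)) ∧ ψ F W (a, orc H F (j a) u) v := by
  obtain ⟨f, hf, hf'⟩ := hφ
  obtain ⟨g, hg, hg'⟩ := hψ
  obtain ⟨k, hk, hk'⟩ := exists_closure hf
  obtain ⟨l, hl, hl'⟩ := exists_closure hg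
  refine ⟨fun a => act (Nat.pair (j a + 4) (Nat.pair 0 (Nat.pair (k a) (l a)))), by fun_prop, ?_⟩
  intro F W a v
  rw [val_ask_iff (j := j a)]
  · refine exists_congr fun u => ?_
    rw [← hg', ← hl']
    simp only [← hf', ← hk']
    simp [child, cont, action, act, run]
  · simp [kind, action, act]

theorem bind {φ : ((ℕ → ℕ) → ℕ) → Env → α → ℕ → Prop}
    {ψ : ((ℕ → ℕ) → ℕ) → Env → α × ℕ → ℕ → Prop} (hφ : HC H P φ) (hψ : HC H P ψ) :
    HC H P fun F W a v => ∃ w, φ F W a w ∧ ψ F W (a, w) v := by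
  -- Sequencing is a question to oracle 0 about a constant function.
  refine (ask (Primrec.const 0) (hφ.comp Primrec.fst) hψ).of_iff fun F W a v => ?_
  exact ⟨fun ⟨w, h, h'⟩ => ⟨fun _ => w, fun _ => h, h'⟩, fun ⟨u, h, h'⟩ => ⟨u 0, h 0, h'⟩⟩

theorem ite {φ ψ : ((ℕ → ℕ) → ℕ) → Env → α → ℕ → Prop} {c d : α → ℕ} (hc : Primrec c)
    (hd : Primrec d) (hφ : HC H P φ) (hψ : HC H P ψ) :
    HC H P fun F W a v => if c a = d a then φ F W a v else ψ F W a v := by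
  obtain ⟨f, hf, hf'⟩ := hφ
  obtain ⟨g, hg, hg'⟩ := hψ
  refine ⟨fun a => if c a = d a then f a else g a, by fun_prop, fun F W a v => ?_⟩
  dsimp only
  split_ifs
  · exact hf' F W a v
  · exact hg' F W a v

/-- Abstraction. -/
theorem closure {φ : ((ℕ → ℕ) → ℕ) → Env → α × β → ℕ → Prop} (hφ : HC H P φ) :
    ∃ k : α → ℕ, Primrec k ∧ ∀ a b F W v,
      Val H P F W (run (k a) (Encodable.encode b)) v ↔ φ F W (a, b) v := by
  obtain ⟨f, hf, hf'⟩ := hφ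
  obtain ⟨k, hk, hk'⟩ := exists_closure hf
  exact ⟨k, hk, fun a b F W v => by rw [hk', hf']⟩

/-- The recursion theorem. -/
theorem fix {φ : ((ℕ → ℕ) → ℕ) → Env → ℕ × α → ℕ → Prop} (hφ : HC H P φ) :
    ∃ p : ℕ, ∀ a F W v, Val H P F W (run p (Encodable.encode a)) v ↔ φ F W (p, a) v := by
  obtain ⟨f, hf, hf'⟩ := hφ
  obtain ⟨p, hp⟩ := exists_fixed hf
  exact ⟨p, fun a F W v => by rw [hp, hf']⟩

/-- Application of an object of the world. -/
theorem real {f : α × (ℕ × ℕ × ℕ) → ℕ} (hf : Primrec f) {j : α → ℕ} (hj : Primrec j) :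
    ∃ g : α → ℕ, Primrec g ∧ ∀ F (W : Env) a (σ : Ty) (Φ : Full σ) (ξ : Args σ),
      W[j a]? = some ⟨σ, Φ⟩ → ξ.In P →
      (∀ (i : Fin σ.args.length) (η : Args (σ.args.get i)), η.In P →
        Val H P F (W ++ η.toEnv) (f (a, (i : ℕ), W.length, (σ.args.get i).args.length))
          (Full.apply (σ.args.get i) (ξ i) η)) →
      Val H P F W (g a) (Full.apply σ Φ ξ) := by
  obtain ⟨k, hk, hk'⟩ := exists_closure hf
  obtain ⟨l, hl, hl'⟩ := exists_closure
    (show Primrec fun p : Unit × ℕ => act (retAct p.2) by fun_prop)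
  refine ⟨fun a => act (Nat.pair 2 (Nat.pair (j a) (Nat.pair (k a) (l ())))), by fun_prop, ?_⟩
  intro F W a σ Φ ξ hj hξ hi
  refine .real _ _ _ σ Φ ξ (by simp [kind, action, act]) (by simpa [arg, action, act] using hj) hξ
    (fun i η hη => ?_) ?_
  · have := (hk' _ _ _ _ _ _ _).2 (hi i η hη)
    simpa [child, action, act, run] using this
  · have := (hl' () (Full.apply σ Φ ξ) H P F W _).2 (val_act_ret.2 rfl)
    simpa [cont, action, act, run] using this

end HC

end HC

/-! ## Ignoring the variable oracle -/

theorem addMode_unpair (m c : ℕ) : (addMode m c).unpair = (m + c.unpair.1, c.unpair.2) := by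
  simp [addMode]

theorem action_addMode (m c : ℕ) : action (addMode m c) = action c := by
  simp [action, addMode_unpair]

theorem arg_addMode (m c : ℕ) : arg (addMode m c) = arg c := by simp [arg, action_addMode]

theorem child_addMode (m c n : ℕ) : child (addMode m c) n = addMode m (child c n) := by
  simp only [child, action_addMode, addMode_unpair]
  split_ifs
  · simp [addMode, add_assoc]
  · simp [addMode]

theorem cont_addMode (m c n : ℕ) : cont (addMode m c) n = addMode m (cont c n) := by
  simp only [cont, action_addMode, addMode_unpair]
  split_ifs <;> simp [addMode]

theorem kind_addMode (c : ℕ) :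
    kind (addMode 1 c) = if 5 < kind c then 5 else kind c := by
  simp only [kind, action_addMode, addMode_unpair]
  split_ifs <;> omega

theorem orc_zero (H : (ℕ → ℕ) → ℕ) {j : ℕ} (hj : 2 ≤ j) (u : ℕ → ℕ) :
    orc H (fun _ => 0) j u = 0 := by
  match j, hj with
  | 2, _ => rfl
  | 3, _ => rfl
  | j + 4, _ => rfl

/-- Mode 1 redirects every oracle above 2 to oracle 2, which is 0, and is inherited by children and
continuations. This allows a computation that does not use `F` to be simulated inside one that does.
-/
theorem val_addMode {H : (ℕ → ℕ) → ℕ} {P : Family} {F : (ℕ → ℕ) → ℕ} {c v : ℕ} :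
    Val H P F [] (addMode 1 c) v ↔ Val H P (fun _ => 0) [] c v := by
  have hk : ∀ {c j : ℕ}, kind c = j + 3 → ∃ i, kind (addMode 1 c) = i + 3 ∧
      ∀ u, orc H F i u = orc H (fun _ => 0) j u := by
    intro c j hc
    rw [kind_addMode, hc]
    by_cases hj : 2 < j
    · refine ⟨2, by rw [if_pos (by omega)], fun u => ?_⟩
      rw [orc_zero H hj.le]; rfl
    · refine ⟨j, by rw [if_neg (by omega)], fun u => ?_⟩
      have : j ≤ 2 := by omega
      interval_cases j <;> rfl
  constructor
  · intro h
    generalize hd : addMode 1 c = d at h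
    generalize hW : ([] : Env) = W at h
    induction h generalizing c with
    | ret W d h =>
      subst hd
      rw [kind_addMode] at h
      rw [arg_addMode]
      refine .ret _ _ ?_
      split_ifs at h
      omega
    | ask W d j v u hc hu hv ihu ihv =>
      subst hd
      have : ∃ i, kind c = i + 3 := by
        rw [kind_addMode] at hc
        split_ifs at hc with h5
        · exact ⟨kind c - 3, by omega⟩
        · exact ⟨j, hc⟩
      obtain ⟨i, hi⟩ := this
      obtain ⟨j', hj', ho⟩ := hk hi
      obtain rfl : j = j' := by omega
      refine .ask _ _ i _ u hi (fun n => ihu n (child_addMode 1 c n).symm hW) ?_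
      rw [← ho]
      exact ihv (cont_addMode 1 c _).symm hW
    | real W c v σ Φ ξ hc hΦ => subst hW; simp at hΦ
  · intro h
    generalize hW : ([] : Env) = W at h
    induction h with
    | ret W c h =>
      rw [← arg_addMode 1]
      exact .ret _ _ (by rw [kind_addMode, h]; rfl)
    | ask W c j v u hc hu hv ihu ihv =>
      obtain ⟨i, hi, ho⟩ := hk hc
      refine .ask _ _ i _ u hi (fun n => child_addMode 1 c n ▸ ihu n hW) ?_
      rw [ho, cont_addMode]
      exact ihv hW
    | real W c v σ Φ ξ hc hΦ => subst hW; simp at hΦ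


/-! ## Realizability of functionals by programs -/

section Realizes

/-- `Realizes H P F σ Φ W r`: in the world `W` and all its extensions, the program `r` computes
`Φ` from realizers of its arguments. -/
def Realizes (H : (ℕ → ℕ) → ℕ) (P : Family) (F : (ℕ → ℕ) → ℕ) (σ : Ty) (Φ : Full σ) (W : Env)
    (r : ℕ) : Prop :=
  ∀ W' : Env, W <+: W' → ∀ ξ : Args σ, ξ.In P → ∀ s : Fin σ.args.length → ℕ,
    (∀ i, Realizes H P F (σ.args.get i) (ξ i) W' (s i)) →
      Val H P F W' (run r (Encodable.encode (List.ofFn s))) (Full.apply σ Φ ξ)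
termination_by σ.level
decreasing_by exact Ty.level_get_lt σ i

/-- A list of realizers of the entries of a list of arguments. -/
def RealizesEnv (H : (ℕ → ℕ) → ℕ) (P : Family) (F : (ℕ → ℕ) → ℕ) (W : Env) :
    Env → List ℕ → Prop :=
  List.Forall₂ fun v r => Realizes H P F v.1 v.2 W r

variable {H : (ℕ → ℕ) → ℕ} {P : Family} {F : (ℕ → ℕ) → ℕ} {W W' : Env}

theorem Realizes.mono {σ : Ty} {Φ : Full σ} {r : ℕ} (h : Realizes H P F σ Φ W r) (hW : W <+: W') :
    Realizes H P F σ Φ W' r := by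
  rw [Realizes] at h ⊢
  exact fun W'' hW' => h W'' (hW.trans hW')

theorem RealizesEnv.mono {Γ : Env} {γ : List ℕ} (h : RealizesEnv H P F W Γ γ) (hW : W <+: W') :
    RealizesEnv H P F W' Γ γ := h.imp fun _ _ h => h.mono hW

theorem toEnv_get {σ : Ty} (ξ : Args σ) (i : Fin σ.args.length) {h : (i : ℕ) < ξ.toEnv.length} :
    ξ.toEnv.get ⟨i, h⟩ = ⟨σ.args.get i, ξ i⟩ := by simp [Args.toEnv]

theorem realizesEnv_toEnv {σ : Ty} {ξ : Args σ} {s : List ℕ} :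
    RealizesEnv H P F W ξ.toEnv s ↔ ∃ t : Fin σ.args.length → ℕ, s = List.ofFn t ∧
      ∀ i, Realizes H P F (σ.args.get i) (ξ i) W (t i) := by
  constructor
  · intro h
    obtain ⟨hl, h⟩ := List.forall₂_iff_get.1 h
    rw [Args.toEnv, List.length_ofFn] at hl
    refine ⟨fun i => s.get (i.cast hl), ?_, fun i => ?_⟩
    · refine List.ext_get (by simp [hl]) fun n h1 h2 => by simp
    · have := h i (by simp [Args.toEnv]) (by simp [← hl])
      rwa [toEnv_get ξ i] at this
  · rintro ⟨t, rfl, h⟩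
    refine List.forall₂_iff_get.2 ⟨by simp [Args.toEnv], fun i h1 h2 => ?_⟩
    have hi : i < σ.args.length := by simpa using h2
    have := h ⟨i, hi⟩
    rw [toEnv_get ξ ⟨i, hi⟩]
    simpa using this

theorem realizes_iff {σ : Ty} {Φ : Full σ} {r : ℕ} : Realizes H P F σ Φ W r ↔
    ∀ W' : Env, W <+: W' → ∀ ξ : Args σ, ξ.In P → ∀ s : List ℕ, RealizesEnv H P F W' ξ.toEnv s →
      Val H P F W' (run r (Encodable.encode s)) (Full.apply σ Φ ξ) := by
  rw [Realizes]
  refine forall₄_congr fun W' _ ξ _ => ?_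
  simp only [realizesEnv_toEnv]
  exact ⟨fun h s ⟨t, hs, ht⟩ => hs ▸ h t ht, fun h t ht => h _ ⟨t, rfl, ht⟩⟩

theorem Realizes.val {σ : Ty} {Φ : Full σ} {r : ℕ} (h : Realizes H P F σ Φ W r) {ξ : Args σ}
    (hξ : ξ.In P) {s : List ℕ} (hs : RealizesEnv H P F W ξ.toEnv s) :
    Val H P F W (run r (Encodable.encode s)) (Full.apply σ Φ ξ) :=
  realizes_iff.1 h W (List.prefix_refl W) ξ hξ s hs

theorem realizes_nat {n r : ℕ} : Realizes H P F Ty.nat n W r ↔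
    ∀ W' : Env, W <+: W' → Val H P F W' (run r (Encodable.encode ([] : List ℕ))) n := by
  rw [Realizes]
  refine ⟨fun h W' hW => ?_, fun h W' hW ξ _ s _ => ?_⟩
  · simpa using! h W' hW (fun i => i.elim0) (fun i => i.elim0) (fun i => i.elim0)
      (fun i => i.elim0)
  · simpa using! h W' hW

theorem Realizes.val_nat {n r : ℕ} (h : Realizes H P F Ty.nat n W r) :
    Val H P F W (run r (Encodable.encode ([] : List ℕ))) n :=
  realizes_nat.1 h W (List.prefix_refl W)

/-- The arguments of a functional of type one. -/
def Args.one (n : ℕ) : Args (Ty.pure 1) := fun i => match i with | ⟨0, _⟩ => n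

theorem Realizes.val_one {f : ℕ → ℕ} {r : ℕ} (hP : ∀ n : ℕ, n ∈ P Ty.nat)
    (h : Realizes H P F (Ty.pure 1) f W r) {n s : ℕ}
    (hs : Realizes H P F Ty.nat n W s) : Val H P F W (run r (Encodable.encode [s])) (f n) := by
  refine h.val (ξ := Args.one n) (fun i => ?_) ?_
  · match i with | ⟨0, _⟩ => exact hP n
  · exact List.Forall₂.cons hs List.Forall₂.nil

variable (H P) in
/-- There are realizers of all numbers. -/
theorem exists_numeral : ∃ k : ℕ → ℕ, Primrec k ∧ ∀ n F W, Realizes H P F Ty.nat n W (k n) := by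
  obtain ⟨k, hk, h⟩ := (HC.ret (H := H) (P := P) (α := ℕ × List ℕ) (f := fun a => a.1)
    (by fun_prop)).closure
  exact ⟨k, hk, fun n F W => realizes_nat.2 fun W' _ => (h n [] F W' n).2 rfl⟩

/-- The list coded by a number. -/
def toList (e : ℕ) : List ℕ := (Encodable.decode e).getD []

theorem toList_ix (l : List ℕ) : toList (ix l) = l := by simp [toList, ix]

@[fun_prop]
theorem primrec_toList {α : Type*} [Primcodable α] {f : α → ℕ} (hf : Primrec f) :
    Primrec fun a => toList (f a) := by unfold toList; fun_prop

attribute [irreducible] toList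

/-- The interpreter of the schemes S1-S9, on lists of realizers: for every computation there is a
value of the interpreter. -/
theorem exists_interpreter (hP : ∀ n : ℕ, n ∈ P Ty.nat) : ∃ p : ℕ, ∀ e Γ a, Comp H P e Γ a →
    ∀ F W γ, RealizesEnv H P F W Γ γ → Val H P F W (run p (Encodable.encode (e, γ))) a := by
  obtain ⟨num', hnum, hnum'⟩ := exists_numeral H P
  have hnum_comp : ∀ {α : Type} [Primcodable α] {f : α → ℕ}, Primrec f →
    Primrec fun a => num' (f a) := fun hf => hnum.comp hf
  -- closures `λ s. {d}(s, γ)`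
  obtain ⟨cl, hcl, hcl'⟩ := (HC.goto (H := H) (P := P) (α := (ℕ × ℕ × List ℕ) × List ℕ)
    (f := fun a => run a.1.1 (Encodable.encode (a.1.2.1, a.2 ++ a.1.2.2))) (by fun_prop)).closure
  have hcl_comp : ∀ {α : Type} [Primcodable α] {f : α → ℕ × ℕ × List ℕ}, Primrec f →
    Primrec fun a => cl (f a) := fun hf => hcl.comp hf
  -- A triple consists of the interpreter's own number, a Kleene index and a list of realizers; the
  -- head of the index selects the scheme.
  let tag : ℕ × ℕ × List ℕ → ℕ := fun a => (toList a.2.1).getD 0 0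
  have htag : Primrec tag := by fun_prop
  have hhead : HC H P fun F W (a : ℕ × ℕ × List ℕ) v =>
      Val H P F W (run (a.2.2.getD 0 0) (Encodable.encode ([] : List ℕ))) v :=
    HC.goto (by fun_prop)
  have h0 : HC H P fun F W (a : ℕ × ℕ × List ℕ) v => ∃ u : ℕ → ℕ,
      (∀ n, Val H P F W (run a.1 (Encodable.encode
        ((toList a.2.1).getD 1 0, num' n :: a.2.2))) (u n)) ∧ v = orc H F 1 u :=
    HC.ask (Primrec.const 1) (HC.goto (f := fun b : (ℕ × ℕ × List ℕ) × ℕ => run b.1.1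
      (Encodable.encode ((toList b.1.2.1).getD 1 0, num' b.2 :: b.1.2.2))) (by fun_prop))
      (HC.ret (f := fun b => b.2) (by fun_prop))
  have h1 := hhead.bind (HC.ret (f := fun b => b.2 + 1) (by fun_prop))
  have h2 : HC H P fun F W (a : ℕ × ℕ × List ℕ) v => v = (toList a.2.1).getD 1 0 :=
    HC.ret (by fun_prop)
  have h4 := HC.bind (HC.goto (H := H) (P := P) (f := fun a : ℕ × ℕ × List ℕ =>
      run a.1 (Encodable.encode ((toList a.2.1).getD 2 0, a.2.2))) (by fun_prop))
    (HC.goto (H := H) (P := P) (f := fun b : (ℕ × ℕ × List ℕ) × ℕ =>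
      run b.1.1 (Encodable.encode ((toList b.1.2.1).getD 1 0, num' b.2 :: b.1.2.2))) (by fun_prop))
  have h5 := hhead.bind (HC.ite (c := fun b : (ℕ × ℕ × List ℕ) × ℕ => b.2) (d := fun _ => 0)
    (by fun_prop) (by fun_prop)
    (HC.goto (H := H) (P := P) (f := fun b : (ℕ × ℕ × List ℕ) × ℕ =>
      run b.1.1 (Encodable.encode ((toList b.1.2.1).getD 1 0, b.1.2.2.tail))) (by fun_prop))
    (HC.bind (HC.goto (H := H) (P := P) (f := fun b : (ℕ × ℕ × List ℕ) × ℕ =>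
      run b.1.1 (Encodable.encode (b.1.2.1, num' (b.2 - 1) :: b.1.2.2.tail))) (by fun_prop))
      (HC.goto (H := H) (P := P) (f := fun b : ((ℕ × ℕ × List ℕ) × ℕ) × ℕ =>
        run b.1.1.1 (Encodable.encode ((toList b.1.1.2.1).getD 2 0,
          num' (b.1.2 - 1) :: num' b.2 :: b.1.1.2.2.tail))) (by fun_prop))))
  have h6 := HC.goto (H := H) (P := P) (f := fun a : ℕ × ℕ × List ℕ =>
      run a.1 (Encodable.encode ((toList a.2.1).getD 1 0,
        a.2.2.getD ((toList a.2.1).getD 2 0) 0 :: (a.2.2.take ((toList a.2.1).getD 2 0) ++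
          a.2.2.drop ((toList a.2.1).getD 2 0 + 1))))) (by fun_prop)
  have h7 := HC.goto (H := H) (P := P) (f := fun a : ℕ × ℕ × List ℕ =>
      run (a.2.2.getD 0 0) (Encodable.encode [a.2.2.getD 1 0])) (by fun_prop)
  -- S8: the realizer of the head argument receives, for each index `d`, a closure that interprets
  -- `d` on further realizers put in front of the present list.
  have h8 := HC.goto (H := H) (P := P) (f := fun a : ℕ × ℕ × List ℕ =>
      run (a.2.2.getD 0 0) (Encodable.encode
        ((toList a.2.1).tail.map fun d => cl (a.1, d, a.2.2)))) (by fun_prop)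
  have h9 := hhead.bind (HC.goto (H := H) (P := P) (f := fun b : (ℕ × ℕ × List ℕ) × ℕ =>
      run b.1.1 (Encodable.encode (b.2, b.1.2.2.tail.take ((toList b.1.2.1).getD 1 0))))
      (by fun_prop))
  obtain ⟨p, hp⟩ := (HC.ite htag (Primrec.const 0) h0 <| HC.ite htag (Primrec.const 1) h1 <|
    HC.ite htag (Primrec.const 2) h2 <| HC.ite htag (Primrec.const 3) hhead <|
    HC.ite htag (Primrec.const 4) h4 <| HC.ite htag (Primrec.const 5) h5 <|
    HC.ite htag (Primrec.const 6) h6 <| HC.ite htag (Primrec.const 7) h7 <|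
    HC.ite htag (Primrec.const 8) h8 h9).fix
  refine ⟨p, fun e Γ a h F => ?_⟩
  induction h with
  | s1 x Γ =>
    rintro W _ (_ | ⟨hx, -⟩)
    rw [hp]
    simpa [tag, toList_ix] using hx.val_nat
  | s2 q Γ =>
    intro W γ hγ
    rw [hp]
    simp [tag, toList_ix]
  | s3 x Γ =>
    rintro W _ (_ | ⟨hx, -⟩)
    rw [hp]
    simpa [tag, toList_ix] using hx.val_nat
  | s4 c d b a Γ hd hc id ic =>
    intro W γ hγ
    rw [hp]
    simp only [tag, toList_ix]
    exact ⟨b, id W γ hγ, ic W _ (.cons (hnum' b F W) hγ)⟩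
  | s5_zero c d a Γ hc ih =>
    rintro W _ (_ | ⟨hx, hγ⟩)
    rw [hp]
    simp only [tag, toList_ix]
    exact ⟨0, hx.val_nat, ih W _ hγ⟩
  | s5_succ c d x b a Γ hx hd ihx ihd =>
    rintro W _ (_ | ⟨hx, hγ⟩)
    rw [hp]
    simp only [tag, toList_ix]
    exact ⟨x + 1, hx.val_nat, b, ihx W _ (.cons (hnum' x F W) hγ),
      ihd W _ (.cons (hnum' x F W) (.cons (hnum' b F W) hγ))⟩
  | s6 d k a Γ hk hd ih =>
    intro W γ hγ
    rw [hp]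
    simp only [tag, toList_ix]
    refine ih W _ (.cons ?_ ?_)
    · obtain ⟨hl, h⟩ := List.forall₂_iff_get.1 hγ
      have := h k hk (hl ▸ hk)
      change Realizes H P F _ _ W (γ.getD k 0)
      rwa [List.getD_eq_getElem _ _ (hl ▸ hk)]
    · rw [List.eraseIdx_eq_take_drop_succ]
      exact List.rel_append (List.forall₂_take _ hγ) (List.forall₂_drop _ hγ)
  | s7 f x Γ =>
    rintro W _ (_ | ⟨hf, (_ | ⟨hx, -⟩)⟩)
    rw [hp]
    simp only [tag, toList_ix]
    exact hf.val_one hP hx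
  | s8 σ Φ Γ d ξ hξ hd ih =>
    intro W γ' hγ'
    obtain _ | ⟨hΦ, hγ⟩ := id hγ'
    rw [hp]
    simp only [tag, toList_ix]
    refine hΦ.val hξ (realizesEnv_toEnv.2 ⟨_, List.map_ofFn, fun i => ?_⟩)
    -- The new arguments may live in a later world; the old realizers persist there.
    refine realizes_iff.2 fun W' hW η hη s hs => ?_
    exact (hcl' _ _ _ _ _).2 (ih i η hη W' _ (List.rel_append hs (hγ'.mono hW)))
  | s8_oracle d f Γ hd ih =>
    intro W γ hγ
    rw [hp]
    simp only [tag, toList_ix]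
    exact ⟨f, fun n => ih n W _ (.cons (hnum' n F W) hγ), rfl⟩
  | s9 x m a Γ hx ih =>
    rintro W _ (_ | ⟨hx, hγ⟩)
    rw [hp]
    simp only [tag, toList_ix]
    exact ⟨x, hx.val_nat, ih W _ (List.forall₂_take _ hγ)⟩

/-- Realizers of the objects of the world. -/
theorem exists_pointer : ∃ k : ℕ → ℕ, Primrec k ∧ ∀ F (W : Env) j σ Φ, W[j]? = some ⟨σ, Φ⟩ →
    Realizes H P F σ Φ W (k j) := by
  obtain ⟨cl, hcl, hcl'⟩ := (HC.goto (H := H) (P := P) (α := (ℕ × ℕ) × List ℕ)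
    (f := fun a => run a.1.1 (Encodable.encode (a.1.2, a.2))) (by fun_prop)).closure
  have hcl_comp : ∀ {α : Type} [Primcodable α] {f : α → ℕ × ℕ}, Primrec f →
    Primrec fun a => cl (f a) := fun hf => hcl.comp hf
  -- The question to the object: its argument `i` is computed by the given realizer, applied to
  -- pointers to the fresh entries of the world.
  obtain ⟨g, hg, hg'⟩ := HC.real (H := H) (P := P) (α := ℕ × ℕ × List ℕ)
    (f := fun b => run (b.1.2.2.getD b.2.1 0) (Encodable.encode
      ((List.range b.2.2.2).map fun i => cl (b.1.1, b.2.2.1 + i)))) (by fun_prop)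
    (j := fun a => a.2.1) (by fun_prop)
  obtain ⟨p, hp⟩ := exists_fixed hg
  refine ⟨fun j => cl (p, j), by fun_prop, fun F W j σ => ?_⟩
  generalize hn : σ.level = n
  -- The fresh entries are arguments of arguments of the object, so their types have smaller level.
  induction n using Nat.strong_induction_on generalizing W j σ with
  | _ n ih =>
    subst hn
    intro Φ hΦ
    rw [Realizes]
    intro W' hW ξ hξ s hs
    rw [hcl', hp]
    have hj : W'[j]? = some ⟨σ, Φ⟩ := by
      obtain ⟨t, rfl⟩ := hW
      rw [List.getElem?_append_left, hΦ]
      exact (List.getElem?_eq_some_iff.1 hΦ).1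
    refine hg' F W' _ σ Φ ξ hj hξ fun i η hη => ?_
    have hi := (hs i).mono (List.prefix_append W' η.toEnv)
    have : List.getD (List.ofFn s) i 0 = s i := by simp
    dsimp only
    rw [this]
    refine hi.val hη (realizesEnv_toEnv.2 ⟨fun k => cl (p, W'.length + k), ?_, fun k => ?_⟩)
    · refine List.ext_get (by simp) fun k _ _ => by simp
    · refine ih _ ?_ _ _ _ rfl _ ?_
      · exact (Ty.level_get_lt _ k).trans (Ty.level_get_lt _ i)
      · simp [Args.toEnv]

end Realizes


/-! ## Translation of the machine into the schemes S1-S9 -/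

section Schemes

variable {H : (ℕ → ℕ) → ℕ} {P : Family}

@[fun_prop]
theorem primrec_ix {α : Type*} [Primcodable α] {f : α → List ℕ} (hf : Primrec f) :
    Primrec fun a => ix (f a) := by unfold ix; fun_prop

attribute [local irreducible] ix

/-- The index of `λ (x, Γ). {c}(Γ)`. -/
def dropIx (c : ℕ) : ℕ := ix [5, c, ix [6, ix [3], 1]]

@[fun_prop]
theorem primrec_dropIx {α : Type*} [Primcodable α] {f : α → ℕ} (hf : Primrec f) :
    Primrec fun a => dropIx (f a) := by unfold dropIx; fun_prop

/-- A leading number is discarded by a primitive recursion on it whose successor step repeats the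
previous value. -/
theorem Comp.drop {c a : ℕ} {Γ : Env} (h : Comp H P c Γ a) (x : ℕ) :
    Comp H P (dropIx c) (num x :: Γ) a := by
  induction x with
  | zero => exact .s5_zero _ _ _ _ h
  | succ x ih => exact .s5_succ _ _ _ _ _ _ ih (.s6 _ 1 _ _ (by simp) (.s3 _ _))

theorem Comp.drop_list {c a : ℕ} {Γ : Env} (h : Comp H P c Γ a) (l : List ℕ) :
    Comp H P (dropIx^[l.length] c) (l.map num ++ Γ) a := by
  induction l with
  | nil => exact h
  | cons x l ih =>
    rw [List.length_cons, Function.iterate_succ_apply']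
    exact ih.drop x

/-- The index of `λ Γ. {c}({g₁}(Γ), ..., {gₙ}(Γ), Γ)`. -/
def pushIx (c : ℕ) : List ℕ → ℕ
  | [] => c
  | g :: l => pushIx (ix [4, c, dropIx^[l.length] g]) l

/-- The last index is evaluated first. When `g` is evaluated, the values of the later indices
already stand in front and have to be skipped, hence the iterate of `dropIx`. -/
theorem Comp.push {Γ : Env} {l w : List ℕ} (h : List.Forall₂ (fun g b => Comp H P g Γ b) l w)
    {c a : ℕ} (hc : Comp H P c (w.map num ++ Γ) a) : Comp H P (pushIx c l) Γ a := by
  induction h generalizing c with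
  | nil => exact hc
  | @cons g b l w hg h ih => exact ih (.s4 _ _ b _ _ (h.length_eq ▸ hg.drop_list w) hc)

theorem exists_index_vector {n : ℕ} {f : List.Vector ℕ n → ℕ} (hf : Nat.Primrec' f) :
    ∃ e, ∀ v Γ, Comp H P e (v.toList.map num ++ Γ) (f v) := by
  induction hf with
  | zero => exact ⟨ix [2, 0], fun v Γ => .s2 _ _⟩
  | succ => exact ⟨ix [1], fun ⟨[x], _⟩ Γ => .s1 _ _⟩
  | @get n i =>
    refine ⟨ix [6, ix [3], i], fun v Γ => ?_⟩
    have hi : (i : ℕ) < (v.toList.map num ++ Γ).length := by simp; omega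
    have hv : (v.toList.map num ++ Γ)[(i : ℕ)] = num (v.get i) := by
      rw [List.getElem_append_left (by simp)]
      simp [List.Vector.get_eq_get_toList]
    exact .s6 _ _ _ _ hi (hv ▸ .s3 _ _)
  | @comp m n f g hf hg ihf ihg =>
    obtain ⟨e, he⟩ := ihf
    choose d hd using ihg
    refine ⟨pushIx e (List.ofFn d), fun v Γ => ?_⟩
    refine Comp.push (w := List.ofFn fun i => g i v) ?_ ?_
    · refine List.forall₂_iff_get.2 ⟨by simp, fun i h1 h2 => ?_⟩
      simpa using hd _ v Γ
    · have := he (List.Vector.ofFn fun i => g i v) (v.toList.map num ++ Γ)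
      rwa [List.Vector.toList_ofFn] at this
  | @prec n f g hf hg ihf ihg =>
    obtain ⟨c, hc⟩ := ihf
    obtain ⟨d, hd⟩ := ihg
    refine ⟨ix [5, c, d], fun v Γ => ?_⟩
    obtain ⟨x, t, rfl⟩ := v.exists_eq_cons
    simp only [List.Vector.head_cons, List.Vector.tail_cons, List.Vector.toList_cons, List.map_cons,
      List.cons_append]
    induction x with
    | zero => exact .s5_zero _ _ _ _ (hc t Γ)
    | succ x ih =>
      refine .s5_succ _ _ _ _ _ _ ih ?_
      have := hd (x ::ᵥ
        (Nat.rec (motive := fun _ => ℕ) (f t) (fun y IH => g (y ::ᵥ IH ::ᵥ t)) x) ::ᵥ t) Γ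
      simpa only [List.Vector.toList_cons, List.map_cons, List.cons_append] using this

variable (H P) in
theorem exists_index_two {f : ℕ × ℕ → ℕ} (hf : Primrec f) :
    ∃ e, ∀ x y Γ, Comp H P e (num x :: num y :: Γ) (f (x, y)) := by
  have : Primrec fun v : List.Vector ℕ 2 => f (v.get 0, v.get 1) :=
    hf.comp ((Primrec.vector_get.comp Primrec.id (Primrec.const 0)).pair
      (Primrec.vector_get.comp Primrec.id (Primrec.const 1)))
  obtain ⟨e, he⟩ := exists_index_vector (H := H) (P := P) (Nat.Primrec'.of_prim this)
  exact ⟨e, fun x y Γ => he (x ::ᵥ y ::ᵥ .nil) Γ⟩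

variable (H P) in
theorem exists_index_three {f : ℕ × ℕ × ℕ → ℕ} (hf : Primrec f) :
    ∃ e, ∀ x y z Γ, Comp H P e (num x :: num y :: num z :: Γ) (f (x, y, z)) := by
  have : Primrec fun v : List.Vector ℕ 3 => f (v.get 0, v.get 1, v.get 2) :=
    hf.comp ((Primrec.vector_get.comp Primrec.id (Primrec.const 0)).pair
      ((Primrec.vector_get.comp Primrec.id (Primrec.const 1)).pair
        (Primrec.vector_get.comp Primrec.id (Primrec.const 2))))
  obtain ⟨e, he⟩ := exists_index_vector (H := H) (P := P) (Nat.Primrec'.of_prim this)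
  exact ⟨e, fun x y z Γ => he (x ::ᵥ y ::ᵥ z ::ᵥ .nil) Γ⟩

end Schemes

/-! ### The compiler from configurations to indices -/

/-- A number for a type. -/
def Ty.code : Ty → ℕ
  | Ty.nat => ix []
  | Ty.arr σ τ => ix (Ty.code σ :: toList (Ty.code τ))

theorem Ty.toList_code (σ : Ty) : toList σ.code = σ.args.map Ty.code := by
  induction σ with
  | nat => simp [Ty.code, toList_ix]
  | arr σ τ _ ih => simp [Ty.code, toList_ix, ih]

/-- The shape of a list of arguments: the names of its entries, the codes of the types of all
objects of the world, and the number of variable oracles. -/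
abbrev Shape : Type := List ℕ × List ℕ × ℕ

/-- The index which runs configurations, over arguments of shape `T`; here `p` is the index of
the compiler. -/
def runIx (p : ℕ) (T : Shape) : ℕ :=
  ix [4, ix [9, T.1.length + 2], ix [4, ix [4, p, ix [2, p]], ix [2, Encodable.encode T]]]

/-- The index of `λ Γ. {j}(c, Γ)`. -/
def startIx (j c : ℕ) : ℕ := ix [4, j, ix [2, c]]

/-- The index of `λ (w, Γ). {j}({k}(c, w), Γ)`. -/
def nextIx (j k c : ℕ) : ℕ := ix [4, ix [6, dropIx j, 1], ix [4, k, ix [2, c]]]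

/-- The shape of the arguments of the functional that is the argument `i` of the object `j`. -/
def subShape (T : Shape) (j i : ℕ) : Shape :=
  let l := toList ((toList (T.2.1.getD j 0)).getD i 0)
  -- The order of S8: new arguments, then the head, then the rest. In the world the new objects come
  -- last instead, which is why names must be recorded.
  ((List.range l.length).map (fun k => T.2.1.length + k) ++
    j :: (T.1.take (T.1.idxOf j) ++ T.1.drop (T.1.idxOf j + 1)), T.2.1 ++ l, T.2.2)

/-- The indices of the arguments of the object that is asked. -/
def argIx (p : ℕ) (T : Shape) (c : ℕ) : List ℕ :=
  (List.range (toList (T.2.1.getD (arg c) 0)).length).map fun i =>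
    startIx (runIx p (subShape T (arg c) i)) (child c (Encodable.encode (i, T.2.1.length,
      (toList ((toList (T.2.1.getD (arg c) 0)).getD i 0)).length)))

/-- The compiler: an index for the first step of the configuration `c`. -/
def stepIx (k l p : ℕ) (T : Shape) (c : ℕ) : ℕ :=
  if kind c = 0 then ix [2, arg c] else
  ix [4, nextIx (runIx p T) k c,
    if kind c = 2 then ix [6, ix (8 :: argIx p T c), T.1.idxOf (arg c)] else
    if kind c = 3 then startIx (runIx p T) (child c 0) else
    if kind c = 4 then ix [0, nextIx (runIx p T) l c] else
    if kind c = 6 then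
      -- Once the value at which it is to be evaluated has been pushed, the function argument, last
      -- in the list, is at position `T.1.length + 1`.
      if T.2.2 = 1 then ix [4, ix [6, ix [7], T.1.length + 1], startIx (runIx p T) (child c 0)]
      else ix [2, 0]
    else ix [2, 0]]

section primrec

variable {α : Type*} [Primcodable α]

@[fun_prop]
theorem primrec_runIx {p : α → ℕ} {T : α → Shape} (hp : Primrec p) (hT : Primrec T) :
    Primrec fun a => runIx (p a) (T a) := by unfold runIx; fun_prop

@[fun_prop]
theorem primrec_startIx {p q : α → ℕ} (hp : Primrec p) (hq : Primrec q) :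
    Primrec fun a => startIx (p a) (q a) := by unfold startIx; fun_prop

@[fun_prop]
theorem primrec_nextIx {p q r : α → ℕ} (hp : Primrec p) (hq : Primrec q) (hr : Primrec r) :
    Primrec fun a => nextIx (p a) (q a) (r a) := by unfold nextIx; fun_prop

@[fun_prop]
theorem primrec_subShape {T : α → Shape} {p q : α → ℕ} (hT : Primrec T) (hp : Primrec p)
    (hq : Primrec q) : Primrec fun a => subShape (T a) (p a) (q a) := by unfold subShape; fun_prop

@[fun_prop]
theorem primrec_argIx {p c : α → ℕ} {T : α → Shape} (hp : Primrec p) (hT : Primrec T)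
    (hc : Primrec c) : Primrec fun a => argIx (p a) (T a) (c a) := by unfold argIx; fun_prop

attribute [irreducible] runIx startIx nextIx argIx

@[fun_prop]
theorem primrec_stepIx (k l : ℕ) {p c : α → ℕ} {T : α → Shape} (hp : Primrec p) (hT : Primrec T)
    (hc : Primrec c) : Primrec fun a => stepIx k l (p a) (T a) (c a) := by unfold stepIx; fun_prop

end primrec

/-! ### Correctness of the compiler -/

section Translation

variable {H : (ℕ → ℕ) → ℕ} {P : Family}

theorem Comp.start {j c a : ℕ} {Γ : Env} (h : Comp H P j (num c :: Γ) a) :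
    Comp H P (startIx j c) Γ a := by
  rw [startIx]
  exact .s4 _ _ c _ _ (.s2 _ _) h

theorem Comp.next {j k c w b a : ℕ} {Γ : Env} (hk : ∀ Γ, Comp H P k (num c :: num w :: Γ) b)
    (h : Comp H P j (num b :: Γ) a) : Comp H P (nextIx j k c) (num w :: Γ) a := by
  rw [nextIx]
  exact .s4 _ _ b _ _ (.s4 _ _ c _ _ (.s2 _ _) (hk _)) (.s6 _ 1 _ _ (by simp) (h.drop w))

/-- The arguments for the variable oracle `F`: either `F` is trivial, or it evaluates a further
argument of type one. -/
def OracleEnv (e : ℕ) (E : Env) (F : (ℕ → ℕ) → ℕ) : Prop :=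
  (e = 0 ∧ E = [] ∧ F = fun _ => 0) ∨
    (e = 1 ∧ ∃ f : ℕ → ℕ, E = [⟨Ty.pure 1, f⟩] ∧ F = fun u => f (u 0))

-- By induction on the machine computation, each step becomes a few schemes: S8 for objects and for
-- `H`, S7 for the function argument, S4 to continue. The list `π` records in which order the
-- objects of the world appear as arguments, since S6 and S8 permute them.
variable (H P) in
theorem exists_translation : ∃ J : Shape → ℕ, ∀ e E F, OracleEnv e E F → ∀ (W : Env) c v,
    Val H P F W c v → ∀ (π : List ℕ) (Γ : Env), List.Forall₂ (fun j x => W[j]? = some x) π Γ →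
      (∀ j < W.length, j ∈ π) →
        Comp H P (J (π, W.map (fun x => x.1.code), e)) (num c :: (Γ ++ E)) v := by
  obtain ⟨k, hk⟩ := exists_index_two H P (f := fun x => cont x.1 x.2) (by fun_prop)
  obtain ⟨l, hl⟩ := exists_index_two H P (f := fun x => child x.1 x.2) (by fun_prop)
  -- The compiler takes its own index as an argument; the self-application inside `runIx`, followed
  -- by S9, supplies the recursion.
  obtain ⟨p, hp⟩ := exists_index_three H P (f := fun x => dropIx (stepIx k l x.1
    ((Encodable.decode x.2.1 : Option Shape).getD ([], [], 0)) x.2.2)) (by fun_prop)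
  refine ⟨runIx p, fun e E F hE W c v h => ?_⟩
  have key : ∀ (T : Shape) c v Γ, List.length Γ ≤ T.1.length + 1 →
      Comp H P (stepIx k l p T c) Γ v → Comp H P (runIx p T) (num c :: Γ) v := by
    intro T c v Γ hΓ h
    have hp := hp p (Encodable.encode T) c Γ
    simp only [Encodable.encodek, Option.getD_some] at hp
    rw [runIx]
    refine .s4 _ _ _ _ _ (.s4 _ _ _ _ _ (.s2 _ _) (.s4 _ _ _ _ _ (.s2 _ _) hp)) (.s9 _ _ _ _ ?_)
    -- S9 keeps everything: `c`, one argument per name, and at most one function.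
    rw [List.take_of_length_le (by simpa using hΓ)]
    exact h.drop c
  have hlen : E.length ≤ 1 := by
    rcases hE with ⟨-, rfl, -⟩ | ⟨-, f, rfl, -⟩ <;> simp
  induction h with
  | ret W c hc =>
    intro π Γ hπ hW
    refine key _ _ _ _ (by simp [hπ.length_eq, hlen]) ?_
    rw [stepIx, if_pos hc]
    exact .s2 _ _
  | ask W c j v u hc hu hv ihu ihv =>
    intro π Γ hπ hW
    refine key _ _ _ _ (by simp [hπ.length_eq, hlen]) ?_
    rw [stepIx, if_neg (by omega), if_neg (by omega)]
    refine .s4 _ _ (orc H F j u) _ _ ?_ (.next (hk c _) (ihv π Γ hπ hW))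
    match j with
    | 0 =>
      rw [if_pos (by omega)]
      exact (ihu 0 π Γ hπ hW).start
    | 1 =>
      rw [if_neg (by omega), if_pos (by omega)]
      exact .s8_oracle _ _ _ fun n => .next (hl c n) (ihu n π Γ hπ hW)
    | 2 =>
      rw [if_neg (by omega), if_neg (by omega), if_neg (by omega)]
      exact .s2 _ _
    | 3 =>
      rw [if_neg (by omega), if_neg (by omega), if_pos (by omega)]
      rcases hE with ⟨rfl, rfl, rfl⟩ | ⟨rfl, f, rfl, rfl⟩
      · exact .s2 _ _
      · refine .s4 _ _ (u 0) _ _ (ihu 0 π Γ hπ hW).start ?_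
        refine .s6 _ _ _ _ (by simp [hπ.length_eq]) ?_
        have h1 : (num (u 0) :: (Γ ++ [⟨Ty.pure 1, f⟩]) : Env)[π.length + 1]'(by
            simp [hπ.length_eq]) = ⟨Ty.pure 1, f⟩ := by simp [hπ.length_eq]
        rw [h1, List.eraseIdx_cons_succ]
        exact .s7 _ _ _
    | j + 4 =>
      rw [if_neg (by omega), if_neg (by omega), if_neg (by omega)]
      exact .s2 _ _
  | real W c v σ Φ ξ hc hΦ hξ hi hv ihi ihv =>
    intro π Γ hπ hW
    refine key _ _ _ _ (by simp [hπ.length_eq, hlen]) ?_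
    rw [stepIx, if_neg (by omega), if_pos hc]
    refine .s4 _ _ (Full.apply σ Φ ξ) _ _ ?_ (.next (hk c _) (ihv π Γ hπ hW))
    have hmem : arg c ∈ π := hW _ (List.getElem?_eq_some_iff.1 hΦ).1
    have hpos : π.idxOf (arg c) < π.length := List.idxOf_lt_length_iff.2 hmem
    have hpos' : π.idxOf (arg c) < Γ.length := hπ.length_eq ▸ hpos
    have hget : (Γ ++ E)[π.idxOf (arg c)]'(by rw [List.length_append]; omega) = ⟨σ, Φ⟩ := by
      have := (List.forall₂_iff_get.1 hπ).2 _ hpos hpos'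
      simp only [List.get_eq_getElem, List.getElem_idxOf, hΦ, Option.some.injEq] at this
      rw [List.getElem_append_left hpos', this]
    refine .s6 _ _ _ _ (by rw [List.length_append]; exact Nat.lt_add_right _ hpos') ?_
    rw [hget, List.eraseIdx_append_of_lt_length hpos', List.eraseIdx_eq_take_drop_succ]
    have hty : (W.map fun x => x.1.code).getD (arg c) 0 = σ.code := by
      simp [List.getD_eq_getElem?_getD, hΦ]
    have hargs : argIx p (π, W.map (fun x => x.1.code), e) c = List.ofFn
        fun i : Fin σ.args.length => startIx (runIx p (subShape (π, W.map (fun x => x.1.code), e)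
          (arg c) i)) (child c (Encodable.encode ((i : ℕ), W.length,
            (σ.args.get i).args.length))) := by
      rw [argIx]
      simp only [hty, Ty.toList_code]
      refine List.ext_get (by simp) fun i h1 h2 => ?_
      have hi : i < σ.args.length := by simpa using h1
      simp [hi, Ty.toList_code]
    rw [hargs]
    refine .s8 _ _ _ _ ξ hξ fun i η hη => Comp.start ?_
    -- The induction hypothesis in the extended world, read with its objects in the order in which
    -- S8 lists them.
    have := ihi i η hη (subShape (π, W.map (fun x => x.1.code), e) (arg c) i).1
      (η.toEnv ++ ⟨σ, Φ⟩ :: (Γ.take (π.idxOf (arg c)) ++ Γ.drop (π.idxOf (arg c) + 1))) ?_ ?_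
    · have hT : subShape (π, W.map (fun x => x.1.code), e) (arg c) i =
          ((subShape (π, W.map (fun x => x.1.code), e) (arg c) i).1,
            (W ++ η.toEnv).map (fun x => x.1.code), e) := by
        simp only [subShape, hty, Ty.toList_code, Prod.mk.injEq, true_and, and_true]
        rw [List.map_append, List.append_cancel_left_eq]
        refine List.ext_get (by simp [Args.toEnv, Ty.toList_code]) fun k h1 h2 => ?_
        simp [Args.toEnv, Ty.toList_code]
      rw [hT]
      simpa only [List.append_assoc, List.cons_append] using this
    · simp only [subShape, hty, Ty.toList_code]
      have hlt : ∀ j x, W[j]? = some x → (W ++ η.toEnv)[j]? = some x := fun j x h => by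
        rw [List.getElem?_append_left (List.getElem?_eq_some_iff.1 h).1, h]
      have hπ' := hπ.imp hlt
      refine List.rel_append ?_ (.cons (hlt _ _ hΦ)
        (List.rel_append (List.forall₂_take _ hπ') (List.forall₂_drop _ hπ')))
      refine List.forall₂_iff_get.2 ⟨by simp [Args.toEnv, Ty.toList_code], fun k h1 h2 => ?_⟩
      simp only [Args.toEnv, List.length_ofFn] at h2
      simp [Args.toEnv, List.getElem?_append_right]
      exact h2
    · intro j hj
      simp only [subShape, hty, Ty.toList_code, List.mem_append, List.mem_map, List.mem_range,
        List.mem_cons]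
      by_cases hjW : j < W.length
      · right
        have := hW j hjW
        obtain ⟨n, hn, rfl⟩ := List.getElem_of_mem this
        rcases lt_trichotomy n (π.idxOf (arg c)) with h | h | h
        · exact .inr (.inl (List.mem_take_iff_getElem.2 ⟨n, by omega, rfl⟩))
        · left; subst h; simp
        · refine .inr (.inr (List.mem_drop_iff_getElem.2 ⟨n - (π.idxOf (arg c) + 1), by omega, ?_⟩))
          congr 1
          omega
      · left
        refine ⟨j - W.length, ?_, ?_⟩
        · simp only [List.length_append, Args.toEnv, List.length_ofFn] at hj
          simp only [List.getD_eq_getElem?_getD]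
          simp [Ty.toList_code]
          simp at hj
          omega
        · simp; omega

end Translation


/-! ## Closure properties of the structure of computable functionals -/

section Args

variable {P : Family} {σ τ : Ty}

/-- The tuple with first entry `x` and further entries `ξ`. -/
def Args.cons (x : Full σ) (ξ : Args τ) : Args (Ty.arr σ τ) := fun i =>
  match i with
  | ⟨0, _⟩ => x
  | ⟨k + 1, h⟩ => ξ ⟨k, Nat.lt_of_succ_lt_succ h⟩

/-- The empty tuple. -/
def Args.nil : Args Ty.nat := fun i => i.elim0

theorem Args.eq_nil (ξ : Args Ty.nat) : ξ = Args.nil := funext fun i => i.elim0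

theorem Args.exists_cons (ξ : Args (Ty.arr σ τ)) : ∃ x ξ', ξ = Args.cons x ξ' :=
  ⟨ξ ⟨0, Nat.succ_pos _⟩, fun i => ξ i.succ, funext fun i => by
    match i with
    | ⟨0, _⟩ => rfl
    | ⟨k + 1, h⟩ => rfl⟩

theorem Args.nil_in : Args.nil.In P := fun i => i.elim0

theorem Args.cons_in {x : Full σ} {ξ : Args τ} : (Args.cons x ξ).In P ↔ x ∈ P σ ∧ ξ.In P := by
  refine ⟨fun h => ⟨h ⟨0, Nat.succ_pos _⟩, fun i => h i.succ⟩, fun ⟨h, h'⟩ i => ?_⟩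
  match i with
  | ⟨0, _⟩ => exact h
  | ⟨k + 1, hk⟩ => exact h' ⟨k, Nat.lt_of_succ_lt_succ hk⟩

theorem Args.toEnv_cons (x : Full σ) (ξ : Args τ) :
    (Args.cons x ξ).toEnv = ⟨σ, x⟩ :: ξ.toEnv := by
  refine List.ext_get (by simp [Args.toEnv]) fun i h1 h2 => ?_
  match i with
  | 0 => exact (toEnv_get (Args.cons x ξ) ⟨0, Nat.succ_pos _⟩).trans rfl
  | i + 1 => simp [Args.toEnv, Args.cons]

theorem Full.apply_cons (Φ : Full (Ty.arr σ τ)) (x : Full σ) (ξ : Args τ) :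
    Full.apply (Ty.arr σ τ) Φ (Args.cons x ξ) = Full.apply τ (Φ x) ξ := rfl

theorem Full.apply_zero (ξ : Args σ) : Full.apply σ (Full.zero σ) ξ = 0 := by
  induction σ with
  | nat => rfl
  | arr σ τ _ ih => exact ih _

open Classical in
theorem Full.apply_restrict (Φ : Full σ) (ξ : Args σ) :
    Full.apply σ (restrict P σ Φ) ξ = if ξ.In P then Full.apply σ Φ ξ else 0 := by
  induction σ with
  | nat =>
    obtain rfl := ξ.eq_nil
    rw [if_pos Args.nil_in]
    rfl
  | arr σ τ _ ih =>
    obtain ⟨x, ξ, rfl⟩ := ξ.exists_cons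
    simp only [Full.apply_cons, Args.cons_in, restrict]
    by_cases hx : x ∈ P σ
    · simp [hx, ih]
    · simp [hx, Full.apply_zero]

end Args

/-! ### Programs and membership in the structure -/

section M

variable {H : (ℕ → ℕ) → ℕ}

theorem nat_mem_M (n : ℕ) : n ∈ M H Ty.nat := by simp [M, Ty.level, stage]

/-- `Φ` is realized by one and the same program in all worlds. -/
def HasRealizer (H : (ℕ → ℕ) → ℕ) (σ : Ty) (Φ : Full σ) : Prop :=
  ∃ r, ∀ F W, Realizes H (M H) F σ Φ W r

/-- The program that applies the program `a` to the program `b`. -/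
theorem exists_application (H : (ℕ → ℕ) → ℕ) : ∃ k : ℕ × ℕ → ℕ, Primrec k ∧ ∀ F W σ τ
    (Φ : Full (Ty.arr σ τ)) (x : Full σ) (a b : ℕ), x ∈ M H σ →
      Realizes H (M H) F (Ty.arr σ τ) Φ W a → Realizes H (M H) F σ x W b →
        Realizes H (M H) F τ (Φ x) W (k (a, b)) := by
  obtain ⟨k, hk, hk'⟩ := (HC.goto (H := H) (P := M H) (α := (ℕ × ℕ) × List ℕ)
    (f := fun a => run a.1.1 (Encodable.encode (a.1.2 :: a.2))) (by fun_prop)).closure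
  refine ⟨k, hk, fun F W σ τ Φ x a b hx ha hb => realizes_iff.2 fun W' hW ξ hξ s hs => ?_⟩
  rw [hk', ← Full.apply_cons]
  refine (ha.mono hW).val (Args.cons_in.2 ⟨hx, hξ⟩) ?_
  rw [Args.toEnv_cons]
  exact .cons (hb.mono hW) hs

/-- The realizer runs the interpreter at an index of `Φ`. -/
theorem HasRealizer.of_mem {σ : Ty} {Φ : Full σ} (h : Φ ∈ M H σ) : HasRealizer H σ Φ := by
  obtain ⟨⟨e, he⟩, -⟩ := (mem_M_iff H σ Φ).1 h
  obtain ⟨p, hp⟩ := exists_interpreter (H := H) (P := M H) nat_mem_M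
  obtain ⟨k, hk, hk'⟩ := (HC.goto (H := H) (P := M H) (α := Unit × List ℕ)
    (f := fun a => run p (Encodable.encode (e, a.2))) (by fun_prop)).closure
  refine ⟨k (), fun F W => realizes_iff.2 fun W' _ ξ hξ s hs => ?_⟩
  rw [hk']
  exact hp _ _ _ (he ξ hξ) F W' s hs

/-- A functional is an object of the structure if its values are computed by the machine from
pointers to the arguments. -/
theorem mem_M_of_val {σ : Ty} {Φ : Full σ} (h0 : ∀ ξ : Args σ, ¬ ξ.In (M H) → Full.apply σ Φ ξ = 0)
    {c : ℕ} (h : ∀ ξ : Args σ, ξ.In (M H) →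
      Val H (M H) (fun _ => 0) ξ.toEnv c (Full.apply σ Φ ξ)) : Φ ∈ M H σ := by
  obtain ⟨J, hJ⟩ := exists_translation H (M H)
  refine (mem_M_iff H σ Φ).2 ⟨⟨startIx (J (List.range σ.args.length, σ.args.map Ty.code, 0)) c,
    fun ξ hξ => Comp.start ?_⟩, h0⟩
  have := hJ 0 [] _ (.inl ⟨rfl, rfl, rfl⟩) _ _ _ (h ξ hξ) (List.range σ.args.length) ξ.toEnv ?_ ?_
  · have ht : ξ.toEnv.map (fun x => x.1.code) = σ.args.map Ty.code :=
      List.ext_get (by simp [Args.toEnv]) fun k h1 h2 => by simp [Args.toEnv]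
    rwa [List.append_nil, ht] at this
  · refine List.forall₂_iff_get.2 ⟨by simp [Args.toEnv], fun k h1 h2 => ?_⟩
    simp
  · simp [Args.toEnv]

/-- The arguments are taken as the world, and the realizer is applied to pointers to them; the
resulting computation compiles to an index. -/
theorem HasRealizer.mem {σ : Ty} {Φ : Full σ} (h : HasRealizer H σ Φ)
    (h0 : ∀ ξ : Args σ, ¬ ξ.In (M H) → Full.apply σ Φ ξ = 0) : Φ ∈ M H σ := by
  obtain ⟨r, hr⟩ := h
  obtain ⟨k, hk, hk'⟩ := exists_pointer (H := H) (P := M H)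
  refine mem_M_of_val h0 (c := run r (Encodable.encode (List.ofFn fun i : Fin σ.args.length => k i)))
    fun ξ hξ => (hr _ _).val hξ (realizesEnv_toEnv.2 ⟨_, rfl, fun i => hk' _ _ _ _ _ ?_⟩)
  simp [Args.toEnv]

theorem HasRealizer.app {σ τ : Ty} {Φ : Full (Ty.arr σ τ)} {x : Full σ}
    (hΦ : HasRealizer H (Ty.arr σ τ) Φ) (hx : x ∈ M H σ) : HasRealizer H τ (Φ x) := by
  obtain ⟨k, -, hk⟩ := exists_application H
  obtain ⟨a, ha⟩ := hΦ
  obtain ⟨b, hb⟩ := HasRealizer.of_mem hx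
  exact ⟨k (a, b), fun F W => hk F W σ τ Φ x a b hx (ha F W) (hb F W)⟩

/-- The structure is closed under application. -/
theorem app_mem_M {σ τ : Ty} {Φ : Full (Ty.arr σ τ)} {x : Full σ} (hΦ : Φ ∈ M H (Ty.arr σ τ))
    (hx : x ∈ M H σ) : Φ x ∈ M H τ :=
  ((HasRealizer.of_mem hΦ).app hx).mem fun ξ hξ =>
    ((mem_M_iff H _ Φ).1 hΦ).2 (Args.cons x ξ) fun h => hξ (Args.cons_in.1 h).2

/-- The restriction of a functional is an object of the structure if it has a realizer. -/
theorem restrict_mem_M {σ : Ty} {Φ : Full σ} {f : List ℕ → ℕ} (hf : Primrec f)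
    (h : ∀ F W ξ s, ξ.In (M H) → RealizesEnv H (M H) F W ξ.toEnv s →
      Val H (M H) F W (f s) (Full.apply σ Φ ξ)) : restrict (M H) σ Φ ∈ M H σ := by
  obtain ⟨k, -, hk⟩ := (HC.goto (H := H) (P := M H) (α := Unit × List ℕ)
    (f := fun a => f a.2) (hf.comp Primrec.snd)).closure
  refine HasRealizer.mem ⟨k (), fun F W => realizes_iff.2 fun W' _ ξ hξ s hs => ?_⟩ fun ξ hξ => ?_
  · rw [Full.apply_restrict, if_pos hξ, hk]
    exact h F W' ξ s hξ hs
  · rw [Full.apply_restrict, if_neg hξ]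

theorem combK_mem_M (σ τ : Ty) :
    restrict (M H) (Ty.arr σ (Ty.arr τ σ)) (fun x _ => x) ∈ M H (Ty.arr σ (Ty.arr τ σ)) := by
  refine restrict_mem_M (f := fun s => run (s.getD 0 0) (Encodable.encode s.tail.tail))
    (by fun_prop) fun F W ξ s hξ hs => ?_
  obtain ⟨x, ξ, rfl⟩ := ξ.exists_cons
  obtain ⟨y, ξ, rfl⟩ := ξ.exists_cons
  simp only [Args.cons_in] at hξ
  simp only [Args.toEnv_cons] at hs
  rcases hs with _ | ⟨hx, _ | ⟨hy, hs⟩⟩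
  exact hx.val hξ.2.2 hs

theorem combS_mem_M (ρ σ τ : Ty) :
    restrict (M H) (Ty.arr (Ty.arr ρ (Ty.arr σ τ)) (Ty.arr (Ty.arr ρ σ) (Ty.arr ρ τ)))
      (fun f g x => f x (g x)) ∈
        M H (Ty.arr (Ty.arr ρ (Ty.arr σ τ)) (Ty.arr (Ty.arr ρ σ) (Ty.arr ρ τ))) := by
  obtain ⟨k, hk, hk'⟩ := exists_application H
  refine restrict_mem_M (f := fun s => run (s.getD 0 0) (Encodable.encode
    (s.getD 2 0 :: k (s.getD 1 0, s.getD 2 0) :: s.tail.tail.tail)))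
    (by fun_prop) fun F W ξ s hξ hs => ?_
  obtain ⟨f, ξ, rfl⟩ := ξ.exists_cons
  obtain ⟨g, ξ, rfl⟩ := ξ.exists_cons
  obtain ⟨x, ξ, rfl⟩ := ξ.exists_cons
  simp only [Args.cons_in] at hξ
  simp only [Args.toEnv_cons] at hs
  rcases hs with _ | ⟨hf, _ | ⟨hg, _ | ⟨hx, hs⟩⟩⟩
  refine hf.val (ξ := Args.cons x (Args.cons (g x) ξ)) ?_ ?_
  · simp only [Args.cons_in]
    exact ⟨hξ.2.2.1, app_mem_M hξ.2.1 hξ.2.2.1, hξ.2.2.2⟩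
  · simp only [Args.toEnv_cons]
    exact .cons hx (.cons (hk' F W _ _ g x _ _ hξ.2.2.1 hg hx) hs)

/-- A self-referential program recurses on the number. The previous value has type `σ` and is passed
to `f` unevaluated, as a closure. -/
theorem recursor_mem_M (σ : Ty) :
    restrict (M H) (Ty.arr (Ty.arr Ty.nat (Ty.arr σ σ)) (Ty.arr σ (Ty.arr Ty.nat σ)))
      (fun f m n => Nat.rec (motive := fun _ => Full σ) m f n) ∈
        M H (Ty.arr (Ty.arr Ty.nat (Ty.arr σ σ)) (Ty.arr σ (Ty.arr Ty.nat σ))) := by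
  obtain ⟨num', hnum, hnum'⟩ := exists_numeral H (M H)
  obtain ⟨cl, hcl, hcl'⟩ := (HC.goto (H := H) (P := M H) (α := (ℕ × ℕ × ℕ × ℕ) × List ℕ)
    (f := fun a => run a.1.1 (Encodable.encode (a.1.2.1, a.1.2.2.1, a.1.2.2.2, a.2)))
    (by fun_prop)).closure
  have hn : Primrec fun a : ℕ × ℕ × ℕ × ℕ × List ℕ => num' (a.2.2.2.1 - 1) :=
    hnum.comp (by fun_prop)
  have hc : Primrec fun a : ℕ × ℕ × ℕ × ℕ × List ℕ => cl (a.1, a.2.1, a.2.2.1, a.2.2.2.1 - 1) :=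
    hcl.comp (by fun_prop)
  obtain ⟨p, hp⟩ := exists_fixed (α := ℕ × ℕ × ℕ × List ℕ) (f := fun a =>
    if a.2.2.2.1 = 0 then run a.2.2.1 (Encodable.encode a.2.2.2.2) else
      run a.2.1 (Encodable.encode (num' (a.2.2.2.1 - 1) :: cl (a.1, a.2.1, a.2.2.1, a.2.2.2.1 - 1)
        :: a.2.2.2.2)))
    (Prim.ite_eq (by fun_prop) (by fun_prop) (by fun_prop)
      (primrec_run (by fun_prop) (Prim.encode (Prim.cons (Prim.cons (by fun_prop) hc) hn))))
  -- The third argument is evaluated first: the recursion needs the number itself and not a realizer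
  -- of it.
  obtain ⟨g, hg, hg'⟩ := (HC.goto (H := H) (P := M H) (α := List ℕ) (f := fun s =>
    run (s.getD 2 0) (Encodable.encode ([] : List ℕ))) (by fun_prop)).bind
      (HC.goto (f := fun a => run p (Encodable.encode (a.1.getD 0 0, a.1.getD 1 0, a.2,
        a.1.tail.tail.tail))) (by fun_prop))
  refine restrict_mem_M hg fun F W ξ s hξ hs => ?_
  obtain ⟨f, ξ, rfl⟩ := ξ.exists_cons
  obtain ⟨m, ξ, rfl⟩ := ξ.exists_cons
  obtain ⟨n, ξ, rfl⟩ := ξ.exists_cons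
  simp only [Args.cons_in] at hξ
  simp only [Args.toEnv_cons] at hs
  rcases hs with _ | @⟨_, a, _, _, hf, _ | @⟨_, b, _, _, hm, _ | ⟨hx, hs⟩⟩⟩
  rw [hg']
  refine ⟨n, hx.val_nat, ?_⟩
  obtain ⟨hfM, hmM, -, hξ⟩ := hξ
  simp only [Full.apply_cons]
  -- Realizers act correctly only on arguments from the structure, so the intermediate values must
  -- belong to it.
  have hmem : ∀ n : ℕ, (Nat.rec (motive := fun _ => Full σ) m f n : Full σ) ∈ M H σ := by
    intro n
    induction n with
    | zero => exact hmM
    | succ n ih => exact app_mem_M (app_mem_M hfM (nat_mem_M n)) ih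
  have key : ∀ n : ℕ, ∀ W', W <+: W' → ∀ ξ s, Args.In (M H) ξ →
      RealizesEnv H (M H) F W' (Args.toEnv ξ) s →
      Val H (M H) F W' (run p (Encodable.encode (a, b, n, s)))
        (Full.apply σ (Nat.rec (motive := fun _ => Full σ) m f n) ξ) := by
    intro n
    induction n with
    | zero =>
      intro W' hW ξ s hξ hs
      rw [hp]
      exact (hm.mono hW).val hξ hs
    | succ n ih =>
      intro W' hW ξ s hξ hs
      rw [hp]
      refine (hf.mono hW).val
        (ξ := Args.cons n (Args.cons (Nat.rec (motive := fun _ => Full σ) m f n) ξ)) ?_ ?_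
      · simp only [Args.cons_in]
        exact ⟨nat_mem_M n, hmem n, hξ⟩
      · simp only [Args.toEnv_cons]
        refine .cons (hnum' n F W') (.cons (realizes_iff.2 fun W'' hW' η hη t ht => ?_) hs)
        rw [hcl']
        exact ih W'' (hW.trans hW') η t hη ht
  exact key n W (List.prefix_refl W) ξ _ hξ hs

/-- A binary function computed by the machine is an object of the structure. -/
theorem mem_M_of_binary {Y : ℕ → ℕ → ℕ} {f : ℕ × ℕ → ℕ} (hf : Primrec f)
    (h : ∀ m n, Val H (M H) (fun _ => 0) [] (f (m, n)) (Y m n)) :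
    Y ∈ M H (Ty.arr Ty.nat (Ty.arr Ty.nat Ty.nat)) := by
  obtain ⟨l, hl, hl'⟩ := exists_pointer (H := H) (P := M H)
  obtain ⟨g, hg, hg'⟩ := ((HC.goto (H := H) (P := M H) (α := Unit) (f := fun _ =>
    run (l 0) (Encodable.encode ([] : List ℕ))) (by fun_prop)).bind
      ((HC.goto (f := fun _ => run (l 1) (Encodable.encode ([] : List ℕ)))
        (by fun_prop)).bind (HC.goto (f := fun a => f (a.1.2, a.2)) (by fun_prop))))
  refine mem_M_of_val (c := g ()) (fun ξ hξ => ?_) fun ξ hξ => ?_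
  all_goals
    obtain ⟨m, ξ, rfl⟩ := ξ.exists_cons
    obtain ⟨n, ξ, rfl⟩ := ξ.exists_cons
    obtain rfl := ξ.eq_nil
  · exact absurd (Args.cons_in.2 ⟨nat_mem_M m, Args.cons_in.2 ⟨nat_mem_M n, Args.nil_in⟩⟩) hξ
  · rw [hg']
    exact ⟨m, (hl' _ _ 0 Ty.nat m rfl).val_nat, n, (hl' _ _ 1 Ty.nat n rfl).val_nat,
      (h m n).weaken⟩

/-- The functions in the structure are those that are computed by the machine. -/
theorem mem_M_one_iff {f : ℕ → ℕ} : f ∈ M H (Ty.pure 1) ↔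
    ∃ p, ∀ n, Val H (M H) (fun _ => 0) [] (run p n) (f n) := by
  constructor
  · intro h
    obtain ⟨num', hnum, hnum'⟩ := exists_numeral H (M H)
    obtain ⟨r, hr⟩ := HasRealizer.of_mem h
    obtain ⟨k, hk, hk'⟩ := (HC.goto (H := H) (P := M H) (α := Unit × ℕ)
      (f := fun a => run r (Encodable.encode [num' a.2])) (by fun_prop)).closure
    exact ⟨k (), fun n => (hk' () n _ _ _).2 ((hr _ _).val_one nat_mem_M (hnum' n _ _))⟩
  · rintro ⟨p, hp⟩
    obtain ⟨l, hl, hl'⟩ := exists_pointer (H := H) (P := M H)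
    obtain ⟨g, hg, hg'⟩ := (HC.goto (H := H) (P := M H) (α := Unit) (f := fun _ =>
      run (l 0) (Encodable.encode ([] : List ℕ))) (by fun_prop)).bind
        (HC.goto (f := fun a => run p a.2) (by fun_prop))
    refine mem_M_of_val (c := g ()) (fun ξ hξ => ?_) fun ξ hξ => ?_
    · obtain ⟨n, ξ, rfl⟩ := ξ.exists_cons
      obtain rfl := ξ.eq_nil
      exact absurd (Args.cons_in.2 ⟨nat_mem_M n, Args.nil_in⟩) hξ
    · obtain ⟨n, ξ, rfl⟩ := ξ.exists_cons
      obtain rfl := ξ.eq_nil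
      rw [hg']
      exact ⟨n, (hl' _ _ 0 Ty.nat n rfl).val_nat, (hp n).weaken⟩

/-- A functional of type two is an object of the structure if it is computed by the machine from
its argument, as an oracle. -/
theorem mem_M_two {G : (ℕ → ℕ) → ℕ} (h0 : ∀ f, f ∉ M H (Ty.pure 1) → G f = 0) {c : ℕ}
    (h : ∀ f ∈ M H (Ty.pure 1), Val H (M H) (fun u => f (u 0)) [] c (G f)) :
    G ∈ M H (Ty.pure 2) := by
  obtain ⟨J, hJ⟩ := exists_translation H (M H)
  refine (mem_M_iff H (Ty.pure 2) G).2 ⟨⟨startIx (J ([], [], 1)) c, fun ξ hξ => Comp.start ?_⟩, fun ξ hξ => ?_⟩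
  · obtain ⟨f, ξ, rfl⟩ := ξ.exists_cons
    obtain rfl := ξ.eq_nil
    exact hJ 1 [⟨Ty.pure 1, f⟩] _ (.inr ⟨rfl, f, rfl, rfl⟩) _ _ _
      (h f (Args.cons_in.1 hξ).1) [] [] .nil (by simp)
  · obtain ⟨f, ξ, rfl⟩ := ξ.exists_cons
    obtain rfl := ξ.eq_nil
    exact h0 f fun hf => hξ (Args.cons_in.2 ⟨hf, Args.nil_in⟩)

/-- A functional of type one is realized by every program that computes it. -/
theorem exists_realizer_one (H : (ℕ → ℕ) → ℕ) : ∃ k : ℕ → ℕ, Primrec k ∧ ∀ p (f : ℕ → ℕ) F W,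
    (∀ n, Val H (M H) F [] (run p n) (f n)) → Realizes H (M H) F (Ty.pure 1) f W (k p) := by
  obtain ⟨k, hk, hk'⟩ := ((HC.goto (H := H) (P := M H) (α := ℕ × List ℕ) (f := fun s =>
    run (s.2.getD 0 0) (Encodable.encode ([] : List ℕ))) (by fun_prop)).bind
      (HC.goto (f := fun a => run a.1.1 a.2) (by fun_prop))).closure
  refine ⟨k, hk, fun p f F W h => realizes_iff.2 fun W' hW ξ hξ s hs => ?_⟩
  obtain ⟨n, ξ, rfl⟩ := ξ.exists_cons
  obtain rfl := ξ.eq_nil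
  simp only [Args.toEnv_cons] at hs
  rcases hs with _ | ⟨hn, _⟩
  rw [hk']
  exact ⟨n, hn.val_nat, (h n).weaken⟩

/-! ## Evaluation of terms -/

variable {ρ : Assignment} {i j : ℕ}

/-- The terms with two variables, of types `0` and `1`, have realizers in the realizers of the
variables, and their values are in the structure. -/
theorem exists_term_realizer (hρ : ∀ v, ρ v ∈ M H v.1) {σ : Ty} (t : Term σ) :
    ∃ k : ℕ × ℕ → ℕ, Primrec k ∧ ∀ F W (x : ℕ) (y : ℕ → ℕ) a b, y ∈ M H (Ty.pure 1) →
      Realizes H (M H) F Ty.nat x W a → Realizes H (M H) F (Ty.pure 1) y W b →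
        t.eval (M H) (Function.update (Function.update ρ (Ty.nat, i) x) (Ty.pure 1, j) y) ∈ M H σ ∧
        Realizes H (M H) F σ (t.eval (M H)
          (Function.update (Function.update ρ (Ty.nat, i) x) (Ty.pure 1, j) y)) W (k (a, b)) := by
  have hconst : ∀ {σ : Ty} (Φ : Full σ), Φ ∈ M H σ → ∃ k : ℕ × ℕ → ℕ, Primrec k ∧
      ∀ F W (x : ℕ) (y : ℕ → ℕ) a b, y ∈ M H (Ty.pure 1) →
      Realizes H (M H) F Ty.nat x W a → Realizes H (M H) F (Ty.pure 1) y W b →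
        Φ ∈ M H σ ∧ Realizes H (M H) F σ Φ W (k (a, b)) := by
    intro σ Φ h
    obtain ⟨r, hr⟩ := HasRealizer.of_mem h
    exact ⟨fun _ => r, Primrec.const r, fun F W _ _ _ _ _ _ _ => ⟨h, hr F W⟩⟩
  induction t with
  | var σ n =>
    by_cases h1 : (σ, n) = (Ty.pure 1, j)
    · cases h1
      refine ⟨fun q => q.2, Primrec.snd, fun F W x y a b hy ha hb => ?_⟩
      simp only [Term.eval, Function.update_self]
      exact ⟨hy, hb⟩
    by_cases h2 : (σ, n) = (Ty.nat, i)
    · cases h2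
      refine ⟨fun q => q.1, Primrec.fst, fun F W x y a b hy ha hb => ?_⟩
      simp only [Term.eval]
      rw [Function.update_of_ne h1, Function.update_self]
      exact ⟨nat_mem_M x, ha⟩
    · obtain ⟨k, hk, hk'⟩ := hconst (ρ (σ, n)) (hρ _)
      refine ⟨k, hk, fun F W x y a b hy ha hb => ?_⟩
      simp only [Term.eval]
      rw [Function.update_of_ne h1, Function.update_of_ne h2]
      exact hk' F W x y a b hy ha hb
  | app t s iht ihs =>
    obtain ⟨k, hk, hk'⟩ := iht
    obtain ⟨l, hl, hl'⟩ := ihs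
    obtain ⟨m, hm, hm'⟩ := exists_application H
    refine ⟨fun q => m (k q, l q), by fun_prop, fun F W x y a b hy ha hb => ?_⟩
    obtain ⟨h1, h2⟩ := hk' F W x y a b hy ha hb
    obtain ⟨h3, h4⟩ := hl' F W x y a b hy ha hb
    exact ⟨app_mem_M h1 h3, hm' F W _ _ _ _ _ _ h3 h2 h4⟩
  | zero => exact hconst _ (nat_mem_M 0)
  | one => exact hconst _ (nat_mem_M 1)
  | add =>
    exact hconst _ (mem_M_of_binary (f := fun q => act (retAct (q.1 + q.2))) (by fun_prop)
      fun _ _ => val_act_ret.2 rfl)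
  | mul =>
    exact hconst _ (mem_M_of_binary (f := fun q => act (retAct (q.1 * q.2))) (by fun_prop)
      fun _ _ => val_act_ret.2 rfl)
  | combK σ τ => exact hconst _ (combK_mem_M σ τ)
  | combS ρ σ τ => exact hconst _ (combS_mem_M ρ σ τ)
  | recursor σ => exact hconst _ (recursor_mem_M σ)

open Classical in
/-- The truth value of a quantifier-free formula is computed by the machine. -/
theorem exists_truth_value (hρ : ∀ v, ρ v ∈ M H v.1) (A : QF) :
    ∃ f : ℕ × ℕ → ℕ, Primrec f ∧ ∀ F W (x : ℕ) (y : ℕ → ℕ) a b, y ∈ M H (Ty.pure 1) →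
      Realizes H (M H) F Ty.nat x W a → Realizes H (M H) F (Ty.pure 1) y W b →
        Val H (M H) F W (f (a, b)) (if A.Holds (M H)
          (Function.update (Function.update ρ (Ty.nat, i) x) (Ty.pure 1, j) y) then 1 else 0) := by
  have hbin : ∀ {f g : ℕ × ℕ → ℕ} {h : ℕ × ℕ → ℕ}, Primrec f → Primrec g → Primrec h →
      ∃ e : ℕ × ℕ → ℕ, Primrec e ∧ ∀ F W q m n, Val H (M H) F W (f q) m →
        Val H (M H) F W (g q) n → Val H (M H) F W (e q) (h (m, n)) := by
    intro f g h hf hg hh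
    obtain ⟨e, he, he'⟩ := (HC.goto (H := H) (P := M H) hf).bind ((HC.goto
      (f := fun a : (ℕ × ℕ) × ℕ => g a.1) (by fun_prop)).bind (HC.ret (f := fun a => h (a.1.2, a.2))
        (by fun_prop)))
    exact ⟨e, he, fun F W q m n hm hn => (he' F W q _).2 ⟨m, hm, n, hn, rfl⟩⟩
  induction A with
  | eq t s =>
    obtain ⟨k, hk, hk'⟩ := exists_term_realizer (i := i) (j := j) hρ t
    obtain ⟨l, hl, hl'⟩ := exists_term_realizer (i := i) (j := j) hρ s
    obtain ⟨e, he, he'⟩ := hbin (f := fun q => run (k q) (Encodable.encode ([] : List ℕ)))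
      (g := fun q => run (l q) (Encodable.encode ([] : List ℕ)))
      (h := fun q => if q.1 = q.2 then 1 else 0) (by fun_prop) (by fun_prop) (by fun_prop)
    refine ⟨e, he, fun F W x y a b hy ha hb => ?_⟩
    convert he' F W _ _ _
      (hk' F W x y a b hy ha hb).2.val_nat (hl' F W x y a b hy ha hb).2.val_nat
    exact Iff.rfl
  | lt t s =>
    obtain ⟨k, hk, hk'⟩ := exists_term_realizer (i := i) (j := j) hρ t
    obtain ⟨l, hl, hl'⟩ := exists_term_realizer (i := i) (j := j) hρ s
    obtain ⟨e, he, he'⟩ := hbin (f := fun q => run (k q) (Encodable.encode ([] : List ℕ)))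
      (g := fun q => run (l q) (Encodable.encode ([] : List ℕ)))
      (h := fun q => if q.1 < q.2 then 1 else 0) (by fun_prop) (by fun_prop) (by fun_prop)
    refine ⟨e, he, fun F W x y a b hy ha hb => ?_⟩
    convert he' F W _ _ _
      (hk' F W x y a b hy ha hb).2.val_nat (hl' F W x y a b hy ha hb).2.val_nat
    exact Iff.rfl
  | not A ih =>
    obtain ⟨f, hf, hf'⟩ := ih
    obtain ⟨e, he, he'⟩ := hbin hf hf (h := fun q => 1 - q.1) (by fun_prop)
    refine ⟨e, he, fun F W x y a b hy ha hb => ?_⟩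
    have h1 := hf' F W x y a b hy ha hb
    have := he' F W _ _ _ h1 h1
    by_cases hA : A.Holds (M H)
      (Function.update (Function.update ρ (Ty.nat, i) x) (Ty.pure 1, j) y) <;>
    simpa [QF.Holds, hA] using this
  | and A B ihA ihB =>
    obtain ⟨f, hf, hf'⟩ := ihA
    obtain ⟨g, hg, hg'⟩ := ihB
    obtain ⟨e, he, he'⟩ := hbin hf hg (h := fun q => q.1 * q.2) (by fun_prop)
    refine ⟨e, he, fun F W x y a b hy ha hb => ?_⟩
    have := he' F W _ _ _ (hf' F W x y a b hy ha hb) (hg' F W x y a b hy ha hb)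
    by_cases hA : A.Holds (M H)
      (Function.update (Function.update ρ (Ty.nat, i) x) (Ty.pure 1, j) y) <;>
    by_cases hB : B.Holds (M H)
      (Function.update (Function.update ρ (Ty.nat, i) x) (Ty.pure 1, j) y) <;>
    simpa [QF.Holds, hA, hB] using this
  | or A B ihA ihB =>
    obtain ⟨f, hf, hf'⟩ := ihA
    obtain ⟨g, hg, hg'⟩ := ihB
    obtain ⟨e, he, he'⟩ := hbin hf hg (h := fun q => 1 - (1 - q.1) * (1 - q.2)) (by fun_prop)
    refine ⟨e, he, fun F W x y a b hy ha hb => ?_⟩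
    have := he' F W _ _ _ (hf' F W x y a b hy ha hb) (hg' F W x y a b hy ha hb)
    by_cases hA : A.Holds (M H)
      (Function.update (Function.update ρ (Ty.nat, i) x) (Ty.pure 1, j) y) <;>
    by_cases hB : B.Holds (M H)
      (Function.update (Function.update ρ (Ty.nat, i) x) (Ty.pure 1, j) y) <;>
    simpa [QF.Holds, hA, hB] using this
  | imp A B ihA ihB =>
    obtain ⟨f, hf, hf'⟩ := ihA
    obtain ⟨g, hg, hg'⟩ := ihB
    obtain ⟨e, he, he'⟩ := hbin hf hg (h := fun q => 1 - q.1 * (1 - q.2)) (by fun_prop)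
    refine ⟨e, he, fun F W x y a b hy ha hb => ?_⟩
    have := he' F W _ _ _ (hf' F W x y a b hy ha hb) (hg' F W x y a b hy ha hb)
    by_cases hA : A.Holds (M H)
      (Function.update (Function.update ρ (Ty.nat, i) x) (Ty.pure 1, j) y) <;>
    by_cases hB : B.Holds (M H)
      (Function.update (Function.update ρ (Ty.nat, i) x) (Ty.pure 1, j) y) <;>
    simpa [QF.Holds, hA, hB] using this

end M


/-! ## Stage comparison and Gandy selection -/

section Stage

variable {H F : (ℕ → ℕ) → ℕ}

/-- With an argument of type one, computations depend on the structure only at type 0, where `M H`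
is full. -/
theorem Normal.exists_comp (hH : Normal H) :
    ∃ e, ∀ f : ℕ → ℕ, Comp H (M H) e [⟨Ty.pure 1, f⟩] (existsTwo f) := by
  obtain ⟨e, he⟩ := hH
  refine ⟨e, fun f => (he f).congr (n := 1) (fun τ hτ => ?_) fun v hv => ?_⟩
  · cases τ with
    | nat => exact (Set.eq_univ_of_forall nat_mem_M).symm
    | arr σ τ => simp only [Ty.level] at hτ; omega
  · obtain rfl := List.mem_singleton.1 hv
    simp [Ty.level]

/-- Quantification over the numbers is computed by the machine. -/
theorem Normal.exists_quantifier (hH : Normal H) {α : Type} [Primcodable α] {f : α × ℕ → ℕ}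
    (hf : Primrec f) : ∃ g : α → ℕ, Primrec g ∧ ∀ F a u,
      (∀ n, Val H (M H) F [] (f (a, n)) (u n)) → Val H (M H) F [] (g a) (existsTwo u) := by
  obtain ⟨e, he⟩ := hH.exists_comp
  obtain ⟨p, hp⟩ := exists_interpreter (H := H) (P := M H) nat_mem_M
  obtain ⟨k, hk, hk'⟩ := exists_realizer_one H
  obtain ⟨l, hl, hl'⟩ := exists_closure hf
  refine ⟨fun a => run p (Encodable.encode (e, [k (l a)])), by fun_prop, fun F a u hu => ?_⟩
  exact hp _ _ _ (he u) F [] _ (.cons (hk' _ u F [] fun n => (hl' a n _ _ _ _ _).2 (hu n)) .nil)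

/-- `x` is an immediate subcomputation of `c`. -/
def Child (H F : (ℕ → ℕ) → ℕ) (x c : ℕ) : Prop :=
  -- A stuck configuration is its own child, hence not accessible. Asking for an object is stuck as
  -- well, because the world is empty.
  ((kind c = 1 ∨ kind c = 2) ∧ x = c) ∨ (3 ≤ kind c ∧ ((∃ n, x = child c n) ∨
    ∃ u, (∀ n, Val H (M H) F [] (child c n) (u n)) ∧ x = cont c (orc H F (kind c - 3) u)))

/-- The continuation counts as a child only when all `child c n` have values; accessibility provides
these values first and then that of the continuation. -/
theorem acc_child_iff {c : ℕ} : Acc (Child H F) c ↔ ∃ v, Val H (M H) F [] c v := by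
  constructor
  · intro h
    induction h with
    | intro c h ih =>
      rcases Nat.lt_or_ge (kind c) 3 with h3 | h3
      · rcases Nat.eq_zero_or_pos (kind c) with h0 | h0
        · exact ⟨_, .ret _ _ h0⟩
        · have hc : Child H F c c := .inl ⟨by omega, rfl⟩
          exact ih c hc
      · choose u hu using fun n => ih (child c n) (.inr ⟨h3, .inl ⟨n, rfl⟩⟩)
        obtain ⟨v, hv⟩ := ih _ (.inr ⟨h3, .inr ⟨u, hu, rfl⟩⟩)
        exact ⟨v, .ask _ _ (kind c - 3) _ u (by omega) hu hv⟩
  · rintro ⟨v, hv⟩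
    generalize hW : ([] : Env) = W at hv
    induction hv with
    | ret W c hc =>
      refine ⟨_, fun x hx => ?_⟩
      rcases hx with ⟨h, -⟩ | ⟨h, -⟩ <;> omega
    | ask W c j v u hc hu hv ihu ihv =>
      subst hW
      refine ⟨_, fun x hx => ?_⟩
      rcases hx with ⟨h, -⟩ | ⟨h, ⟨n, rfl⟩ | ⟨u', hu', rfl⟩⟩
      · omega
      · exact ihu n rfl
      · obtain rfl : u = u' := funext fun n => (hu n).unique (hu' n)
        have : kind c - 3 = j := by omega
        rw [this]
        exact ihv rfl
    | real W c v σ Φ ξ hc hΦ => subst hW; simp at hΦ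

open Classical in
/-- The stage of a computation. -/
noncomputable def rank (H F : (ℕ → ℕ) → ℕ) (c : ℕ) : WithTop Ordinal.{0} :=
  if h : Acc (Child H F) c then (h.rank : WithTop Ordinal.{0}) else ⊤

theorem rank_lt_top {c : ℕ} : rank H F c < ⊤ ↔ ∃ v, Val H (M H) F [] c v := by
  rw [← acc_child_iff, rank]
  split_ifs with h
  · simpa using h
  · simpa using h

theorem rank_lt {x c : ℕ} (h : Child H F x c) (hc : rank H F c < ⊤) :
    rank H F x < rank H F c := by
  have hc' := acc_child_iff.2 (rank_lt_top.1 hc)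
  rw [rank, rank, dif_pos hc', dif_pos (hc'.inv h)]
  exact WithTop.coe_lt_coe.2 (Acc.rank_lt_of_rel hc' h)

theorem rank_le {c : ℕ} {b : WithTop Ordinal.{0}} (h : ∀ x, Child H F x c → rank H F x < b) :
    rank H F c ≤ b := by
  have hc : Acc (Child H F) c := ⟨_, fun x hx =>
    acc_child_iff.2 (rank_lt_top.1 ((h x hx).trans_le le_top))⟩
  cases b with
  | top => exact le_top
  | coe o =>
    rw [rank, dif_pos hc, hc.rank_eq]
    refine WithTop.coe_le_coe.2 (Ordinal.iSup_le fun x => Order.succ_le_of_lt ?_)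
    have := h x.1 x.2
    rw [rank, dif_pos (hc.inv x.2)] at this
    exact WithTop.coe_lt_coe.1 this

theorem exists_rank_le {c : ℕ} {b : WithTop Ordinal.{0}} (h : b < rank H F c) :
    ∃ x, Child H F x c ∧ b ≤ rank H F x := by
  by_contra! h'
  exact h.not_ge (rank_le h')

theorem child_iff {x c : ℕ} (hc : 3 ≤ kind c) {u : ℕ → ℕ}
    (hu : ∀ n, Val H (M H) F [] (child c n) (u n)) :
    Child H F x c ↔ (∃ n, x = child c n) ∨ x = cont c (orc H F (kind c - 3) u) := by
  constructor
  · rintro (⟨h, -⟩ | ⟨-, h | ⟨u', hu', rfl⟩⟩)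
    · omega
    · exact .inl h
    · obtain rfl : u = u' := funext fun n => (hu n).unique (hu' n)
      exact .inr rfl
  · rintro (h | rfl)
    · exact .inr ⟨hc, .inl h⟩
    · exact .inr ⟨hc, .inr ⟨u, hu, rfl⟩⟩

theorem existsTwo_of_exists {u : ℕ → ℕ} (h : ∃ n, u n = 0) : existsTwo u = 0 := by
  rw [existsTwo, if_pos h]

theorem existsTwo_of_not {u : ℕ → ℕ} (h : ∀ n, u n ≠ 0) : existsTwo u = 1 := by
  rw [existsTwo, if_neg (by push Not; exact h)]

open Classical in
/-- Stage comparison: the machine decides which of two computations, at least one of which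
terminates, has the lower stage. -/
theorem Normal.exists_comparison (hH : Normal H) : ∃ p, ∀ F c d,
    (rank H F c < ⊤ ∨ rank H F d < ⊤) →
      Val H (M H) F [] (run p (Encodable.encode (c, d)))
        (if rank H F c ≤ rank H F d then 0 else 1) := by
  obtain ⟨e₁, he₁, he₁'⟩ := hH.exists_quantifier (α := (ℕ × ℕ × ℕ) × ℕ) (f := fun a =>
    run a.1.1.1 (Encodable.encode (child a.1.1.2.1 a.1.2, child a.1.1.2.2 a.2))) (by fun_prop)
  obtain ⟨n₁, hn₁, hn₁'⟩ := (HC.goto (H := H) (P := M H) he₁).bind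
    (HC.ret (f := fun a => 1 - a.2) (by fun_prop))
  obtain ⟨e₂, he₂, he₂'⟩ := hH.exists_quantifier hn₁
  obtain ⟨e₃, he₃, he₃'⟩ := hH.exists_quantifier (α := ℕ × ℕ × ℕ) (f := fun a =>
    run a.1.1 (Encodable.encode (a.1.2.1, child a.1.2.2 a.2))) (by fun_prop)
  obtain ⟨n₄, hn₄, hn₄'⟩ := (HC.goto (H := H) (P := M H) (α := (ℕ × ℕ × ℕ) × ℕ) (f := fun a =>
    run a.1.1 (Encodable.encode (child a.1.2.1 a.2, a.1.2.2))) (by fun_prop)).bind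
      (HC.ret (f := fun a => 1 - a.2) (by fun_prop))
  obtain ⟨e₄, he₄, he₄'⟩ := hH.exists_quantifier hn₄
  -- the two continuations, after the values of the children of `c`, respectively `d`, are known
  have hA : HC H (M H) fun F W (a : (ℕ × ℕ × ℕ) × ℕ) v =>
      ∃ w, Val H (M H) F W (e₃ (a.1.1, cont a.1.2.1 a.2, a.1.2.2)) w ∧
        if w = 0 then v = 0 else ∃ u : ℕ → ℕ, (∀ n, Val H (M H) F W (child a.1.2.2 n) (u n)) ∧
          Val H (M H) F W (run a.1.1 (Encodable.encode (cont a.1.2.1 a.2,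
            cont a.1.2.2 (orc H F (kind a.1.2.2 - 3) u)))) v :=
    (HC.goto (f := fun a : (ℕ × ℕ × ℕ) × ℕ => e₃ (a.1.1, cont a.1.2.1 a.2, a.1.2.2))
      (he₃.comp (by fun_prop))).bind <| HC.ite (c := fun b => b.2) (d := fun _ => 0)
        (by fun_prop) (by fun_prop) (HC.ret (f := fun _ => 0) (by fun_prop)) <|
        HC.ask (j := fun b : ((ℕ × ℕ × ℕ) × ℕ) × ℕ => kind b.1.1.2.2 - 3) (by fun_prop)
          (HC.goto (f := fun b => child b.1.1.1.2.2 b.2) (by fun_prop))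
          (HC.goto (f := fun b => run b.1.1.1.1 (Encodable.encode (cont b.1.1.1.2.1 b.1.1.2,
            cont b.1.1.1.2.2 b.2))) (by fun_prop))
  have hB : HC H (M H) fun F W (a : (ℕ × ℕ × ℕ) × ℕ) v =>
      ∃ w, Val H (M H) F W (e₄ (a.1.1, a.1.2.1, cont a.1.2.2 a.2)) w ∧
        if w = 0 then v = 1 else ∃ u : ℕ → ℕ, (∀ n, Val H (M H) F W (child a.1.2.1 n) (u n)) ∧
          Val H (M H) F W (run a.1.1 (Encodable.encode (cont a.1.2.1
            (orc H F (kind a.1.2.1 - 3) u), cont a.1.2.2 a.2))) v :=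
    (HC.goto (f := fun a : (ℕ × ℕ × ℕ) × ℕ => e₄ (a.1.1, a.1.2.1, cont a.1.2.2 a.2))
      (he₄.comp (by fun_prop))).bind <| HC.ite (c := fun b => b.2) (d := fun _ => 0)
        (by fun_prop) (by fun_prop) (HC.ret (f := fun _ => 1) (by fun_prop)) <|
        HC.ask (j := fun b : ((ℕ × ℕ × ℕ) × ℕ) × ℕ => kind b.1.1.2.1 - 3) (by fun_prop)
          (HC.goto (f := fun b => child b.1.1.1.2.1 b.2) (by fun_prop))
          (HC.goto (f := fun b => run b.1.1.1.1 (Encodable.encode (cont b.1.1.1.2.1 b.2,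
            cont b.1.1.1.2.2 b.1.1.2))) (by fun_prop))
  -- A continuation is known only after the values of the children, and asking for these may
  -- diverge. The answer 0 guarantees that the children of `d` terminate, the answer 1 that those of
  -- `c` do, so only the safe side is asked.
  have hAB := (HC.goto (H := H) (P := M H) he₂).bind <|
    HC.ite (c := fun b => b.2) (d := fun _ => 0) (by fun_prop) (by fun_prop)
      (HC.ask (j := fun b : (ℕ × ℕ × ℕ) × ℕ => kind b.1.2.2 - 3) (by fun_prop)
          (HC.goto (f := fun b => child b.1.1.2.2 b.2) (by fun_prop))
          (hB.comp (g := fun b : ((ℕ × ℕ × ℕ) × ℕ) × ℕ => (b.1.1, b.2)) (by fun_prop)))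
      (HC.ask (j := fun b : (ℕ × ℕ × ℕ) × ℕ => kind b.1.2.1 - 3) (by fun_prop)
          (HC.goto (f := fun b => child b.1.1.2.1 b.2) (by fun_prop))
          (hA.comp (g := fun b : ((ℕ × ℕ × ℕ) × ℕ) × ℕ => (b.1.1, b.2)) (by fun_prop)))
  have h0 := HC.ret (H := H) (P := M H) (f := fun _ : ℕ × ℕ × ℕ => 0) (by fun_prop)
  have h1 := HC.ret (H := H) (P := M H) (f := fun _ : ℕ × ℕ × ℕ => 1) (by fun_prop)
  have hc : Primrec fun a : ℕ × ℕ × ℕ => kind a.2.1 := by fun_prop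
  have hd : Primrec fun a : ℕ × ℕ × ℕ => kind a.2.2 := by fun_prop
  obtain ⟨p, hp⟩ := (HC.ite hc (Primrec.const 0) h0 <| HC.ite hc (Primrec.const 1) h1 <|
    HC.ite hc (Primrec.const 2) h1 <| HC.ite hd (Primrec.const 0) h1 <|
    HC.ite hd (Primrec.const 1) h0 <| HC.ite hd (Primrec.const 2) h0 hAB).fix
  refine ⟨p, fun F c d hcd => ?_⟩
  -- Induction on the smaller rank, since one of the two computations may diverge.
  generalize hμ : min (rank H F c) (rank H F d) = μ
  induction μ using WellFoundedLT.induction generalizing c d with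
  | ind μ ih =>
  subst hμ
  have hiff : ∀ {q : Prop} [Decidable q], (rank H F c ≤ rank H F d ↔ q) →
      (if rank H F c ≤ rank H F d then 0 else 1) = if q then 0 else 1 :=
    fun h => if_congr h rfl rfl
  have hzero : rank H F c ≤ rank H F d → (if rank H F c ≤ rank H F d then 0 else 1) = 0 :=
    fun h => if_pos h
  have hone : ¬ rank H F c ≤ rank H F d → (if rank H F c ≤ rank H F d then 0 else 1) = 1 :=
    fun h => if_neg h
  generalize (if rank H F c ≤ rank H F d then 0 else 1) = R at hiff hzero hone ⊢
  rw [hp]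
  dsimp only
  by_cases hc0 : kind c = 0
  · rw [if_pos hc0]
    refine hzero (rank_le fun x hx => ?_)
    rcases hx with ⟨h, -⟩ | ⟨h, -⟩ <;> omega
  have hstuck : ∀ {c}, kind c = 1 ∨ kind c = 2 → ¬ rank H F c < ⊤ := fun h h' =>
    (rank_lt (.inl ⟨h, rfl⟩) h').false
  rw [if_neg hc0]
  by_cases hc1 : kind c = 1 ∨ kind c = 2
  · have h1 := hstuck hc1
    have h2 := hcd.resolve_left h1
    rw [hone fun h => h1 (h.trans_lt h2)]
    rcases hc1 with h | h
    · rw [if_pos h]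
    · rw [if_neg (by omega), if_pos h]
  rw [if_neg fun h => hc1 (.inl h), if_neg fun h => hc1 (.inr h)]
  have hc3 : 3 ≤ kind c := by omega
  by_cases hd0 : kind d = 0
  · rw [if_pos hd0]
    refine hone fun h => ?_
    obtain ⟨x, hx, -⟩ := exists_rank_le ((rank_lt (.inr ⟨hc3, .inl ⟨0, rfl⟩⟩)
      (h.trans_lt (rank_lt_top.2 ⟨_, .ret _ _ hd0⟩))).trans_le h)
    rcases hx with ⟨h, -⟩ | ⟨h, -⟩ <;> omega
  rw [if_neg hd0]
  by_cases hd1 : kind d = 1 ∨ kind d = 2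
  · have h1 := hstuck hd1
    rw [hzero (by rw [not_lt_top_iff.1 h1]; exact le_top)]
    rcases hd1 with h | h
    · rw [if_pos h]
    · rw [if_neg (by omega), if_pos h]
  rw [if_neg fun h => hd1 (.inl h), if_neg fun h => hd1 (.inr h)]
  have hd3 : 3 ≤ kind d := by omega
  have hcmp : ∀ x y, Child H F x c → Child H F y d → Val H (M H) F []
      (run p (Encodable.encode (x, y))) (if rank H F x ≤ rank H F y then 0 else 1) := by
    intro x y hx hy
    have hxy : min (rank H F x) (rank H F y) < min (rank H F c) (rank H F d) := by
      rcases le_total (rank H F c) (rank H F d) with h | h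
      · rw [min_eq_left h]
        have : rank H F c < ⊤ := hcd.elim id fun h' => h.trans_lt h'
        exact (min_le_left _ _).trans_lt (rank_lt hx this)
      · rw [min_eq_right h]
        have : rank H F d < ⊤ := hcd.elim (fun h' => h.trans_lt h') id
        exact (min_le_right _ _).trans_lt (rank_lt hy this)
    refine ih _ hxy x y ?_ rfl
    rcases min_lt_iff.1 (hxy.trans_le le_top) with h | h
    · exact .inl h
    · exact .inr h
  have hq : ∀ n, Child H F (child c n) c := fun n => .inr ⟨hc3, .inl ⟨n, rfl⟩⟩
  have hq' : ∀ n, Child H F (child d n) d := fun n => .inr ⟨hd3, .inl ⟨n, rfl⟩⟩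
  have hbc : ∀ {x y}, Child H F x c → Child H F y d → rank H F x ≤ rank H F y →
      rank H F x < ⊤ := by
    intro x y hx hy hxy
    rcases hcd with h | h
    · exact (rank_lt hx h).trans_le le_top
    · exact hxy.trans_lt ((rank_lt hy h).trans_le le_top)
  -- from the comparison of all children to the comparison of `c` and `d`
  have hle : (∀ x, Child H F x c → ∃ y, Child H F y d ∧ rank H F x ≤ rank H F y) →
      rank H F c ≤ rank H F d := by
    intro h
    rcases eq_or_lt_of_le (le_top : rank H F d ≤ ⊤) with hd | hd
    · rw [hd]; exact le_top
    · refine rank_le fun x hx => ?_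
      obtain ⟨y, hy, hxy⟩ := h x hx
      exact hxy.trans_lt (rank_lt hy hd)
  have hge : rank H F c ≤ rank H F d → ∀ x, Child H F x c →
      ∃ y, Child H F y d ∧ rank H F x ≤ rank H F y := fun h x hx =>
    exists_rank_le ((rank_lt hx (hcd.elim id fun h' => h.trans_lt h')).trans_le h)
  -- The value is 0 if some `child c n` lies strictly above every `child d m`, and 1 otherwise.
  have hval₂ := he₂' F (p, c, d) _ fun n => (hn₁' F [] ((p, c, d), n) _).2
    ⟨_, he₁' F ((p, c, d), n) _ fun m => hcmp _ _ (hq n) (hq' m), rfl⟩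
  refine ⟨_, hval₂, ?_⟩
  dsimp only
  by_cases hA : ∀ n, ∃ m, rank H F (child c n) ≤ rank H F (child d m)
  · rw [if_neg]
    swap
    · rw [existsTwo_of_not]
      · exact one_ne_zero
      · intro n
        obtain ⟨m, hm⟩ := hA n
        have h0 : existsTwo (fun m => if rank H F (child c n) ≤ rank H F (child d m) then 0 else 1)
            = 0 := existsTwo_of_exists ⟨m, if_pos hm⟩
        rw [h0]
        exact one_ne_zero
    -- Each child of `c` lies below a child of `d`; whichever of `c` and `d` terminates, the child
    -- of `c` does.
    choose u hu using fun n => rank_lt_top.1 ((hA n).elim fun m hm => hbc (hq n) (hq' m) hm)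
    refine ⟨u, hu, _, he₃' F _ _ fun m => hcmp _ _ ((child_iff hc3 hu).2 (.inr rfl)) (hq' m), ?_⟩
    by_cases hE : ∃ m, rank H F (cont c (orc H F (kind c - 3) u)) ≤ rank H F (child d m)
    · rw [if_pos (existsTwo_of_exists (hE.imp fun m hm => if_pos hm))]
      refine hzero (hle fun x hx => ?_)
      rcases (child_iff hc3 hu).1 hx with ⟨n, rfl⟩ | rfl
      · exact (hA n).elim fun m hm => ⟨_, hq' m, hm⟩
      · exact hE.elim fun m hm => ⟨_, hq' m, hm⟩
    · push Not at hE
      rw [if_neg]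
      swap
      · rw [existsTwo_of_not]
        · exact one_ne_zero
        · intro m
          rw [if_neg (hE m).not_ge]
          exact one_ne_zero
      -- All children of `d` lie strictly below the continuation of `c`, so they terminate, and it
      -- remains to compare the two continuations.
      choose w hw using fun m => rank_lt_top.1 ((hE m).trans_le le_top)
      refine ⟨w, hw, ?_⟩
      have := hcmp _ _ ((child_iff hc3 hu).2 (.inr rfl)) ((child_iff hd3 hw).2 (.inr rfl))
      convert this
      refine hiff ⟨fun h => ?_, fun h => hle fun x hx => ?_⟩
      · obtain ⟨y, hy, hxy⟩ := hge h _ ((child_iff hc3 hu).2 (.inr rfl))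
        rcases (child_iff hd3 hw).1 hy with ⟨m, rfl⟩ | rfl
        · exact absurd hxy (hE m).not_ge
        · exact hxy
      · rcases (child_iff hc3 hu).1 hx with ⟨n, rfl⟩ | rfl
        · exact (hA n).elim fun m hm => ⟨_, hq' m, hm⟩
        · exact ⟨_, (child_iff hd3 hw).2 (.inr rfl), h⟩
  · push Not at hA
    obtain ⟨n₀, hn₀⟩ := hA
    rw [if_pos]
    swap
    · refine existsTwo_of_exists ⟨n₀, ?_⟩
      rw [existsTwo_of_not]
      intro m
      rw [if_neg (hn₀ m).not_ge]
      exact one_ne_zero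
    -- All children of `d` lie strictly below `child c n₀`, so the continuation of `d` is available.
    choose w hw using fun m => rank_lt_top.1 ((hn₀ m).trans_le le_top)
    have hk' := (child_iff hd3 hw).2 (.inr rfl)
    refine ⟨w, hw, _, he₄' F _ _ fun n => (hn₄' F [] _ _).2 ⟨_, hcmp _ _ (hq n) hk', rfl⟩, ?_⟩
    by_cases hE : ∀ n, rank H F (child c n) ≤ rank H F (cont d (orc H F (kind d - 3) w))
    · rw [if_neg]
      swap
      · rw [existsTwo_of_not]
        · exact one_ne_zero
        · intro n
          dsimp only
          rw [if_pos (hE n)]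
          exact one_ne_zero
      choose u hu using fun n => rank_lt_top.1 (hbc (hq n) hk' (hE n))
      refine ⟨u, hu, ?_⟩
      have := hcmp _ _ ((child_iff hc3 hu).2 (.inr rfl)) hk'
      convert this
      refine hiff ⟨fun h => ?_, fun h => hle fun x hx => ?_⟩
      · obtain ⟨y, hy, hxy⟩ := hge h _ ((child_iff hc3 hu).2 (.inr rfl))
        rcases (child_iff hd3 hw).1 hy with ⟨m, rfl⟩ | rfl
        · exact hxy.trans ((hn₀ m).le.trans (hE n₀))
        · exact hxy
      · rcases (child_iff hc3 hu).1 hx with ⟨n, rfl⟩ | rfl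
        · exact ⟨_, hk', hE n⟩
        · exact ⟨_, hk', h⟩
    · push Not at hE
      obtain ⟨n, hn⟩ := hE
      rw [if_pos]
      swap
      · refine existsTwo_of_exists ⟨n, ?_⟩
        dsimp only
        rw [if_neg hn.not_ge]
      refine hone fun h => ?_
      obtain ⟨y, hy, hxy⟩ := hge h _ (hq n₀)
      rcases (child_iff hd3 hw).1 hy with ⟨m, rfl⟩ | rfl
      · exact (hn₀ m).not_ge hxy
      · obtain ⟨y, hy, hxy'⟩ := hge h _ (hq n)
        rcases (child_iff hd3 hw).1 hy with ⟨m, rfl⟩ | rfl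
        · exact hn.not_ge (hxy'.trans ((hn₀ m).le.trans hxy))
        · exact hn.not_ge hxy'

/-- Gandy selection: a number for which a computation terminates is computed by the machine, if
there is one. -/
theorem Normal.exists_selection (hH : Normal H) {α : Type} [Primcodable α] {f : α × ℕ → ℕ}
    (hf : Primrec f) : ∃ g : α → ℕ, Primrec g ∧ ∀ F a, (∃ n v, Val H (M H) F [] (f (a, n)) v) →
      ∃ n v, Val H (M H) F [] (g a) n ∧ Val H (M H) F [] (f (a, n)) v := by
  obtain ⟨q, hq⟩ := hH.exists_comparison
  -- At `(a, n)` the program races `f (a, n)` against its own run at `(a, n + 1)`. If `f (a, n)` is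
  -- no later, the answer is 0; else it is one more than the answer of that run.
  obtain ⟨p, hp⟩ := ((HC.goto (H := H) (P := M H) (α := ℕ × α × ℕ) (f := fun a =>
    run q (Encodable.encode (f a.2, run a.1 (Encodable.encode (a.2.1, a.2.2 + 1)))))
      (by fun_prop)).bind <| HC.ite (c := fun b => b.2) (d := fun _ => 0)
        (by fun_prop) (by fun_prop)
        ((HC.goto (f := fun b => f b.1.2) (by fun_prop)).bind
          (HC.ret (f := fun _ => 0) (by fun_prop)))
        ((HC.goto (f := fun b => run b.1.1 (Encodable.encode (b.1.2.1, b.1.2.2 + 1)))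
          (by fun_prop)).bind (HC.ret (f := fun b => b.2 + 1) (by fun_prop)))).fix
  -- Before answering 0 the program runs `f (a, n)` to its end, so soundness does not depend on the
  -- comparison.
  have hsound : ∀ F a m n, Val H (M H) F [] (run p (Encodable.encode (a, n))) m →
      ∃ v, Val H (M H) F [] (f (a, n + m)) v := by
    intro F a m
    induction m with
    | zero =>
      intro n h
      obtain ⟨b, -, h⟩ := (hp _ _ _ _).1 h
      split_ifs at h
      · obtain ⟨v, hv, -⟩ := h
        exact ⟨v, hv⟩
      · obtain ⟨v, hv, h0⟩ := h
        exact h0.elim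
    | succ m ih =>
      intro n h
      obtain ⟨b, -, h⟩ := (hp _ _ _ _).1 h
      split_ifs at h
      · obtain ⟨v, hv, h0⟩ := h
        exact h0.elim
      · obtain ⟨v, hv, h0⟩ := h
        obtain rfl : m = v := Nat.succ_injective h0
        have := ih (n + 1) hv
        rwa [Nat.add_right_comm] at this
  obtain ⟨g, hg, hg'⟩ := HC.goto (H := H) (P := M H) (α := α) (f := fun a =>
    run p (Encodable.encode (a, 0))) (by fun_prop)
  refine ⟨g, hg, fun F a ⟨n₀, hn₀⟩ => ?_⟩
  -- Downwards from `n₀`: at each place at least one of the two competitors terminates, so the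
  -- comparison is defined.
  have key : ∀ i n, n + i = n₀ → ∃ m, Val H (M H) F [] (run p (Encodable.encode (a, n))) m := by
    intro i
    induction i with
    | zero =>
      rintro n rfl
      have hr := rank_lt_top.2 hn₀
      have h := hq F _ (run p (Encodable.encode (a, n + 1))) (.inl hr)
      split_ifs at h with h'
      · exact ⟨0, (hp _ _ _ _).2 ⟨0, h, hn₀.imp fun v hv => ⟨hv, rfl⟩⟩⟩
      · obtain ⟨m, hm⟩ := rank_lt_top.1 ((not_le.1 h').trans_le le_top)
        exact ⟨m + 1, (hp _ _ _ _).2 ⟨1, h, m, hm, rfl⟩⟩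
    | succ i ih =>
      intro n hn
      obtain ⟨m, hm⟩ := ih (n + 1) (by omega)
      have hr := rank_lt_top.2 ⟨m, hm⟩
      have h := hq F (f (a, n)) _ (.inr hr)
      split_ifs at h with h'
      · obtain ⟨v, hv⟩ := rank_lt_top.1 (h'.trans_lt hr)
        exact ⟨0, (hp _ _ _ _).2 ⟨0, h, v, hv, rfl⟩⟩
      · exact ⟨m + 1, (hp _ _ _ _).2 ⟨1, h, m, hm, rfl⟩⟩
  obtain ⟨m, hm⟩ := key n₀ 0 (by omega)
  obtain ⟨v, hv⟩ := hsound F a m 0 hm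
  rw [Nat.zero_add] at hv
  exact ⟨m, v, (hg' F [] a m).2 hm, hv⟩

end Stage

/-! ## Quantifier-free choice -/

section Choice

variable {H : (ℕ → ℕ) → ℕ}

/-- Selection is applied to the computations `d (x, e)`, which terminate exactly if `e` computes a
function `y` with `A(x, y)`. -/
theorem Normal.qfac (hH : Normal H) : QFAC (M H) (Ty.pure 0) (Ty.pure 1) := by
  intro A i j _ ρ hρ hA
  obtain ⟨t, ht, ht'⟩ := exists_truth_value (i := i) (j := j) hρ A
  obtain ⟨l, hl, hl'⟩ := exists_numeral H (M H)
  obtain ⟨k, hk, hk'⟩ := exists_realizer_one H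
  have htk : Primrec fun a : (ℕ × ℕ) × ℕ => t (l a.1.1, k a.1.2) :=
    ht.comp ((hl.comp (by fun_prop)).pair (hk.comp (by fun_prop)))
  -- The question to `H` only enforces that `e` is total; its answer is discarded.
  obtain ⟨d, hd, hd'⟩ := HC.ask (H := H) (P := M H) (α := ℕ × ℕ) (Primrec.const 1)
    (HC.goto (f := fun a => run a.1.2 a.2) (by fun_prop))
    ((HC.goto htk).bind (HC.ite (c := fun a => a.2) (d := fun _ => 1) (by fun_prop) (by fun_prop)
      (HC.ret (f := fun _ => 0) (by fun_prop)) HC.stuck))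
  have hconv : ∀ x e, (∃ v, Val H (M H) (fun _ => 0) [] (d (x, e)) v) ↔
      ∃ y : ℕ → ℕ, (∀ n, Val H (M H) (fun _ => 0) [] (run e n) (y n)) ∧
        A.Holds (M H) (Function.update (Function.update ρ (Ty.nat, i) x) (Ty.pure 1, j) y) := by
    intro x e
    have key : ∀ y : ℕ → ℕ, (∀ n, Val H (M H) (fun _ => 0) [] (run e n) (y n)) → _ :=
      fun y hy => ht' (fun _ => 0) [] x y _ _ (mem_M_one_iff.2 ⟨e, hy⟩) (hl' x _ _)
        (hk' e y _ _ hy)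
    constructor
    · rintro ⟨v, hv⟩
      obtain ⟨y, hy, w, hw, hv⟩ := (hd' _ _ _ _).1 hv
      refine ⟨y, hy, ?_⟩
      have hw' := hw.unique (key y hy)
      dsimp only at hv
      split_ifs at hv hw' with h1 h2
      · exact h2
      · omega
    · rintro ⟨y, hy, h⟩
      have := key y hy
      rw [if_pos h] at this
      exact ⟨0, (hd' _ _ _ _).2 ⟨y, hy, 1, this, by simp⟩⟩
  obtain ⟨g, hg, hg'⟩ := hH.exists_selection hd
  have : ∀ x : ℕ, ∃ (e : ℕ) (y : ℕ → ℕ), Val H (M H) (fun _ => 0) [] (g x) e ∧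
      (∀ n, Val H (M H) (fun _ => 0) [] (run e n) (y n)) ∧
        A.Holds (M H) (Function.update (Function.update ρ (Ty.nat, i) x) (Ty.pure 1, j) y) := by
    intro x
    obtain ⟨y, hy, h⟩ := hA x (nat_mem_M x)
    obtain ⟨p, hp⟩ := mem_M_one_iff.1 hy
    obtain ⟨v, hv⟩ := (hconv x p).2 ⟨y, hp, h⟩
    obtain ⟨e, v, he, hv⟩ := hg' _ x ⟨p, v, hv⟩
    obtain ⟨y, hy, h⟩ := (hconv x e).1 ⟨v, hv⟩
    exact ⟨e, y, he, hy, h⟩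
  choose e Y he hY hAY using this
  obtain ⟨f, hf, hf'⟩ := (HC.goto (H := H) (P := M H) (α := ℕ × ℕ) (f := fun a => g a.1)
    (by fun_prop)).bind (HC.goto (f := fun a => run a.2 a.1.2) (by fun_prop))
  exact ⟨Y, mem_M_of_binary hf fun (x : ℕ) n => (hf' _ _ _ _).2 ⟨e x, he x, hY x n⟩, fun x _ => hAY x⟩

end Choice

/-! ## A functional without a uniform bound -/

section Index

variable {H : (ℕ → ℕ) → ℕ}

/-- The value of the oracle function, in the machine with oracle `fun u => f (u 0)`. -/
theorem exists_evaluation (H : (ℕ → ℕ) → ℕ) : ∃ k : ℕ → ℕ, Primrec k ∧ ∀ F W n v,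
    Val H (M H) F W (k n) v ↔ v = F fun _ => n := by
  obtain ⟨k, hk, hk'⟩ := HC.ask (H := H) (P := M H) (α := ℕ) (Primrec.const 3)
    (HC.ret (f := fun a => a.1) (by fun_prop)) (HC.ret (f := fun a => a.2) (by fun_prop))
  refine ⟨k, hk, fun F W n v => (hk' F W n v).trans ?_⟩
  constructor
  · rintro ⟨u, hu, rfl⟩
    rw [show u = fun _ => n from funext hu]
    rfl
  · rintro rfl
    exact ⟨fun _ => n, fun _ => rfl, rfl⟩

/-- There is a functional that maps every function to an index of it. -/
theorem Normal.exists_index (hH : Normal H) : ∃ G : (ℕ → ℕ) → ℕ, G ∈ M H (Ty.pure 2) ∧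
    ∀ f : ℕ → ℕ, f ∈ M H (Ty.pure 1) → ∃ e : ℕ, G f = e + 1 ∧ ∀ n, Val H (M H) (fun _ => 0) [] (run e n) (f n) := by
  obtain ⟨k, hk, hk'⟩ := exists_evaluation H
  -- Terminates exactly if `e`, run without the oracle, agrees everywhere with the oracle function;
  -- a disagreement gets stuck.
  obtain ⟨d, hd, hd'⟩ := HC.ask (H := H) (P := M H) (α := Unit × ℕ) (Primrec.const 1)
    ((HC.goto (f := fun a : (Unit × ℕ) × ℕ => addMode 1 (run a.1.2 a.2)) (by fun_prop)).bind
      ((HC.goto (f := fun a => k a.1.2) (by fun_prop)).bind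
        (HC.ite (c := fun a => a.1.2) (d := fun a => a.2) (by fun_prop) (by fun_prop)
          (HC.ret (f := fun _ => 0) (by fun_prop)) HC.stuck)))
    (HC.ret (f := fun _ => 0) (by fun_prop))
  have hconv : ∀ (f : ℕ → ℕ) e, (∃ v, Val H (M H) (fun u => f (u 0)) [] (d ((), e)) v) ↔
      ∀ n, Val H (M H) (fun _ => 0) [] (run e n) (f n) := by
    intro f e
    constructor
    · rintro ⟨v, hv⟩ n
      obtain ⟨u, hu, -⟩ := (hd' _ _ _ _).1 hv
      obtain ⟨x, hx, y, hy, h⟩ := hu n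
      obtain rfl := (hk' _ _ _ _).1 hy
      dsimp only at h
      split_ifs at h with hxy
      exact hxy ▸ val_addMode.1 hx
    · intro h
      refine ⟨0, (hd' _ _ _ _).2 ⟨fun _ => 0, fun n => ⟨f n, val_addMode.2 (h n), f n,
        (hk' _ _ _ _).2 rfl, by simp⟩, rfl⟩⟩
  obtain ⟨g, hg, hg'⟩ := hH.exists_selection hd
  -- With the successor, agreement below `G f` includes the place `e`, where the diagonalisation
  -- happens.
  obtain ⟨c, hc, hc'⟩ := (HC.goto (H := H) (P := M H) hg).bind
    (HC.ret (f := fun a => a.2 + 1) (by fun_prop))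
  have : ∀ f : ℕ → ℕ, ∃ w, (f ∉ M H (Ty.pure 1) → w = 0) ∧ (f ∈ M H (Ty.pure 1) →
      ∃ e, w = e + 1 ∧ Val H (M H) (fun u => f (u 0)) [] (g ()) e ∧
        ∀ n, Val H (M H) (fun _ => 0) [] (run e n) (f n)) := by
    intro f
    by_cases hf : f ∈ M H (Ty.pure 1)
    · obtain ⟨p, hp⟩ := mem_M_one_iff.1 hf
      obtain ⟨v, hv⟩ := (hconv f p).2 hp
      obtain ⟨e, v, he, hv⟩ := hg' _ () ⟨p, v, hv⟩
      exact ⟨e + 1, fun h => absurd hf h, fun _ => ⟨e, rfl, he, (hconv f e).1 ⟨v, hv⟩⟩⟩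
    · exact ⟨0, fun _ => rfl, fun h => absurd h hf⟩
  choose G h0 h1 using this
  refine ⟨G, mem_M_two h0 (c := c ()) fun f hf => ?_, fun f hf => ?_⟩
  · obtain ⟨e, hw, he, -⟩ := h1 f hf
    exact (hc' _ _ _ _).2 ⟨e, he, hw⟩
  · obtain ⟨e, hw, -, h⟩ := h1 f hf
    exact ⟨e, hw, h⟩

open Classical in
/-- The functional with value `N` at `g` and `0` elsewhere. -/
noncomputable def spike (g : ℕ → ℕ) (N : ℕ) (f : ℕ → ℕ) : ℕ := if f = g then N else 0

/-- Equality of the argument with `g` is a number quantifier over decidable equations, hence decided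
with `∃²`. -/
theorem Normal.spike_mem (hH : Normal H) {g : ℕ → ℕ} (hg : g ∈ M H (Ty.pure 1)) (N : ℕ) :
    spike g N ∈ M H (Ty.pure 2) := by
  obtain ⟨p, hp⟩ := mem_M_one_iff.1 hg
  obtain ⟨k, hk, hk'⟩ := exists_evaluation H
  obtain ⟨d, hd, hd'⟩ :=
    (HC.goto (H := H) (P := M H) (f := fun a : Unit × ℕ => addMode 1 (run p a.2)) (by fun_prop)).bind
      ((HC.goto (f := fun a => k a.1.2) (by fun_prop)).bind
        (HC.ite (c := fun a => a.1.2) (d := fun a => a.2) (by fun_prop) (by fun_prop)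
          (HC.ret (f := fun _ => 1) (by fun_prop)) (HC.ret (f := fun _ => 0) (by fun_prop))))
  obtain ⟨q, hq, hq'⟩ := hH.exists_quantifier hd
  obtain ⟨c, hc, hc'⟩ := (HC.goto (H := H) (P := M H) hq).bind
    (HC.ite (c := fun a => a.2) (d := fun _ => 0) (by fun_prop) (by fun_prop)
      (HC.ret (f := fun _ => 0) (by fun_prop)) (HC.ret (f := fun _ => N) (by fun_prop)))
  refine mem_M_two (c := c ()) (fun f hf => if_neg fun h : f = g => hf (h ▸ hg)) fun f hf => ?_
  rw [hc']
  refine ⟨_, hq' _ () (fun n => if g n = f n then 1 else 0) fun n => ?_, ?_⟩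
  · rw [hd']
    refine ⟨g n, val_addMode.2 (hp n), f n, (hk' _ _ _ _).2 rfl, ?_⟩
    dsimp only
    split_ifs <;> rfl
  · dsimp only [spike]
    by_cases h : f = g
    · rw [existsTwo_of_not fun n => by simp [h], if_pos h]
      simp
    · obtain ⟨n, hn⟩ := Function.ne_iff.1 h
      rw [existsTwo_of_exists ⟨n, if_neg hn.symm⟩, if_neg h]
      simp

/-- There is a functional `G` with a function that escapes all its neighbourhoods. -/
theorem Normal.exists_escape (hH : Normal H) : ∃ G : (ℕ → ℕ) → ℕ, G ∈ M H (Ty.pure 2) ∧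
    ∃ s : ℕ → ℕ, (∀ n, s n ≤ 1) ∧ ∀ g : ℕ → ℕ, ∀ N, (∀ n < N, g n = s n) → LOC (M H) (spike g (N + 1)) G := by
  obtain ⟨G, hG, hG'⟩ := hH.exists_index
  -- All `f` with `G f = e + 1` are computed by the program `e`, so they share one value at `e`, and
  -- a single bit avoids it.
  have : ∀ e, ∃ v ≤ 1, ∀ f ∈ Cantor (M H), G f = e + 1 → v ≠ f e := by
    intro e
    by_cases h : ∃ f ∈ Cantor (M H), G f = e + 1
    · obtain ⟨f, hf, hfe⟩ := h
      refine ⟨1 - f e, by omega, fun f' hf' hfe' => ?_⟩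
      obtain ⟨i, hi, hi'⟩ := hG' f hf.1
      obtain ⟨j, hj, hj'⟩ := hG' f' hf'.1
      obtain rfl : e = i := by omega
      obtain rfl : e = j := by omega
      have := (hi' e).unique (hj' e)
      omega
    · exact ⟨0, by omega, fun f hf hfe => absurd ⟨f, hf, hfe⟩ h⟩
  choose s hs hs' using this
  refine ⟨G, hG, s, hs, fun g N hgs f hf f' hf' hff' => ?_⟩
  by_cases h : f' = g
  · obtain ⟨e, he, -⟩ := hG' f hf.1
    rw [spike, if_pos h]
    -- Otherwise `e < N`, so `g e = s e ≠ f e`, although `g` agrees with `f` below `G f = e + 1`.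
    by_contra hlt
    refine hs' e f hf he ?_
    rw [← hgs e (by omega), ← h]
    exact hff' e (by omega)
  · rw [spike, if_neg h]
    exact Nat.zero_le _

theorem getD_mem_M (l : List ℕ) : (fun n => l.getD n 0) ∈ M H (Ty.pure 1) := by
  obtain ⟨k, -, hk⟩ := (HC.ret (H := H) (P := M H) (α := Unit × ℕ) (f := fun a => l.getD a.2 0)
    (by fun_prop)).closure
  exact mem_M_one_iff.2 ⟨k (), fun n => (hk () n _ _ _).2 rfl⟩

/-- The diagonal function `s` is itself outside the structure. Its first `N` values, continued by 0,
give an element of the structure at which a spike beats the bound `N`. -/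
theorem Normal.not_pitu (hH : Normal H) : ¬ PITu (M H) := by
  intro h
  obtain ⟨G, hG, s, hs, hL⟩ := hH.exists_escape
  obtain ⟨N, hN⟩ := h G hG
  let g : ℕ → ℕ := fun n => ((List.range N).map s).getD n 0
  have hg : g ∈ M H (Ty.pure 1) := getD_mem_M _
  have hgs : ∀ n, g n = if n < N then s n else 0 := fun n => by
    simp only [g, List.getD_eq_getElem?_getD, List.getElem?_map]
    split_ifs with h <;> simp [h]
  have := hN _ (hH.spike_mem hg (N + 1)) (hL g N fun n hn => by rw [hgs, if_pos hn]) g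
    ⟨hg, fun n => by rw [hgs]; split_ifs; exacts [hs n, zero_le_one]⟩
  rw [spike, if_pos rfl] at this
  omega

theorem Normal.not_pr (hH : Normal H) (Mu : ((ℕ → ℕ) → ℕ) → ℕ) : ¬ PR (M H) Mu := fun h =>
  hH.not_pitu fun G hG => ⟨Mu G, fun F hF => h F G hF hG⟩

end Index


/-! ## There is no weak Pincherle realiser -/

section Nodes

variable {H : (ℕ → ℕ) → ℕ}

/-- A program that computes the configurations that occur in a computation, from paths to them. -/
theorem exists_path_program (H : (ℕ → ℕ) → ℕ) (P : Family) : ∃ p : ℕ, ∀ F W c,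
    (∀ d, Val H P F W (run p (Encodable.encode (c, ([] : List ℕ)))) d ↔ d = c) ∧
    (3 ≤ kind c → ∀ (n : ℕ) (l : List ℕ) d,
      Val H P F W (run p (Encodable.encode (c, (n + 1) :: l))) d ↔
        Val H P F W (run p (Encodable.encode (child c n, l))) d) ∧
    (3 ≤ kind c → ∀ (l : List ℕ) d,
      Val H P F W (run p (Encodable.encode (c, 0 :: l))) d ↔ ∃ u : ℕ → ℕ,
        (∀ n, Val H P F W (child c n) (u n)) ∧
        Val H P F W (run p (Encodable.encode (cont c (orc H F (kind c - 3) u), l))) d) ∧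
    (kind c < 3 → ∀ (n : ℕ) (l : List ℕ) d,
      Val H P F W (run p (Encodable.encode (c, n :: l))) d ↔ d = c) := by
  obtain ⟨p, hp⟩ := (HC.ite (H := H) (P := P) (α := ℕ × ℕ × List ℕ)
    -- The sum vanishes exactly if the configuration asks an oracle and the path is nonempty. The
    -- entry 0 leads to the continuation and `n + 1` to the child `n`.
    (c := fun a => (3 - kind a.2.1) + (1 - a.2.2.length)) (d := fun _ => 0)
    (by fun_prop) (by fun_prop)
    (HC.ite (c := fun a => a.2.2.getD 0 0) (d := fun _ => 0) (by fun_prop) (by fun_prop)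
      (HC.ask (j := fun a => kind a.2.1 - 3) (by fun_prop)
        (HC.goto (f := fun a => child a.1.2.1 a.2) (by fun_prop))
        (HC.goto (f := fun a => run a.1.1 (Encodable.encode (cont a.1.2.1 a.2, a.1.2.2.tail)))
          (by fun_prop)))
      (HC.goto (f := fun a => run a.1 (Encodable.encode
        (child a.2.1 (a.2.2.getD 0 0 - 1), a.2.2.tail))) (by fun_prop)))
    (HC.ret (f := fun a => a.2.1) (by fun_prop))).fix
  refine ⟨p, fun F W c => ⟨fun d => ?_, fun hc n l d => ?_, fun hc l d => ?_, fun hc n l d => ?_⟩⟩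
  all_goals rw [hp]
  · simp
  · simp [show 3 - kind c = 0 by omega]
  · simp [show 3 - kind c = 0 by omega]
  · simp [show 3 - kind c ≠ 0 by omega]

/-- Every computation has a function that it does not pass to its oracle, and that can be
prescribed on any finite set. -/
theorem exists_not_queried {c v : ℕ} (hv : Val H (M H) (fun _ => 0) [] c v) (s : ℕ → ℕ)
    (hs : ∀ n, s n ≤ 1) (N : ℕ) : ∃ g ∈ Cantor (M H), (∀ n < N, g n = s n) ∧
      ∀ F : (ℕ → ℕ) → ℕ, (∀ u, u ≠ g → F u = 0) → Val H (M H) F [] c v := by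
  obtain ⟨p, hp⟩ := exists_path_program H (M H)
  -- A path that runs past a leaf stays there, so every list names a terminating configuration.
  have htotal : ∀ l : List ℕ, ∃ d w, Val H (M H) (fun _ => 0) [] (run p (Encodable.encode (c, l))) d ∧
      Val H (M H) (fun _ => 0) [] d w := by
    generalize hW : ([] : Env) = W at hv
    induction hv with
    | ret W c hc =>
      subst hW
      intro l
      refine ⟨c, _, ?_, .ret _ _ hc⟩
      cases l with
      | nil => exact ((hp _ _ c).1 c).2 rfl
      | cons n l => exact ((hp _ _ c).2.2.2 (by omega) n l c).2 rfl
    | ask W c j v u hc hu hv ihu ihv =>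
      subst hW
      intro l
      have hj : kind c - 3 = j := by omega
      match l with
      | [] => exact ⟨c, v, ((hp _ _ c).1 c).2 rfl, .ask _ _ j _ u hc hu hv⟩
      | 0 :: l =>
        obtain ⟨d, w, hd, hw⟩ := ihv rfl l
        exact ⟨d, w, ((hp _ _ c).2.2.1 (by omega) l d).2 ⟨u, hu, hj ▸ hd⟩, hw⟩
      | (n + 1) :: l =>
        obtain ⟨d, w, hd, hw⟩ := ihu n rfl l
        exact ⟨d, w, ((hp _ _ c).2.1 (by omega) n l d).2 hd, hw⟩
    | real W c v σ Φ ξ hc hΦ => subst hW; simp at hΦ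
  let t := (List.range N).map s
  have hts : ∀ n < N, t.getD n 0 = s n := fun n hn => by simp [t, hn]
  -- The function copies `s` below `N`. At `N + Encodable.encode l` it takes a value different from
  -- that of the function asked about at the end of the path `l`.
  obtain ⟨k, -, hk⟩ := (HC.ite (H := H) (P := M H) (α := Unit × ℕ) (c := fun a => N - a.2)
    (d := fun _ => 0) (by fun_prop) (by fun_prop)
    ((HC.goto (f := fun a => run p (Encodable.encode (c, toList (a.2 - N)))) (by fun_prop)).bind
      (HC.ite (c := fun a => 3 - kind a.2) (d := fun _ => 0) (by fun_prop) (by fun_prop)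
        ((HC.goto (f := fun a => child a.2 a.1.2) (by fun_prop)).bind
          (HC.ret (f := fun a => 1 - a.2) (by fun_prop)))
        (HC.ret (f := fun _ => 0) (by fun_prop))))
    (HC.ret (f := fun a => t.getD a.2 0) (by fun_prop))).closure
  replace hk := hk ()
  have hg : ∀ n : ℕ, ∃ w ≤ 1, Val H (M H) (fun _ => 0) [] (run (k ()) n) w := by
    intro n
    have hk := fun v => hk n (fun _ => 0) [] v
    rw [Encodable.encode_nat] at hk
    dsimp only at hk
    simp only [hk]
    by_cases hn : N - n = 0
    · simp only [if_pos hn]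
      obtain ⟨d, w, hd, hw⟩ := htotal (toList (n - N))
      by_cases h3 : 3 - kind d = 0
      · obtain ⟨u, hu, -⟩ := (val_ask_iff (j := kind d - 3) (by omega)).1 hw
        exact ⟨1 - u n, by omega, d, hd, by rw [if_pos h3]; exact ⟨_, hu n, rfl⟩⟩
      · exact ⟨0, by omega, d, hd, by rw [if_neg h3]⟩
    · simp only [if_neg hn]
      exact ⟨_, by rw [hts n (by omega)]; exact hs n, rfl⟩
  choose g hg1 hg using hg
  refine ⟨g, ⟨mem_M_one_iff.2 ⟨k (), hg⟩, hg1⟩, fun n hn => ?_, fun F hF => ?_⟩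
  · have := (hk n _ _ _).1 (hg n)
    dsimp only at this
    rw [if_neg (by omega), hts n hn] at this
    exact this
  -- no node of the computation passes `g` to the oracle
  have hq : ∀ (l : List ℕ) d u, Val H (M H) (fun _ => 0) [] (run p (Encodable.encode (c, l))) d → 3 ≤ kind d →
      (∀ n, Val H (M H) (fun _ => 0) [] (child d n) (u n)) → u ≠ g := by
    intro l d u hd h3 hu hug
    have := (hk (N + Encodable.encode l) _ _ _).1 (hg _)
    dsimp only at this
    rw [if_pos (by omega)] at this
    obtain ⟨d', hd', h⟩ := this
    rw [Nat.add_sub_cancel_left, toList, Encodable.encodek, Option.getD_some] at hd'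
    obtain rfl := hd.unique hd'
    rw [if_pos (by omega)] at h
    obtain ⟨w, hw, h⟩ := h
    have := (hu _).unique hw
    rw [hug] at this
    rw [Encodable.encode_nat] at h
    omega
  clear hk htotal
  generalize hW : ([] : Env) = W at hv
  induction hv with
  | ret W c hc => exact hW ▸ .ret _ _ hc
  | ask W c j v u hc hu hv ihu ihv =>
    subst hW
    have h3 : 3 ≤ kind c := by omega
    refine .ask _ _ j _ u hc (fun n => ihu n (fun l d u' hd => ?_) rfl) ?_
    · exact hq ((n + 1) :: l) d u' (((hp _ _ c).2.1 h3 n l d).2 hd)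
    · have ho : orc H F j u = orc H (fun _ => 0) j u := by
        match j with
        | 0 => rfl
        | 1 => rfl
        | 2 => rfl
        | 3 => exact hF u (hq [] c u (((hp _ _ c).1 c).2 rfl) h3 hu)
        | j + 4 => rfl
      rw [ho]
      refine ihv (fun l d u' hd => ?_) rfl
      refine hq (0 :: l) d u' (((hp _ _ c).2.2.1 h3 l d).2 ⟨u, hu, ?_⟩)
      rwa [show kind c - 3 = j by omega]
  | real W c v σ Φ ξ hc hΦ => subst hW; simp at hΦ

/-- The oracle is realized by the program that asks it. -/
theorem exists_oracle_realizer (H : (ℕ → ℕ) → ℕ) :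
    ∃ r, ∀ F W, Realizes H (M H) F (Ty.pure 2) F W r := by
  obtain ⟨l, hl, hl'⟩ := exists_numeral H (M H)
  have hc : Primrec fun a : (Unit × List ℕ) × ℕ =>
      run (a.1.2.getD 0 0) (Encodable.encode [l a.2]) :=
    primrec_run (by fun_prop) (Prim.encode (Prim.cons (by fun_prop) (hl.comp (by fun_prop))))
  obtain ⟨k, -, hk⟩ := (HC.ask (H := H) (P := M H) (Primrec.const 3) (HC.goto hc)
    (HC.ret (f := fun a => a.2) (by fun_prop))).closure
  refine ⟨k (), fun F W => realizes_iff.2 fun W' _ ξ hξ s hs => ?_⟩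
  obtain ⟨f, ξ, rfl⟩ := ξ.exists_cons
  obtain rfl := ξ.eq_nil
  simp only [Args.toEnv_cons] at hs
  rcases hs with _ | ⟨hf, _⟩
  rw [hk]
  exact ⟨f, fun n => hf.val_one nat_mem_M (hl' n _ _), rfl⟩

theorem zero_mem_M_two : (fun _ => 0) ∈ M H (Ty.pure 2) :=
  mem_M_two (fun _ _ => rfl) (c := act (retAct 0)) fun _ _ => val_act_ret.2 rfl

/-- With `F` as oracle, one configuration computes `Mo F G` for all `F`. A spike at a function not
asked about at `F = 0` leaves the value unchanged and yet exceeds it. -/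
theorem Normal.not_wpr (hH : Normal H) {Mo : ((ℕ → ℕ) → ℕ) → ((ℕ → ℕ) → ℕ) → ℕ}
    (hMo : Mo ∈ M H (Ty.arr (Ty.pure 2) (Ty.arr (Ty.pure 2) Ty.nat))) : ¬ WPR (M H) Mo := by
  intro h
  obtain ⟨G, hG, s, hs, hL⟩ := hH.exists_escape
  obtain ⟨a, ha⟩ := HasRealizer.of_mem hMo
  obtain ⟨b, hb⟩ := HasRealizer.of_mem hG
  obtain ⟨r, hr⟩ := exists_oracle_realizer H
  have hv : ∀ F : (ℕ → ℕ) → ℕ, F ∈ M H (Ty.pure 2) →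
      Val H (M H) F [] (run a (Encodable.encode [r, b])) (Mo F G) := by
    intro F hF
    refine (ha F []).val (ξ := Args.cons F (Args.cons G Args.nil)) ?_ ?_
    · exact Args.cons_in.2 ⟨hF, Args.cons_in.2 ⟨hG, Args.nil_in⟩⟩
    · simp only [Args.toEnv_cons]
      exact .cons (hr F []) (.cons (hb F []) .nil)
  obtain ⟨g, hg, hgs, hg'⟩ := exists_not_queried (hv _ zero_mem_M_two) s hs (Mo (fun _ => 0) G)
  have hS := hH.spike_mem hg.1 (Mo (fun _ => 0) G + 1)
  have h1 := hg' (spike g (Mo (fun _ => 0) G + 1)) fun u hu => if_neg hu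
  have h2 := h _ G hS hG (hL g _ hgs) g hg
  rw [← h1.unique (hv _ hS), spike, if_pos rfl] at h2
  omega

end Nodes

/-! ## Pincherle's theorem -/

section Pincherle

variable {H : (ℕ → ℕ) → ℕ} {α : Type} [Primcodable α]

open Classical in
/-- The predicate `φ` is decided by the machine. -/
def Decided (H : (ℕ → ℕ) → ℕ) (φ : α → Prop) : Prop :=
  ∃ f : α → ℕ, Primrec f ∧ ∀ a, Val H (M H) (fun _ => 0) [] (f a) (if φ a then 0 else 1)

theorem Decided.not {φ : α → Prop} (h : Decided H φ) : Decided H fun a => ¬ φ a := by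
  obtain ⟨f, hf, hf'⟩ := h
  obtain ⟨g, hg, hg'⟩ := (HC.goto (H := H) (P := M H) hf).bind
    (HC.ret (f := fun a => 1 - a.2) (by fun_prop))
  refine ⟨g, hg, fun a => (hg' _ _ _ _).2 ⟨_, hf' a, ?_⟩⟩
  by_cases h : φ a <;> simp [h]

theorem Decided.and {φ : α → Prop} {c : α → ℕ} (hc : Primrec c) (h : Decided H φ) :
    Decided H fun a => c a = 0 ∧ φ a := by
  obtain ⟨f, hf, hf'⟩ := h
  obtain ⟨g, hg, hg'⟩ := HC.ite (H := H) (P := M H) hc (Primrec.const 0) (HC.goto hf)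
    (HC.ret (f := fun _ => 1) (by fun_prop))
  refine ⟨g, hg, fun a => (hg' _ _ _ _).2 ?_⟩
  by_cases h : c a = 0
  · dsimp only
    rw [if_pos h]
    convert hf' a using 1
    split_ifs <;> tauto
  · dsimp only
    rw [if_neg h, if_neg fun h' => h h'.1]

theorem Normal.decided_exists (hH : Normal H) {φ : α × ℕ → Prop} (h : Decided H φ) :
    Decided H fun a => ∃ n, φ (a, n) := by
  classical
  obtain ⟨f, hf, hf'⟩ := h
  obtain ⟨g, hg, hg'⟩ := hH.exists_quantifier hf
  refine ⟨g, hg, fun a => ?_⟩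
  have := hg' _ a _ fun n => hf' (a, n)
  convert this using 1
  by_cases h : ∃ n, φ (a, n)
  · rw [if_pos h, existsTwo_of_exists (h.imp fun n hn => if_pos hn)]
  · rw [if_neg h, existsTwo_of_not fun n => by rw [if_neg fun hn => h ⟨n, hn⟩]; exact one_ne_zero]

theorem Decided.forall (hH : Normal H) {φ : α × ℕ → Prop} (h : Decided H φ) :
    Decided H fun a => ∀ n, φ (a, n) := by
  have := (hH.decided_exists h.not).not
  simpa using this

theorem Decided.eq {f : α → ℕ} {y c : α → ℕ} (hf : Primrec f) (hc : Primrec c)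
    (h : ∀ a, Val H (M H) (fun _ => 0) [] (f a) (y a)) : Decided H fun a => y a = c a := by
  obtain ⟨g, hg, hg'⟩ := (HC.goto (H := H) (P := M H) hf).bind
    (HC.ite (c := fun a => a.2) (d := fun a => c a.1) (by fun_prop) (by fun_prop)
      (HC.ret (f := fun _ => 0) (by fun_prop)) (HC.ret (f := fun _ => 1) (by fun_prop)))
  refine ⟨g, hg, fun a => (hg' _ _ _ _).2 ⟨_, h a, ?_⟩⟩
  dsimp only
  split_ifs <;> rfl

/-- A sequence in Cantor space has a cluster point. -/
theorem Normal.exists_cluster_point (hH : Normal H) {f : ℕ × ℕ → ℕ} (hf : Primrec f)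
    {y : ℕ → ℕ → ℕ} (hy : ∀ n i, Val H (M H) (fun _ => 0) [] (f (n, i)) (y n i))
    (h1 : ∀ n i, y n i ≤ 1) :
    ∃ g ∈ Cantor (M H), ∀ m K, ∃ n, m ≤ n ∧ ∀ i < K, y n i = g i := by
  classical
  -- `T s`: infinitely many `y n` begin with `s`. The bounds are written as vanishing differences to
  -- fit `Decided.and`; with only number quantifiers, `∃²` decides `T`.
  let T : List ℕ → Prop := fun s => ∀ m, ∃ n, m - n = 0 ∧ ∀ i, ¬ (i + 1 - s.length = 0 ∧
    ¬ y n i = s.getD i 0)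
  have hT : Decided H T := by
    have h0 := Decided.eq (H := H) (α := ((List ℕ × ℕ) × ℕ) × ℕ) (f := fun a => f (a.1.2, a.2))
      (y := fun a => y a.1.2 a.2) (c := fun a => a.1.1.1.getD a.2 0) (by fun_prop) (by fun_prop)
      fun a => hy a.1.2 a.2
    have h2 := h0.not.and (c := fun a => a.2 + 1 - a.1.1.1.length) (by fun_prop)
    have h3 := (h2.not.forall hH).and (c := fun a => a.1.2 - a.2) (by fun_prop)
    exact (hH.decided_exists h3).forall hH
  have hTiff : ∀ s, T s ↔ ∀ m, ∃ n, m ≤ n ∧ ∀ i < s.length, y n i = s.getD i 0 := by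
    intro s
    refine forall_congr' fun m => exists_congr fun n => and_congr (by omega) ?_
    refine forall_congr' fun i => ?_
    rw [not_and_not_right]
    exact imp_congr (by omega) Iff.rfl
  have hstep : ∀ s, T s → T (s ++ [0]) ∨ T (s ++ [1]) := by
    intro s hs
    by_contra! h
    simp only [hTiff] at h hs
    push Not at h
    obtain ⟨⟨m, hm⟩, ⟨m', hm'⟩⟩ := h
    obtain ⟨n, hn, hn'⟩ := hs (max m m')
    have key : ∀ b, y n s.length = b → ∀ i < (s ++ [b]).length, y n i = (s ++ [b]).getD i 0 := by
      intro b hb i hi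
      rcases Nat.lt_or_ge i s.length with h | h
      · rw [hn' i h]
        simp [List.getElem?_append, h]
      · obtain rfl : i = s.length := by simp at hi; omega
        simp [hb]
    have := h1 n s.length
    rcases (show y n s.length = 0 ∨ y n s.length = 1 by omega) with h | h
    · obtain ⟨i, hi, hi'⟩ := hm n (by omega)
      exact hi' (key 0 h i hi)
    · obtain ⟨i, hi, hi'⟩ := hm' n (by omega)
      exact hi' (key 1 h i hi)
  obtain ⟨t, ht, ht'⟩ := hT
  -- The leftmost path through `T`, which by `hstep` never leaves it.
  let g' : List ℕ → ℕ := fun s => if T (s ++ [0]) then 0 else 1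
  let S : ℕ → List ℕ := fun k => Nat.rec [] (fun _ s => s ++ [g' s]) k
  have hS : ∀ k, S (k + 1) = S k ++ [g' (S k)] := fun _ => rfl
  have hlen : ∀ k, (S k).length = k := fun k => by
    induction k with
    | zero => rfl
    | succ k ih => rw [hS, List.length_append, ih]; rfl
  have hTS : ∀ k, T (S k) := fun k => by
    induction k with
    | zero => exact (hTiff _).2 fun m => ⟨m, le_rfl, fun i hi => absurd hi (Nat.not_lt_zero i)⟩
    | succ k ih =>
      rw [hS]
      by_cases h : T (S k ++ [0])
      · simpa only [g', if_pos h] using h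
      · simpa only [g', if_neg h] using (hstep _ ih).resolve_left h
  have hget : ∀ k i, i < k → (S k).getD i 0 = g' (S i) := fun k => by
    induction k with
    | zero => intro i hi; omega
    | succ k ih =>
      intro i hi
      rw [hS]
      rcases Nat.lt_or_ge i k with h | h
      · rw [← ih i h]
        simp [List.getElem?_append, hlen, h]
      · obtain rfl : i = k := by omega
        simp [hlen]
  have hgmem : (fun i => g' (S i)) ∈ M H (Ty.pure 1) := by
    have ht0 : Primrec fun a : (ℕ × ℕ) × ℕ => t (toList a.2 ++ [0]) := ht.comp (by fun_prop)
    obtain ⟨p, hp⟩ := (HC.ite (H := H) (P := M H) (α := ℕ × ℕ) (c := fun a => a.2)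
      (d := fun _ => 0) (by fun_prop) (by fun_prop)
      (HC.ret (f := fun _ => Encodable.encode ([] : List ℕ)) (by fun_prop))
      ((HC.goto (f := fun a => run a.1 (Encodable.encode (a.2 - 1))) (by fun_prop)).bind
        ((HC.goto ht0).bind (HC.ret (f := fun a => Encodable.encode (toList a.1.2 ++ [a.2]))
          (by fun_prop))))).fix
    have hpS : ∀ k, Val H (M H) (fun _ => 0) [] (run p (Encodable.encode k))
        (Encodable.encode (S k)) := by
      intro k
      induction k with
      | zero => exact (hp _ _ _ _).2 (by simp [S])
      | succ k ih =>
        rw [hp]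
        dsimp only
        rw [if_neg k.succ_ne_zero]
        refine ⟨_, ih, g' (S k), ?_, by simp [hS, toList]⟩
        convert ht' (S k ++ [0]) using 1
        simp [toList]
    have ht1 : Primrec fun a : (Unit × ℕ) × ℕ => t (toList a.2 ++ [0]) := ht.comp (by fun_prop)
    obtain ⟨q, -, hq⟩ := ((HC.goto (H := H) (P := M H) (α := Unit × ℕ)
      (f := fun a => run p (Encodable.encode a.2)) (by fun_prop)).bind (HC.goto ht1)).closure
    refine mem_M_one_iff.2 ⟨q (), fun n => (hq () n _ _ _).2 ⟨_, hpS n, ?_⟩⟩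
    convert ht' (S n ++ [0]) using 1
    simp [toList]
  refine ⟨fun i => g' (S i), ⟨hgmem, fun n => ?_⟩, fun m K => ?_⟩
  · dsimp only [g']
    split_ifs <;> omega
  · obtain ⟨n, hn, h⟩ := (hTiff _).1 (hTS K) m
    exact ⟨n, hn, fun i hi => by rw [h i (by rwa [hlen]), hget K i hi]⟩

/-- If `F` were unbounded, selection would give functions `y n` with `n < F (y n)` uniformly in `n`,
and `LOC` fails at a cluster point of this sequence. -/
theorem Normal.pito (hH : Normal H) : PITo (M H) := by
  intro F G hF hG
  by_contra! hN
  have hL : LOC (M H) F G := (hN 0).1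
  obtain ⟨r, hr⟩ := HasRealizer.of_mem hF
  obtain ⟨k, hk, hk'⟩ := exists_realizer_one H
  have hrk : Primrec fun a : (ℕ × ℕ) × ℕ => run r (Encodable.encode [k a.1.2]) :=
    primrec_run (by fun_prop) (Prim.encode (Prim.cons (by fun_prop) (hk.comp (by fun_prop))))
  -- Terminates exactly if `e` computes a 0-1 function `y` with `n < F y`; the question to `H`
  -- enforces totality and the bound 1.
  obtain ⟨d, hd, hd'⟩ := HC.ask (H := H) (P := M H) (α := ℕ × ℕ) (Primrec.const 1)
    ((HC.goto (f := fun a : (ℕ × ℕ) × ℕ => run a.1.2 a.2) (by fun_prop)).bind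
      (HC.ite (c := fun a => a.2 - 1) (d := fun _ => 0) (by fun_prop) (by fun_prop)
        (HC.ret (f := fun _ => 0) (by fun_prop)) HC.stuck))
    ((HC.goto hrk).bind (HC.ite (c := fun a => a.1.1.1 + 1 - a.2) (d := fun _ => 0) (by fun_prop)
      (by fun_prop) (HC.ret (f := fun _ => 0) (by fun_prop)) HC.stuck))
  have hval : ∀ e (y : ℕ → ℕ), (∀ i, Val H (M H) (fun _ => 0) [] (run e i) (y i)) →
      Val H (M H) (fun _ => 0) [] (run r (Encodable.encode [k e])) (F y) := by
    intro e y hy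
    refine (hr _ []).val (ξ := Args.cons y Args.nil) ?_ ?_
    · exact Args.cons_in.2 ⟨mem_M_one_iff.2 ⟨e, hy⟩, Args.nil_in⟩
    · simp only [Args.toEnv_cons]
      exact .cons (hk' e y _ _ hy) .nil
  have hconv : ∀ n e, (∃ v, Val H (M H) (fun _ => 0) [] (d (n, e)) v) ↔ ∃ y : ℕ → ℕ,
      (∀ i, Val H (M H) (fun _ => 0) [] (run e i) (y i)) ∧ (∀ i, y i ≤ 1) ∧ n < F y := by
    intro n e
    constructor
    · rintro ⟨v, hv⟩
      obtain ⟨u, hu, w, hw, hv⟩ := (hd' _ _ _ _).1 hv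
      choose y hy hu using hu
      refine ⟨y, hy, fun i => ?_, ?_⟩
      · have := hu i
        dsimp only at this
        split_ifs at this
        omega
      · obtain rfl := hw.unique (hval e y hy)
        dsimp only at hv
        split_ifs at hv
        omega
    · rintro ⟨y, hy, h1, hn⟩
      refine ⟨0, (hd' _ _ _ _).2 ⟨fun _ => 0, fun i => ⟨y i, hy i, ?_⟩, F y, hval e y hy, ?_⟩⟩
      · dsimp only
        rw [if_pos (by have := h1 i; omega)]
      · dsimp only
        rw [if_pos (by omega)]
  obtain ⟨g, hg, hg'⟩ := hH.exists_selection hd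
  have : ∀ n : ℕ, ∃ (e : ℕ) (y : ℕ → ℕ), Val H (M H) (fun _ => 0) [] (g n) e ∧
      (∀ i, Val H (M H) (fun _ => 0) [] (run e i) (y i)) ∧ (∀ i, y i ≤ 1) ∧ n < F y := by
    intro n
    obtain ⟨-, y, hy, hFy⟩ := hN n
    obtain ⟨p, hp⟩ := mem_M_one_iff.1 hy.1
    obtain ⟨v, hv⟩ := (hconv n p).2 ⟨y, hp, hy.2, hFy⟩
    obtain ⟨e, v, he, hv⟩ := hg' _ n ⟨p, v, hv⟩
    obtain ⟨y, h⟩ := (hconv n e).1 ⟨v, hv⟩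
    exact ⟨e, y, he, h⟩
  choose e y he hy h1 hFy using this
  obtain ⟨f, hf, hf'⟩ := (HC.goto (H := H) (P := M H) (α := ℕ × ℕ) (f := fun a => g a.1)
    (by fun_prop)).bind (HC.goto (f := fun a => run a.2 a.1.2) (by fun_prop))
  obtain ⟨z, hz, hz'⟩ := hH.exists_cluster_point hf (y := y)
    (fun n i => (hf' _ _ _ _).2 ⟨e n, he n, hy n i⟩) h1
  -- Taking `n ≥ G z` with agreement below `G z` yields `n < F (y n) ≤ G z ≤ n`.
  obtain ⟨n, hn, h⟩ := hz' (G z) (G z)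
  have := hL z hz (y n) ⟨mem_M_one_iff.2 ⟨e n, hy n⟩, h1 n⟩ h
  have := hFy n
  omega

end Pincherle

end HigherType

theorem mainTheorem5 (H : (ℕ → ℕ) → ℕ) (hH : HigherType.Normal H) :
    HigherType.QFAC (HigherType.M H) (HigherType.Ty.pure 0) (HigherType.Ty.pure 1) ∧
    ¬ HigherType.PITu (HigherType.M H) ∧
    HigherType.PITo (HigherType.M H) ∧
    (∀ Mo ∈ HigherType.M H
        (HigherType.Ty.arr (HigherType.Ty.pure 2)
          (HigherType.Ty.arr (HigherType.Ty.pure 2) HigherType.Ty.nat)),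
      ¬ HigherType.WPR (HigherType.M H) Mo) ∧
    (∀ Mu ∈ HigherType.M H (HigherType.Ty.pure 3), ¬ HigherType.PR (HigherType.M H) Mu) := by
  exact ⟨hH.qfac, hH.not_pitu, hH.pito, fun _ hMo => hH.not_wpr hMo, fun Mu _ => hH.not_pr Mu⟩
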